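/- Conventions. $\mathbb H^n$ is the Poincaré ball $\{|x|<1\}$ with metric $b=\rho^{-2}\delta$, $\rho(x)=(1-|x|^2)/2$; $B_R$ denotes hyperbolic balls (centred at $0$ if no centre is given). Let $\alpha\in(0,1)$, $\tau>0$. A complete Riemannian $n$-manifold $(M,g)$, possibly with boundary, with a symmetric 2-tensor $K$, $g\in C^{2,\alpha}_{loc}$, $K\in C^{1,\alpha}_{loc}$, is a $C^{2,\alpha}_\tau$ asymptotically anti-de Sitter initial data set if there are a compact $K_0\subset M$, $R_0>0$ and a diffeomorphism $\Psi:M\setminus K_0\to\mathbb H^n\setminus\overline{B_{R_0}}$ with $$\sup_{x\notin\overline{B_{R_0+1}}}\rho(x)^{-\tau}\|\Psi_*g-b\|_{C^{2,\alpha}(B_1(x))}<\infty,\qquad \sup_{x\notin\overline{B_{R_0+1}}}\rho(x)^{-\tau}\|\Psi_*K\|_{C^{1,\alpha}(B_1(x))}<\infty,$$ where the $C^{k,\alpha}(B_1(x))$ norms of tensors are measured at the scale of $b$. We fix $\Psi$ and a positive $C^2$ function $\rho$ on $M$ which equals $\rho\circ\Psi$ outside a compact set; both are regarded as part of the data $(M,g,K)$.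 For $v\in C^2(M)$ put $|v|_{C^{2,0}_0(M)}=\sup_M|v|+\sup_M|dv|_g+\sup_M|\nabla^2v|_g$. For a positive function $u$ on $M$, $M\times_u\mathbb R$ is $\widetilde M=M\times\mathbb R$ with metric $\widetilde g=g+u^2dt^2$. For an open set $U\subset M$ and $f\in C^3_{loc}(U)$, let $\Gamma(f)=\{(x,f(x)):x\in U\}$, with induced metric $\overline g=g+u^2df^2$, downward pointing unit normal $\nu$, and mean curvature $H=\operatorname{tr}_{\overline g}A$, $A(X,Y)=\langle\widetilde\nabla_X\nu,Y\rangle$. For a $C^1$ function $F:T\widetilde M\to\mathbb R$, written $F(x,t,X)$ with $X\in T_{(x,t)}\widetilde M\cong T_xM\oplus\mathbb R$, let $D=\{|X|_{\widetilde g}\le1\}$ and $|F|_{C^1(D)}=\sup_D|F|+\sup_D|dF|$, where $|dF|$ is measured in the Sasaki metric of $\widetilde g$. Proposition. Let $(M,g,K)$ be a $C^{2,\alpha}_\tau$ asymptotically anti-de Sitter initial data set, and let $A\in\mathbb R$, $m>0$, $C_0\in\mathbb R$. There is a constant $C>0$, depending only on $(M,g,K)$, $A$, $m$ and $C_0$,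 such that the following holds. Let $u:M\to\mathbb R$ satisfy $u\ge m$, $u-\rho^{-1}\in C^2(M)$ and $|u-\rho^{-1}|_{C^{2,0}_0(M)}\le A$. Let $U\subset M$ be open, $f\in C^3_{loc}(U)$, and let $F:T\widetilde M\to\mathbb R$ be a $C^1$ function with $|F|_{C^1(D)}\le C_0$ such that $t\mapsto F(x,t,X)$ is non-decreasing for all $x\in M$ and $X\in T_xM\oplus\mathbb R$, and such that $H(p)=F(p,\nu(p))$ for all $p\in\Gamma(f)$. Then $w=\langle u^{-1}\partial_t,-\nu\rangle$, regarded as a function on $U\cong\Gamma(f)$, satisfies $$\Delta^{\overline g}(w^{1/2})\le C\,w^{1/2}\quad\text{on }U.$$ -/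

import Mathlib

open Set Filter Manifold
open scoped Topology ContDiff NNReal ENNReal

noncomputable section

namespace WarpedGraph

section Shortcuts

/-! Shortcuts to Mathlib's norms on bilinear and trilinear forms, for instance search only. -/

variable {E : Type*} [NormedAddCommGroup E] [NormedSpace ℝ E]

instance instNormedAddCommGroupBilin : NormedAddCommGroup (E →L[ℝ] E →L[ℝ] ℝ) :=
  ContinuousLinearMap.toNormedAddCommGroup

instance instNormedSpaceBilin : NormedSpace ℝ (E →L[ℝ] E →L[ℝ] ℝ) :=
  ContinuousLinearMap.toNormedSpace

instance instNormedAddCommGroupTrilin : NormedAddCommGroup (E →L[ℝ] E →L[ℝ] E →L[ℝ] ℝ) :=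
  ContinuousLinearMap.toNormedAddCommGroup

instance instNormedSpaceTrilin : NormedSpace ℝ (E →L[ℝ] E →L[ℝ] E →L[ℝ] ℝ) :=
  ContinuousLinearMap.toNormedSpace

end Shortcuts

section Koszul

variable {E : Type*} [NormedAddCommGroup E] [NormedSpace ℝ E]

/-- The Christoffel symbols of the first kind of a metric with first derivatives
`D y v w = ∂_y h(v, w)`, namely
`koszul D v w y = (∂_v h(w, y) + ∂_w h(v, y) - ∂_y h(v, w)) / 2`. -/
def koszul (D : E →L[ℝ] E →L[ℝ] E →L[ℝ] ℝ) : E →L[ℝ] E →L[ℝ] E →L[ℝ] ℝ :=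
  (1 / 2 : ℝ) • (D + D.flip
    - ((ContinuousLinearMap.flipₗᵢ ℝ E E ℝ).toContinuousLinearEquiv :
        (E →L[ℝ] E →L[ℝ] ℝ) →L[ℝ] (E →L[ℝ] E →L[ℝ] ℝ)) ∘L D.flip)

theorem koszul_apply (D : E →L[ℝ] E →L[ℝ] E →L[ℝ] ℝ) (v w y : E) :
    koszul D v w y = (D v w y + D w v y - D y v w) / 2 := by
  change (1 / 2 : ℝ) * (D v w y + D w v y - D y v w) = _
  ring

end Koszul

/-! ### Pointwise linear algebra -/

section Pointwise

variable {V W : Type*} [AddCommGroup V] [Module ℝ V] [TopologicalSpace V]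
  [IsTopologicalAddGroup V] [ContinuousConstSMul ℝ V]
  [AddCommGroup W] [Module ℝ W] [TopologicalSpace W]
  [IsTopologicalAddGroup W] [ContinuousConstSMul ℝ W]

/-- The pullback `(v, w) ↦ B (S v) (T w)` of a bilinear form. -/
def pullForm (B : W →L[ℝ] W →L[ℝ] ℝ) (S T : V →L[ℝ] W) : V →L[ℝ] V →L[ℝ] ℝ :=
  ContinuousLinearMap.precomp ℝ T ∘L (B ∘L S)

/-- The trace `g^{ij} B_{ij}` of a bilinear form `B` with respect to a nondegenerate
bilinear form `g`; here `g.inverse` is the index-raising map. -/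
def metricTrace (g B : V →L[ℝ] V →L[ℝ] ℝ) : ℝ :=
  LinearMap.trace ℝ V (g.inverse ∘L B : V →L[ℝ] V).toLinearMap

end Pointwise

/-! ### Riemannian geometry in charts

All objects at a point `p` are computed in the preferred chart at `p`, with derivatives taken within
the range of the model with corners, so that boundary points are allowed. -/

section Geometry

variable {E : Type*} [NormedAddCommGroup E] [NormedSpace ℝ E]
  {H : Type*} [TopologicalSpace H] (I : ModelWithCorners ℝ E H)
  (M : Type*) [TopologicalSpace M] [ChartedSpace H M]

/-- Fields of bilinear forms (covariant 2-tensors) on a manifold. -/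
abbrev FormField : Type _ :=
  ∀ x : M, TangentSpace I x →L[ℝ] TangentSpace I x →L[ℝ] ℝ

variable {I M} [IsManifold I 1 M]

/-- The components of a covariant 2-tensor in the preferred chart at `p`, as a function of the
coordinate `y`. The map `A` sends the components in that chart of a vector at the point `x` with
coordinate `y` to the vector itself. -/
def formInChart (h : FormField I M) (p : M) (y : E) : E →L[ℝ] E →L[ℝ] ℝ :=
  let x := (extChartAt I p).symm y
  let A : E →L[ℝ] TangentSpace I x := tangentCoordChange I p x x
  pullForm (h x) A A

/-- The 2-tensor `h` is of class `C^{k,α}_loc`: in every preferred chart the components are `C^k` and their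
`k`-th derivative is locally `α`-Hölder continuous. -/
def IsHolderForm (k : ℕ) (α : ℝ≥0) (h : FormField I M) : Prop :=
  ∀ p : M, ContDiffOn ℝ k (formInChart h p) (extChartAt I p).target ∧
    ∀ y ∈ (extChartAt I p).target, ∃ C : ℝ≥0, ∃ s ∈ 𝓝[(extChartAt I p).target] y,
      HolderOnWith C α
        (iteratedFDerivWithin ℝ k (formInChart h p) (extChartAt I p).target) s

/-- First derivatives of the components of `h` at `p`: `dForm h p y v w = ∂_y h(v, w)`. -/
def dForm (h : FormField I M) (p : M) : E →L[ℝ] E →L[ℝ] E →L[ℝ] ℝ :=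
  fderivWithin ℝ (formInChart h p) (range I) (extChartAt I p p)

/-- The Christoffel symbols `Γ(v, w) = Γ^k_{ij} v^i w^j ∂_k` of the metric `h` at `p`. -/
def christoffel (h : FormField I M) (p : M) : E →L[ℝ] E →L[ℝ] E :=
  ContinuousLinearMap.compL ℝ E (E →L[ℝ] ℝ) E
    (ContinuousLinearMap.inverse (formInChart h p (extChartAt I p p))) ∘L koszul (dForm h p)

/-- The differential of a function. -/
def diff (v : M → ℝ) (x : M) : TangentSpace I x →L[ℝ] ℝ :=
  mfderiv I 𝓘(ℝ, ℝ) v x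

/-- The coordinate expression of the differential of a function in the chart at `p`. -/
def dInChart (I : ModelWithCorners ℝ E H) (v : M → ℝ) (p : M) (y : E) : E →L[ℝ] ℝ :=
  fderivWithin ℝ (fun z => v ((extChartAt I p).symm z)) (range I) y

/-- The Hessian `∂_i ∂_j v - Γ^k_{ij} ∂_k v` of a function. -/
def hessian (h : FormField I M) (v : M → ℝ) (x : M) :
    TangentSpace I x →L[ℝ] TangentSpace I x →L[ℝ] ℝ :=
  show E →L[ℝ] E →L[ℝ] ℝ from
    fderivWithin ℝ (dInChart I v x) (range I) (extChartAt I x x)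
      - ContinuousLinearMap.compL ℝ E E ℝ (dInChart I v x (extChartAt I x x)) ∘L christoffel h x

/-- The Laplace-Beltrami operator of the metric `h`. -/
def laplacian (h : FormField I M) (v : M → ℝ) (x : M) : ℝ :=
  metricTrace (h x) (hessian h v x)

/-- The connection map `T_X(TM) → T_p M` of the Levi-Civita connection of `h`, where `X ∈ T_p M`.
A vector `ζ` tangent to `TM` at `X` has, in the bundle chart over the preferred chart at `p`,
a base part `ζ.1` and a fibre part `ζ.2`, and it is sent to `ζ.2 + Γ(ζ.1, X)`. -/
def connectionMap (h : FormField I M) (X : TangentBundle I M) :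
    TangentSpace I.tangent X →L[ℝ] TangentSpace I X.proj :=
  show E × E →L[ℝ] E from
    ContinuousLinearMap.snd ℝ E E + (christoffel h X.proj).flip X.snd ∘L
      ContinuousLinearMap.fst ℝ E E

/-- The squared Sasaki norm of a vector tangent to the tangent bundle. -/
def sasakiSq (h : FormField I M) (X : TangentBundle I M) (ζ : TangentSpace I.tangent X) : ℝ :=
  let Y : TangentSpace I X.proj := (show E × E from ζ).1
  h X.proj Y Y + h X.proj (connectionMap h X ζ) (connectionMap h X ζ)

/-- `|F|_{C^1(D)} ≤ C₀` for the unit disc bundle `D = {X : |X|_h ≤ 1}`: the sum of the supremum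
over `D` of `|F|` and of the Sasaki norm of `dF` is at most `C₀`. -/
def C1NormLE (h : FormField I M) (F : TangentBundle I M → ℝ) (C₀ : ℝ) : Prop :=
  ∃ a b : ℝ, 0 ≤ a ∧ 0 ≤ b ∧ a + b ≤ C₀ ∧ ∀ X : TangentBundle I M, h X.proj X.snd X.snd ≤ 1 →
    |F X| ≤ a ∧
    ∀ ζ : TangentSpace I.tangent X,
      |diff (I := I.tangent) F X ζ| ≤ b * √(sasakiSq h X ζ)

/-- `|v|_{C^2} ≤ A` over the whole manifold, i.e. `v` is `C^2` and
`sup |v| + sup |dv|_h + sup |∇²v|_h ≤ A`. -/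
def C2NormLE (h : FormField I M) (v : M → ℝ) (A : ℝ) : Prop :=
  ContMDiff I 𝓘(ℝ, ℝ) 2 v ∧
  ∃ a₀ a₁ a₂ : ℝ, 0 ≤ a₀ ∧ 0 ≤ a₁ ∧ 0 ≤ a₂ ∧ a₀ + a₁ + a₂ ≤ A ∧ ∀ x : M,
    |v x| ≤ a₀ ∧
    (∀ X : TangentSpace I x, |diff v x X| ≤ a₁ * √(h x X X)) ∧
    (∀ X Y : TangentSpace I x, |hessian h v x X Y| ≤ a₂ * √(h x X X) * √(h x Y Y))

end Geometry

/-! ### Submanifolds and warped products -/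

section Warped

variable {E : Type*} [NormedAddCommGroup E] [NormedSpace ℝ E]
  {H : Type*} [TopologicalSpace H] {I : ModelWithCorners ℝ E H}
  {M : Type*} [TopologicalSpace M] [ChartedSpace H M]
  {E' : Type*} [NormedAddCommGroup E'] [NormedSpace ℝ E']
  {H' : Type*} [TopologicalSpace H'] {J : ModelWithCorners ℝ E' H'}
  {N : Type*} [TopologicalSpace N] [ChartedSpace H' N] [IsManifold J 1 N]

/-- The covariant derivative `v ↦ ∇_v Z` at `x` of a vector field `Z` along a map `φ : M → N`. -/
def covDerivAlong (h : FormField J N) (φ : M → N) (Z : ∀ x : M, TangentSpace J (φ x)) (x : M) :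
    TangentSpace I x →L[ℝ] TangentSpace J (φ x) :=
  connectionMap h (⟨φ x, Z x⟩ : TangentBundle J N) ∘L
    mfderiv I J.tangent (fun x' => (⟨φ x', Z x'⟩ : TangentBundle J N)) x

/-- The second fundamental form `A(X, Y) = ⟨∇_X ν, Y⟩` of an immersion `φ : M → N` with normal
field `ν`. -/
def secondFundForm (h : FormField J N) (φ : M → N) (ν : ∀ x : M, TangentSpace J (φ x)) (x : M) :
    TangentSpace I x →L[ℝ] TangentSpace I x →L[ℝ] ℝ :=
  pullForm (h (φ x)) (covDerivAlong h φ ν x) (mfderiv I J φ x)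

/-- The mean curvature, i.e. the trace of the second fundamental form (the tangential divergence
of `ν`) with respect to the induced metric. -/
def meanCurvature (I : ModelWithCorners ℝ E H) (h : FormField J N) (φ : M → N)
    (ν : ∀ x : M, TangentSpace J (φ x)) (x : M) : ℝ :=
  metricTrace (pullForm (h (φ x)) (mfderiv I J φ x) (mfderiv I J φ x) :
      TangentSpace I x →L[ℝ] TangentSpace I x →L[ℝ] ℝ)
    (secondFundForm h φ ν x)

/-- The metric `g + u² dt²` on `M × ℝ`. -/
def warpedMetric (g : FormField I M) (u : M → ℝ) : FormField (I.prod 𝓘(ℝ, ℝ)) (M × ℝ) :=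
  fun p =>
    let S : TangentSpace (I.prod 𝓘(ℝ, ℝ)) p →L[ℝ] TangentSpace I p.1 :=
      ContinuousLinearMap.fst ℝ E ℝ
    let T : TangentSpace (I.prod 𝓘(ℝ, ℝ)) p →L[ℝ] ℝ := ContinuousLinearMap.snd ℝ E ℝ
    pullForm (g p.1) S S + (u p.1) ^ 2 • pullForm (ContinuousLinearMap.mul ℝ ℝ) T T

/-- The tangent vector `X + s ∂_t` at the point `p` of `M × ℝ`. -/
def tangentVec (p : M × ℝ) (X : TangentSpace I p.1) (s : ℝ) : TangentSpace (I.prod 𝓘(ℝ, ℝ)) p :=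
  show E × ℝ from (X, s)

/-- The graph embedding `x ↦ (x, f x)`. -/
def graphMap (f : M → ℝ) (x : M) : M × ℝ := (x, f x)

/-- The metric `g + u² df²` induced on the graph of `f`, transported to the domain of `f`
by the graph embedding. -/
def graphMetric (g : FormField I M) (u f : M → ℝ) : FormField I M :=
  fun x => g x + (u x) ^ 2 • pullForm (ContinuousLinearMap.mul ℝ ℝ) (diff f x) (diff f x)

/-- `ν` is the downward pointing unit normal of the graph of `f` over `U` in `M ×_u ℝ`. -/
def IsDownwardUnitNormal (g : FormField I M) (u f : M → ℝ) (U : Set M)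
    (ν : ∀ x : M, TangentSpace (I.prod 𝓘(ℝ, ℝ)) (graphMap f x)) : Prop :=
  ∀ x ∈ U,
    warpedMetric g u (graphMap f x) (ν x) (ν x) = 1 ∧
    (∀ X : TangentSpace I x,
      warpedMetric g u (graphMap f x) (ν x) (tangentVec (graphMap f x) X (diff f x X)) = 0) ∧
    (show E × ℝ from ν x).2 < 0

/-- The vertical part `⟨u⁻¹ ∂_t, -ν⟩` of the normal. -/
def verticalPart (g : FormField I M) (u f : M → ℝ)
    (ν : ∀ x : M, TangentSpace (I.prod 𝓘(ℝ, ℝ)) (graphMap f x)) (x : M) : ℝ :=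
  warpedMetric g u (graphMap f x) (tangentVec (graphMap f x) (0 : TangentSpace I x) (u x)⁻¹)
    (-ν x)

end Warped

/-! ### Hyperbolic space and asymptotically anti-de Sitter initial data -/

section Hyperbolic

variable {n : ℕ}

/-- The function `ρ = (1 - |x|²)/2` on the Poincaré ball. -/
def ballRho (x : EuclideanSpace ℝ (Fin n)) : ℝ := (1 - ‖x‖ ^ 2) / 2

/-- The hyperbolic metric `b = ρ⁻² δ` of the Poincaré ball. -/
def hypMetric (x : EuclideanSpace ℝ (Fin n)) :
    EuclideanSpace ℝ (Fin n) →L[ℝ] EuclideanSpace ℝ (Fin n) →L[ℝ] ℝ :=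
  ((ballRho x) ^ 2)⁻¹ • innerSL ℝ

/-- The hyperbolic distance on the Poincaré ball. -/
def hypDist (x y : EuclideanSpace ℝ (Fin n)) : ℝ :=
  Real.arcosh (1 + 2 * ‖x - y‖ ^ 2 / ((1 - ‖x‖ ^ 2) * (1 - ‖y‖ ^ 2)))

/-- The hyperbolic ball `B_r(x)`. -/
def hypBall (x : EuclideanSpace ℝ (Fin n)) (r : ℝ) : Set (EuclideanSpace ℝ (Fin n)) :=
  {y | ‖y‖ < 1 ∧ hypDist x y < r}

/-- The complement `ℍⁿ \ closure B_R(0)` of the closed hyperbolic ball of radius `R`. -/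
def hypExterior (n : ℕ) (R : ℝ) : Set (EuclideanSpace ℝ (Fin n)) :=
  {y | ‖y‖ < 1 ∧ R < hypDist 0 y}

/-- `‖T‖_{C^{k,α}(B_1(x))} ≤ c` for a covariant 2-tensor `T` on a part of the Poincaré ball that
contains `B_1(x)`. Derivatives are those of the Cartesian components, and each is measured in the
scale `ρ` of the hyperbolic metric: a covariant tensor of rank `j + 2` with Euclidean norm `a` at `y`
has hyperbolic norm `ρ(y)^{j+2} a`. -/
def HypHolderNormLE (k : ℕ) (α : ℝ≥0)
    (T : EuclideanSpace ℝ (Fin n) →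
      EuclideanSpace ℝ (Fin n) →L[ℝ] EuclideanSpace ℝ (Fin n) →L[ℝ] ℝ)
    (x : EuclideanSpace ℝ (Fin n)) (c : ℝ) : Prop :=
  (∀ j ≤ k, ∀ y ∈ hypBall x 1, ballRho y ^ (j + 2) * ‖iteratedFDeriv ℝ j T y‖ ≤ c) ∧
  (∀ y ∈ hypBall x 1, ∀ z ∈ hypBall x 1,
    ballRho x ^ ((k : ℝ) + 2 + α) * ‖iteratedFDeriv ℝ k T y - iteratedFDeriv ℝ k T z‖
      ≤ c * ‖y - z‖ ^ (α : ℝ))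

/-- Finiteness of the weighted norm `sup_x ρ(x)^{-τ} ‖T‖_{C^{k,α}(B_1(x))}`, the supremum being
over the points `x` outside the closed ball of radius `R₀ + 1`. -/
def HasWeightedDecay (R₀ : ℝ) (k : ℕ) (α : ℝ≥0) (τ : ℝ)
    (T : EuclideanSpace ℝ (Fin n) →
      EuclideanSpace ℝ (Fin n) →L[ℝ] EuclideanSpace ℝ (Fin n) →L[ℝ] ℝ) : Prop :=
  ∃ B : ℝ, ∀ x ∈ hypExterior n (R₀ + 1), HypHolderNormLE k α T x (B * ballRho x ^ τ)

variable {H : Type*} [TopologicalSpace H] (I : ModelWithCorners ℝ (EuclideanSpace ℝ (Fin n)) H)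
  (M : Type*) [TopologicalSpace M] [ChartedSpace H M]

/-- A chart at infinity: a diffeomorphism from the complement of a compact set `K₀` onto the
exterior of a closed ball in hyperbolic space. -/
structure ChartAtInfinity where
  K₀ : Set M
  isCompact_K₀ : IsCompact K₀
  R₀ : ℝ
  R₀_pos : 0 < R₀
  Ψ : OpenPartialHomeomorph M (EuclideanSpace ℝ (Fin n))
  source_eq : Ψ.source = K₀ᶜ
  target_eq : Ψ.target = hypExterior n R₀
  contMDiffOn : ContMDiffOn I 𝓘(ℝ, EuclideanSpace ℝ (Fin n)) ∞ Ψ Ψ.source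
  contMDiffOn_symm : ContMDiffOn 𝓘(ℝ, EuclideanSpace ℝ (Fin n)) I ∞ Ψ.symm Ψ.target

variable {I M}

/-- The push-forward `Ψ_* h` of a covariant 2-tensor by the chart at infinity. -/
def ChartAtInfinity.push (c : ChartAtInfinity I M) (h : FormField I M)
    (y : EuclideanSpace ℝ (Fin n)) :
    EuclideanSpace ℝ (Fin n) →L[ℝ] EuclideanSpace ℝ (Fin n) →L[ℝ] ℝ :=
  let D : EuclideanSpace ℝ (Fin n) →L[ℝ] TangentSpace I (c.Ψ.symm y) :=
    mfderiv 𝓘(ℝ, EuclideanSpace ℝ (Fin n)) I c.Ψ.symm y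
  pullForm (h (c.Ψ.symm y)) D D

variable [IsManifold I 1 M]

/-- `(M, g)` is `C^{k,α}_τ` asymptotically hyperbolic with chart at infinity `c`. -/
def IsAsymptoticallyHyperbolic (c : ChartAtInfinity I M) (k : ℕ) (α : ℝ≥0) (τ : ℝ)
    (g : FormField I M) : Prop :=
  IsHolderForm k α g ∧
  HasWeightedDecay c.R₀ k α τ (fun y => c.push g y - hypMetric y)

/-- `(M, g, K)` is a `C^{k,α}_τ` asymptotically anti-de Sitter initial data set with chart at
infinity `c` (where `k ≥ 1`). -/
def IsAsymptoticallyAdS (c : ChartAtInfinity I M) (k : ℕ) (α : ℝ≥0) (τ : ℝ)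
    (g K : FormField I M) : Prop :=
  IsAsymptoticallyHyperbolic c k α τ g ∧
  (∀ x X Y, K x X Y = K x Y X) ∧
  IsHolderForm (k - 1) α K ∧
  HasWeightedDecay c.R₀ (k - 1) α τ (c.push K)

/-- `ρ` is a positive `C^2` function on `M` which agrees with `(1 - |x|²)/2` in the chart at
infinity, outside some compact set. -/
def IsExtensionOfRho (c : ChartAtInfinity I M) (ρ : M → ℝ) : Prop :=
  (∀ x, 0 < ρ x) ∧ ContMDiff I 𝓘(ℝ, ℝ) 2 ρ ∧
  ∃ K₁ : Set M, IsCompact K₁ ∧ c.K₀ ⊆ K₁ ∧ ∀ x ∉ K₁, ρ x = ballRho (c.Ψ x)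

end Hyperbolic

section Complete

variable {E : Type*} [NormedAddCommGroup E] [NormedSpace ℝ E]
  {H : Type*} [TopologicalSpace H] {I : ModelWithCorners ℝ E H}
  {M : Type*} [TopologicalSpace M] [ChartedSpace H M] [IsManifold I 1 M]

open scoped Bundle in
/-- Completeness of a Riemannian metric: every sequence that is Cauchy for the Riemannian distance
(the infimum of the lengths of `C^1` paths) converges. -/
def IsCompleteMetric (g : Bundle.RiemannianMetric (fun x : M => TangentSpace I x)) : Prop :=
  letI : Bundle.RiemannianBundle (fun x : M => TangentSpace I x) := ⟨g⟩
  ∀ s : ℕ → M,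
    (∀ ε : ℝ≥0∞, 0 < ε → ∃ k, ∀ i ≥ k, ∀ j ≥ k, riemannianEDist I (s i) (s j) < ε) →
    ∃ x, Tendsto s atTop (𝓝 x)

end Complete

end WarpedGraph

end

open WarpedGraph

set_option linter.unusedSectionVars false
noncomputable section
namespace WarpedGraph

section LinearAlgebra

variable {E : Type*} [NormedAddCommGroup E] [NormedSpace ℝ E]

/-- Symmetric positive definite bilinear forms. -/
structure IsInner (B : E →L[ℝ] E →L[ℝ] ℝ) : Prop where
  symm : ∀ X Y, B X Y = B Y X
  pos : ∀ X, X ≠ 0 → 0 < B X X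

theorem IsInner.nonneg {B : E →L[ℝ] E →L[ℝ] ℝ} (hB : IsInner B) (X : E) : 0 ≤ B X X := by
  by_cases h : X = 0
  · simp [h]
  · exact (hB.pos X h).le

theorem IsInner.eq_zero {B : E →L[ℝ] E →L[ℝ] ℝ} (hB : IsInner B) {X : E} (h : B X X = 0) :
    X = 0 := by
  by_contra hX
  exact (hB.pos X hX).ne' h

theorem IsInner.ext {B : E →L[ℝ] E →L[ℝ] ℝ} (hB : IsInner B) {X Y : E}
    (h : ∀ Z, B X Z = B Y Z) : X = Y := by
  apply sub_eq_zero.1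
  apply hB.eq_zero
  have := h (X - Y)
  simp only [map_sub, _root_.sub_apply] at this ⊢
  linarith

theorem IsInner.sq_le {B : E →L[ℝ] E →L[ℝ] ℝ} (hB : IsInner B) (X Y : E) :
    B X Y ^ 2 ≤ B X X * B Y Y := by
  rcases eq_or_ne Y 0 with rfl | hY
  · simp
  have hp := hB.pos Y hY
  have h := hB.nonneg (B Y Y • X - B X Y • Y)
  simp only [map_sub, map_smul, _root_.sub_apply, _root_.smul_apply,
    smul_eq_mul, hB.symm Y X] at h
  have : 0 ≤ B Y Y * (B X X * B Y Y - B X Y ^ 2) := by linarith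
  have := nonneg_of_mul_nonneg_right this hp
  linarith

theorem IsInner.add_sq {B : E →L[ℝ] E →L[ℝ] ℝ} (hB : IsInner B) (η : E →L[ℝ] ℝ) {a : ℝ}
    (ha : 0 ≤ a) : IsInner (B + a • pullForm (ContinuousLinearMap.mul ℝ ℝ) η η) where
  symm X Y := by
    change B X Y + a * (η X * η Y) = B Y X + a * (η Y * η X)
    rw [hB.symm]; ring
  pos X hX := by
    change 0 < B X X + a * (η X * η X)
    have := hB.pos X hX
    have := mul_nonneg ha (mul_self_nonneg (η X))
    linarith

variable [FiniteDimensional ℝ E]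

theorem IsInner.injective {B : E →L[ℝ] E →L[ℝ] ℝ} (hB : IsInner B) :
    Function.Injective B := by
  intro X Y h
  exact hB.ext fun Z => by rw [h]

theorem IsInner.exists_equiv {B : E →L[ℝ] E →L[ℝ] ℝ} (hB : IsInner B) :
    ∃ e : E ≃L[ℝ] (E →L[ℝ] ℝ), (e : E →L[ℝ] E →L[ℝ] ℝ) = B := by
  have hfr : Module.finrank ℝ E = Module.finrank ℝ (E →L[ℝ] ℝ) := by
    rw [← (LinearMap.toContinuousLinearMap : (E →ₗ[ℝ] ℝ) ≃ₗ[ℝ] _).finrank_eq]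
    exact (Subspace.dual_finrank_eq (K := ℝ) (V := E)).symm
  refine ⟨(LinearEquiv.ofInjectiveOfFinrankEq B.toLinearMap hB.injective hfr).toContinuousLinearEquiv, ?_⟩
  ext X Y
  rfl

theorem IsInner.isInvertible {B : E →L[ℝ] E →L[ℝ] ℝ} (hB : IsInner B) :
    ContinuousLinearMap.IsInvertible B := by
  obtain ⟨e, he⟩ := hB.exists_equiv
  exact ⟨e, he⟩

theorem IsInner.inverse_apply {B : E →L[ℝ] E →L[ℝ] ℝ} (hB : IsInner B) (X : E) :
    B.inverse (B X) = X := by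
  obtain ⟨e, rfl⟩ := hB.exists_equiv
  simp

theorem IsInner.apply_inverse {B : E →L[ℝ] E →L[ℝ] ℝ} (hB : IsInner B) (η : E →L[ℝ] ℝ) :
    B (B.inverse η) = η := by
  obtain ⟨e, rfl⟩ := hB.exists_equiv
  simp

theorem IsInner.inverse_eq {B : E →L[ℝ] E →L[ℝ] ℝ} (hB : IsInner B) {X : E} {η : E →L[ℝ] ℝ}
    (h : ∀ Z, B X Z = η Z) : B.inverse η = X := by
  have : B X = η := ContinuousLinearMap.ext h
  rw [← this, hB.inverse_apply]

theorem IsInner.exists_basis {B : E →L[ℝ] E →L[ℝ] ℝ} (hB : IsInner B) :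
    ∃ b : Module.Basis (Fin (Module.finrank ℝ E)) ℝ E, ∀ i j, B (b i) (b j) = if i = j then 1 else 0 := by
  let B' : LinearMap.BilinForm ℝ E := ContinuousLinearMap.coeLM ℝ ∘ₗ B.toLinearMap
  have hB' : ∀ X Y, B' X Y = B X Y := fun X Y => rfl
  have hs : LinearMap.IsSymm B' := ⟨fun X Y => by simp [hB', hB.symm X Y]⟩
  obtain ⟨v, hv⟩ := LinearMap.BilinForm.exists_orthogonal_basis (K := ℝ) (V := E) (B := B') hs
  have hp : ∀ i, 0 < B (v i) (v i) := fun i => hB.pos _ (v.ne_zero i)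
  let u : Fin (Module.finrank ℝ E) → ℝˣ := fun i =>
    Units.mk0 (√(B (v i) (v i)))⁻¹ (inv_ne_zero (Real.sqrt_pos.2 (hp i)).ne')
  refine ⟨v.unitsSMul u, fun i j => ?_⟩
  simp only [Module.Basis.unitsSMul_apply, Units.smul_def, u, Units.val_mk0, map_smul,
    _root_.smul_apply, smul_eq_mul]
  split_ifs with h
  · subst h
    have := Real.mul_self_sqrt (hp i).le
    have h0 := (Real.sqrt_pos.2 (hp i)).ne'
    field_simp
    linarith
  · have : B (v i) (v j) = 0 := hv h
    simp [this]

theorem IsInner.basis_repr {B : E →L[ℝ] E →L[ℝ] ℝ} (_hB : IsInner B) {ι : Type*} [Fintype ι]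
    [DecidableEq ι]
    {b : Module.Basis ι ℝ E} (hb : ∀ i j, B (b i) (b j) = if i = j then 1 else 0) (X : E) (i : ι) :
    b.repr X i = B X (b i) := by
  conv_rhs => rw [← b.sum_repr X]
  simp only [map_sum, map_smul, _root_.sum_apply, _root_.smul_apply, hb, smul_eq_mul]
  simp

theorem IsInner.trace_eq {B : E →L[ℝ] E →L[ℝ] ℝ} (hB : IsInner B) {ι : Type*} [Fintype ι]
    [DecidableEq ι]
    {b : Module.Basis ι ℝ E} (hb : ∀ i j, B (b i) (b j) = if i = j then 1 else 0)
    (T : E →L[ℝ] E) :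
    LinearMap.trace ℝ E T.toLinearMap = ∑ i, B (T (b i)) (b i) := by
  rw [LinearMap.trace_eq_matrix_trace ℝ b, Matrix.trace]
  refine Finset.sum_congr rfl fun i _ => ?_
  rw [Matrix.diag_apply, LinearMap.toMatrix_apply, hB.basis_repr hb]
  rfl

theorem IsInner.metricTrace_eq {B : E →L[ℝ] E →L[ℝ] ℝ} (hB : IsInner B) {ι : Type*} [Fintype ι]
    [DecidableEq ι]
    {b : Module.Basis ι ℝ E} (hb : ∀ i j, B (b i) (b j) = if i = j then 1 else 0)
    (T : E →L[ℝ] E →L[ℝ] ℝ) :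
    metricTrace B T = ∑ i, T (b i) (b i) := by
  rw [metricTrace, hB.trace_eq hb]
  refine Finset.sum_congr rfl fun i _ => ?_
  rw [ContinuousLinearMap.comp_apply, hB.apply_inverse]

/-- The trace of an endomorphism, as a continuous linear functional. -/
def traceL (E : Type*) [NormedAddCommGroup E] [NormedSpace ℝ E] [FiniteDimensional ℝ E] :
    (E →L[ℝ] E) →L[ℝ] ℝ :=
  LinearMap.toContinuousLinearMap
    (LinearMap.trace ℝ E ∘ₗ ContinuousLinearMap.coeLM ℝ)

theorem traceL_apply (T : E →L[ℝ] E) : traceL E T = LinearMap.trace ℝ E T.toLinearMap := rfl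

theorem metricTrace_def (B T : E →L[ℝ] E →L[ℝ] ℝ) :
    metricTrace B T = traceL E (B.inverse ∘L T) := rfl

theorem traceL_comp_comm (S T : E →L[ℝ] E) : traceL E (S ∘L T) = traceL E (T ∘L S) := by
  simp only [traceL_apply]
  exact LinearMap.trace_mul_comm ℝ S.toLinearMap T.toLinearMap

theorem traceL_smulRight (η : E →L[ℝ] ℝ) (X : E) : traceL E (η.smulRight X) = η X := by
  rw [traceL_apply]
  exact LinearMap.trace_smulRight η.toLinearMap X

theorem traceL_conj (K : E ≃L[ℝ] E) {S T : E →L[ℝ] E} (h : ∀ X, T (K X) = K (S X)) :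
    traceL E T = traceL E S := by
  have : T = (K : E →L[ℝ] E) ∘L (S ∘L (K.symm : E →L[ℝ] E)) := by
    ext X
    simpa using h (K.symm X)
  rw [this, traceL_comp_comm]
  congr 1
  ext X
  simp

theorem IsInner.traceL_comp_self_nonneg {B : E →L[ℝ] E →L[ℝ] ℝ} (hB : IsInner B)
    {T : E →L[ℝ] E} (hT : ∀ X Y, B (T X) Y = B (T Y) X) : 0 ≤ traceL E (T ∘L T) := by
  obtain ⟨b, hb⟩ := hB.exists_basis
  rw [traceL_apply, hB.trace_eq hb]
  refine Finset.sum_nonneg fun i _ => ?_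
  rw [ContinuousLinearMap.comp_apply, hT]
  exact hB.nonneg _

theorem IsInner.abs_metricTrace_le {B : E →L[ℝ] E →L[ℝ] ℝ} (hB : IsInner B)
    {T : E →L[ℝ] E →L[ℝ] ℝ} {c : ℝ} (hT : ∀ X, |T X X| ≤ c * B X X) :
    |metricTrace B T| ≤ Module.finrank ℝ E * c := by
  obtain ⟨b, hb⟩ := hB.exists_basis
  rw [hB.metricTrace_eq hb]
  refine (Finset.abs_sum_le_sum_abs _ _).trans ?_
  refine (Finset.sum_le_sum fun i _ => hT (b i)).trans ?_
  simp [hb]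

end LinearAlgebra

section Coordinates

variable {E : Type*} [NormedAddCommGroup E] [NormedSpace ℝ E]

/-- The Christoffel symbols of the second kind of a metric on a subset `S` of a vector space. -/
def chr (G : E → E →L[ℝ] E →L[ℝ] ℝ) (S : Set E) (y : E) : E →L[ℝ] E →L[ℝ] E :=
  ContinuousLinearMap.compL ℝ E (E →L[ℝ] ℝ) E (ContinuousLinearMap.inverse (G y)) ∘L
    koszul (fderivWithin ℝ G S y)

/-- The Hessian of a function on a subset of a vector space. -/
def hess (G : E → E →L[ℝ] E →L[ℝ] ℝ) (S : Set E) (v : E → ℝ) (y : E) : E →L[ℝ] E →L[ℝ] ℝ :=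
  fderivWithin ℝ (fderivWithin ℝ v S) S y
    - ContinuousLinearMap.compL ℝ E E ℝ (fderivWithin ℝ v S y) ∘L chr G S y

/-- The covariant derivative of a vector field. -/
def covd (G : E → E →L[ℝ] E →L[ℝ] ℝ) (S : Set E) (Y : E → E) (y : E) : E →L[ℝ] E :=
  fderivWithin ℝ Y S y + (chr G S y).flip (Y y)

/-- The endomorphism `Z ↦ R(Z, X) X`. -/
def jacobiOp (G : E → E →L[ℝ] E →L[ℝ] ℝ) (S : Set E) (y X : E) : E →L[ℝ] E :=
  ((fderivWithin ℝ (chr G S) S y).flip X).flip X - (fderivWithin ℝ (chr G S) S y X).flip X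
    + (chr G S y).flip (chr G S y X X) - (chr G S y X) ∘L (chr G S y).flip X

theorem hess_apply (G : E → E →L[ℝ] E →L[ℝ] ℝ) (S : Set E) (v : E → ℝ) (y X Z : E) :
    hess G S v y X Z = fderivWithin ℝ (fderivWithin ℝ v S) S y X Z
      - fderivWithin ℝ v S y (chr G S y X Z) := rfl

theorem covd_apply (G : E → E →L[ℝ] E →L[ℝ] ℝ) (S : Set E) (Y : E → E) (y X : E) :
    covd G S Y y X = fderivWithin ℝ Y S y X + chr G S y X (Y y) := rfl

theorem jacobiOp_apply (G : E → E →L[ℝ] E →L[ℝ] ℝ) (S : Set E) (y X Z : E) :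
    jacobiOp G S y X Z = fderivWithin ℝ (chr G S) S y Z X X - fderivWithin ℝ (chr G S) S y X Z X
      + chr G S y Z (chr G S y X X) - chr G S y X (chr G S y Z X) := rfl

/-- Subsets of a vector space on which second derivatives make sense and are symmetric. -/
structure IsDomain (S : Set E) : Prop where
  unique : UniqueDiffOn ℝ S
  dense : S ⊆ closure (interior S)

/-- `G` is a `C^2` Riemannian metric on `S` near the point `y` of `S`. -/
structure IsMetricAt (G : E → E →L[ℝ] E →L[ℝ] ℝ) (S : Set E) (y : E) : Prop where
  dom : IsDomain S
  mem : y ∈ S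
  contDiff : ContDiffWithinAt ℝ 2 G S y
  inner : ∀ᶠ z in 𝓝[S] y, IsInner (G z)

theorem ContDiffWithinAt.eventually_of_mem {F : Type*} [NormedAddCommGroup F] [NormedSpace ℝ F]
    {f : E → F} {S : Set E} {y : E} {n : ℕ} (hf : ContDiffWithinAt ℝ n f S y) (hy : y ∈ S) :
    ∀ᶠ z in 𝓝[S] y, ContDiffWithinAt ℝ n f S z := by
  have := hf.eventually (by simp)
  rwa [insert_eq_of_mem hy] at this

theorem IsDomain.symm {F : Type*} [NormedAddCommGroup F] [NormedSpace ℝ F] {S : Set E}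
    (hS : IsDomain S) {f : E → F} {y : E} (hf : ContDiffWithinAt ℝ 2 f S y) (hy : y ∈ S) (X Z : E) :
    fderivWithin ℝ (fderivWithin ℝ f S) S y X Z = fderivWithin ℝ (fderivWithin ℝ f S) S y Z X :=
  (hf.isSymmSndFDerivWithinAt (by simp) hS.unique (hS.dense hy) hy) X Z

theorem IsMetricAt.eventually {G : E → E →L[ℝ] E →L[ℝ] ℝ} {S : Set E} {y : E}
    (h : IsMetricAt G S y) : ∀ᶠ z in 𝓝[S] y, IsMetricAt G S z := by
  filter_upwards [ContDiffWithinAt.eventually_of_mem (n := 2) h.contDiff h.mem,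
    eventually_eventually_nhdsWithin.2 h.inner, self_mem_nhdsWithin] with z h1 h2 h3
  exact ⟨h.dom, h3, h1, h2⟩

theorem IsMetricAt.self {G : E → E →L[ℝ] E →L[ℝ] ℝ} {S : Set E} {y : E}
    (h : IsMetricAt G S y) : IsInner (G y) :=
  h.inner.self_of_nhdsWithin h.mem

theorem IsMetricAt.hasFDerivWithinAt {G : E → E →L[ℝ] E →L[ℝ] ℝ} {S : Set E} {y : E}
    (h : IsMetricAt G S y) : HasFDerivWithinAt G (fderivWithin ℝ G S y) S y :=
  (h.contDiff.differentiableWithinAt (by simp)).hasFDerivWithinAt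

theorem IsDomain.eq_of_eventuallyEq {F : Type*} [NormedAddCommGroup F] [NormedSpace ℝ F]
    {S : Set E} (hS : IsDomain S) {f₁ f₂ : E → F} {f₁' f₂' : E →L[ℝ] F} {y : E} (hy : y ∈ S)
    (h : f₁ =ᶠ[𝓝[S] y] f₂)
    (h₁ : HasFDerivWithinAt f₁ f₁' S y) (h₂ : HasFDerivWithinAt f₂ f₂' S y) : f₁' = f₂' :=
  (hS.unique y hy).eq h₁ (h₂.congr_of_eventuallyEq h (h.self_of_nhdsWithin hy))

theorem IsMetricAt.fderiv_symm {G : E → E →L[ℝ] E →L[ℝ] ℝ} {S : Set E} {y : E}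
    (h : IsMetricAt G S y) (Z X W : E) :
    fderivWithin ℝ G S y Z X W = fderivWithin ℝ G S y Z W X := by
  have h1 : HasFDerivWithinAt (fun z => G z X W) (((fderivWithin ℝ G S y).flip X).flip W) S y := by
    simpa using (h.hasFDerivWithinAt.clm_apply (hasFDerivWithinAt_const X y S)).clm_apply
      (hasFDerivWithinAt_const W y S)
  have h2 : HasFDerivWithinAt (fun z => G z W X) (((fderivWithin ℝ G S y).flip W).flip X) S y := by
    simpa using (h.hasFDerivWithinAt.clm_apply (hasFDerivWithinAt_const W y S)).clm_apply
      (hasFDerivWithinAt_const X y S)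
  have := h.dom.eq_of_eventuallyEq h.mem (h.inner.mono fun z hz => hz.symm X W) h1 h2
  exact DFunLike.congr_fun this Z

variable [FiniteDimensional ℝ E]

theorem IsMetricAt.apply_chr {G : E → E →L[ℝ] E →L[ℝ] ℝ} {S : Set E} {y : E}
    (h : IsMetricAt G S y) (X Z W : E) :
    G y (chr G S y X Z) W = (fderivWithin ℝ G S y X Z W + fderivWithin ℝ G S y Z X W
      - fderivWithin ℝ G S y W X Z) / 2 := by
  rw [← koszul_apply]
  exact DFunLike.congr_fun (h.self.apply_inverse (koszul (fderivWithin ℝ G S y) X Z)) W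

theorem IsMetricAt.chr_symm {G : E → E →L[ℝ] E →L[ℝ] ℝ} {S : Set E} {y : E}
    (h : IsMetricAt G S y) (X Z : E) : chr G S y X Z = chr G S y Z X := by
  refine h.self.ext fun W => ?_
  rw [h.apply_chr, h.apply_chr, h.fderiv_symm W X Z]
  ring

theorem IsMetricAt.compat {G : E → E →L[ℝ] E →L[ℝ] ℝ} {S : Set E} {y : E}
    (h : IsMetricAt G S y) (Z X W : E) :
    fderivWithin ℝ G S y Z X W = G y (chr G S y Z X) W + G y X (chr G S y Z W) := by
  rw [h.self.symm X, h.apply_chr, h.apply_chr, h.fderiv_symm W Z X, h.fderiv_symm Z X W,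
    h.fderiv_symm X Z W]
  ring

theorem contDiffWithinAt_koszul {D : E → E →L[ℝ] E →L[ℝ] E →L[ℝ] ℝ} {S : Set E} {y : E}
    {n : WithTop ℕ∞} (h : ContDiffWithinAt ℝ n D S y) :
    ContDiffWithinAt ℝ n (fun z => koszul (D z)) S y := by
  have hf : ContDiffWithinAt ℝ n (fun z => (D z).flip) S y :=
    (ContinuousLinearMap.flipₗᵢ ℝ E E (E →L[ℝ] ℝ)).toContinuousLinearEquiv.contDiff.comp_contDiffWithinAt h
  exact (contDiffWithinAt_const (c := (1 / 2 : ℝ))).smul ((h.add hf).sub (contDiffWithinAt_const.clm_comp hf))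

theorem IsMetricAt.contDiff_inverse {G : E → E →L[ℝ] E →L[ℝ] ℝ} {S : Set E} {y : E}
    (h : IsMetricAt G S y) : ContDiffWithinAt ℝ 2 (fun z => (G z).inverse) S y :=
  h.self.isInvertible.contDiffAt_map_inverse.comp_contDiffWithinAt y h.contDiff

theorem IsMetricAt.contDiff_chr {G : E → E →L[ℝ] E →L[ℝ] ℝ} {S : Set E} {y : E}
    (h : IsMetricAt G S y) : ContDiffWithinAt ℝ 1 (chr G S) S y := by
  have h1 : ContDiffWithinAt ℝ 1 (fderivWithin ℝ G S) S y :=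
    h.contDiff.fderivWithin_right h.dom.unique (by norm_num) h.mem
  have h2 := (ContinuousLinearMap.compL ℝ E (E →L[ℝ] ℝ) E).contDiff.comp_contDiffWithinAt
    (h.contDiff_inverse.of_le (by norm_num : (1 : WithTop ℕ∞) ≤ 2))
  exact h2.clm_comp (contDiffWithinAt_koszul h1)

theorem IsMetricAt.hasFDerivWithinAt_chr {G : E → E →L[ℝ] E →L[ℝ] ℝ} {S : Set E} {y : E}
    (h : IsMetricAt G S y) : HasFDerivWithinAt (chr G S) (fderivWithin ℝ (chr G S) S y) S y :=
  (h.contDiff_chr.differentiableWithinAt (by simp)).hasFDerivWithinAt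

/-- If the one-form `ω` is dual to the vector field `P`, then `∇P` is dual to `∇ω`. -/
theorem IsMetricAt.apply_covd {G : E → E →L[ℝ] E →L[ℝ] ℝ} {S : Set E} {y : E}
    (h : IsMetricAt G S y) {P : E → E} {η : E → E →L[ℝ] ℝ} {η' : E →L[ℝ] E →L[ℝ] ℝ}
    (hP : DifferentiableWithinAt ℝ P S y) (hη : HasFDerivWithinAt η η' S y)
    (he : ∀ᶠ z in 𝓝[S] y, G z (P z) = η z) (Z X : E) :
    G y (covd G S P y Z) X = η' Z X - η y (chr G S y Z X) := by
  have h1 := h.hasFDerivWithinAt.clm_apply hP.hasFDerivWithinAt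
  have h2 := DFunLike.congr_fun (DFunLike.congr_fun (h.dom.eq_of_eventuallyEq h.mem he h1 hη) Z) X
  have h3 : G y (fderivWithin ℝ P S y Z) X + fderivWithin ℝ G S y Z (P y) X = η' Z X := h2
  rw [← he.self_of_nhdsWithin h.mem, ← h3, h.compat, covd_apply, map_add, _root_.add_apply]
  ring

theorem IsMetricAt.hasFDerivWithinAt_covd {G : E → E →L[ℝ] E →L[ℝ] ℝ} {S : Set E} {y : E}
    (h : IsMetricAt G S y) {Y : E → E} (hY : ContDiffWithinAt ℝ 2 Y S y) :
    ∃ N' : E →L[ℝ] E →L[ℝ] E, HasFDerivWithinAt (covd G S Y) N' S y ∧ ∀ Z X,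
      N' Z X = fderivWithin ℝ (fderivWithin ℝ Y S) S y Z X + fderivWithin ℝ (chr G S) S y Z X (Y y)
        + chr G S y X (fderivWithin ℝ Y S y Z) := by
  have h1 : HasFDerivWithinAt (fderivWithin ℝ Y S) (fderivWithin ℝ (fderivWithin ℝ Y S) S y) S y :=
    ((hY.fderivWithin_right h.dom.unique (by norm_num : (1 : WithTop ℕ∞) + 1 ≤ 2)
      h.mem).differentiableWithinAt (by simp)).hasFDerivWithinAt
  have h2 : HasFDerivWithinAt (fun z => (chr G S z).flip) _ S y :=
    (ContinuousLinearMap.flipₗᵢ ℝ E E E).toContinuousLinearEquiv.hasFDerivAt.comp_hasFDerivWithinAt y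
      h.hasFDerivWithinAt_chr
  have h3 := h2.clm_apply (hY.differentiableWithinAt (by simp)).hasFDerivWithinAt
  refine ⟨_, h1.add h3, fun Z X => ?_⟩
  change fderivWithin ℝ (fderivWithin ℝ Y S) S y Z X + (chr G S y X (fderivWithin ℝ Y S y Z)
    + fderivWithin ℝ (chr G S) S y Z X (Y y)) = _
  abel

theorem IsMetricAt.bochner {G : E → E →L[ℝ] E →L[ℝ] ℝ} {S : Set E} {y : E}
    (h : IsMetricAt G S y) {Y : E → E} (hY : ContDiffWithinAt ℝ 2 Y S y) :
    traceL E (covd G S (fun z => covd G S Y z (Y z)) y) =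
      fderivWithin ℝ (fun z => traceL E (covd G S Y z)) S y (Y y)
        + traceL E (jacobiOp G S y (Y y)) + traceL E (covd G S Y y ∘L covd G S Y y) := by
  obtain ⟨N', hN, hN'⟩ := h.hasFDerivWithinAt_covd hY
  have hY1 := (hY.differentiableWithinAt (by simp)).hasFDerivWithinAt
  have h1 := (hN.clm_apply hY1).fderivWithin (h.dom.unique y h.mem)
  have h2 := ((traceL E).hasFDerivAt.comp_hasFDerivWithinAt y hN).fderivWithin
    (h.dom.unique y h.mem)
  change fderivWithin ℝ (fun z => traceL E (covd G S Y z)) S y = _ at h2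
  set Γ := chr G S y with hΓ
  set D := fderivWithin ℝ (chr G S) S y with hD
  set Y' := fderivWithin ℝ Y S y with hY'
  rw [h2]
  change _ = traceL E (N' (Y y)) + _ + _
  have key : covd G S (fun z => covd G S Y z (Y z)) y =
      N' (Y y) + jacobiOp G S y (Y y) + covd G S Y y ∘L covd G S Y y
        + (Γ.flip (Y y) ∘L Y' - Y' ∘L Γ.flip (Y y)) := by
    ext Z
    change fderivWithin ℝ (fun z => covd G S Y z (Y z)) S y Z + Γ Z (covd G S Y y (Y y))
      = N' (Y y) Z + jacobiOp G S y (Y y) Z + covd G S Y y (covd G S Y y Z)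
        + (Γ (Y' Z) (Y y) - Y' (Γ Z (Y y)))
    rw [h1]
    change (covd G S Y y (Y' Z) + N' Z (Y y)) + Γ Z (covd G S Y y (Y y)) = _
    simp only [covd_apply, jacobiOp_apply, hN', ← hΓ, ← hD, ← hY', map_add]
    rw [h.dom.symm hY h.mem Z (Y y), h.chr_symm (Y y) (Y' Z), h.chr_symm (Y y) (Γ Z (Y y))]
    abel
  rw [key, map_add, map_sub, map_add, map_add, traceL_comp_comm Y', sub_self, add_zero]

end Coordinates

section Graphs

variable {E : Type*} [NormedAddCommGroup E] [NormedSpace ℝ E] [FiniteDimensional ℝ E]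

theorem IsInner.dual_symm {B : E →L[ℝ] E →L[ℝ] ℝ} (hB : IsInner B) (a b : E →L[ℝ] ℝ) :
    a (B.inverse b) = b (B.inverse a) := by
  conv_lhs => rw [← hB.apply_inverse a]
  conv_rhs => rw [← hB.apply_inverse b]
  rw [hB.symm]

theorem metricTrace_prod {B : E →L[ℝ] E →L[ℝ] ℝ} (a b : E →L[ℝ] ℝ) :
    metricTrace B (a.smulRight b) = a (B.inverse b) := by
  have e : B.inverse ∘L a.smulRight b = a.smulRight (B.inverse b) := by
    ext X
    simp
  rw [metricTrace_def, e, traceL_smulRight]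

theorem metricTrace_add (B S T : E →L[ℝ] E →L[ℝ] ℝ) :
    metricTrace B (S + T) = metricTrace B S + metricTrace B T := by
  simp only [metricTrace_def, ContinuousLinearMap.comp_add, map_add]

theorem metricTrace_sub (B S T : E →L[ℝ] E →L[ℝ] ℝ) :
    metricTrace B (S - T) = metricTrace B S - metricTrace B T := by
  simp only [metricTrace_def, ContinuousLinearMap.comp_sub, map_sub]

theorem metricTrace_smul (B : E →L[ℝ] E →L[ℝ] ℝ) (c : ℝ) (S : E →L[ℝ] E →L[ℝ] ℝ) :
    metricTrace B (c • S) = c * metricTrace B S := by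
  simp only [metricTrace_def, ContinuousLinearMap.comp_smul, map_smul, smul_eq_mul]

theorem IsInner.metricTrace_comp {B : E →L[ℝ] E →L[ℝ] ℝ} (hB : IsInner B) (T : E →L[ℝ] E) :
    metricTrace B (B ∘L T) = traceL E T := by
  rw [metricTrace_def]
  refine congrArg (traceL E) (ContinuousLinearMap.ext fun X => ?_)
  exact hB.inverse_apply (T X)

/-- The Laplacian on a subset of a vector space. -/
def lap (G : E → E →L[ℝ] E →L[ℝ] ℝ) (S : Set E) (v : E → ℝ) (y : E) : ℝ :=
  metricTrace (G y) (hess G S v y)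

/-- The gradient on a subset of a vector space. -/
def grad (G : E → E →L[ℝ] E →L[ℝ] ℝ) (S : Set E) (v : E → ℝ) (y : E) : E :=
  (G y).inverse (fderivWithin ℝ v S y)

theorem IsMetricAt.hess_symm {G : E → E →L[ℝ] E →L[ℝ] ℝ} {S : Set E} {y : E}
    (h : IsMetricAt G S y) {v : E → ℝ} (hv : ContDiffWithinAt ℝ 2 v S y) (X Z : E) :
    hess G S v y X Z = hess G S v y Z X := by
  rw [hess_apply, hess_apply, h.dom.symm hv h.mem, h.chr_symm]

theorem IsDomain.hasFDerivWithinAt {F : Type*} [NormedAddCommGroup F] [NormedSpace ℝ F] {S : Set E}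
    {v : E → F} {y : E} {n : WithTop ℕ∞} (hv : ContDiffWithinAt ℝ n v S y) (hn : n ≠ 0) :
    HasFDerivWithinAt v (fderivWithin ℝ v S y) S y :=
  (hv.differentiableWithinAt hn).hasFDerivWithinAt

theorem IsDomain.hasFDerivWithinAt_fderivWithin {F : Type*} [NormedAddCommGroup F]
    [NormedSpace ℝ F] {S : Set E}
    (hS : IsDomain S) {v : E → F} {y : E} (hv : ContDiffWithinAt ℝ 2 v S y) (hy : y ∈ S) :
    HasFDerivWithinAt (fderivWithin ℝ v S) (fderivWithin ℝ (fderivWithin ℝ v S) S y) S y :=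
  ((hv.fderivWithin_right hS.unique (by norm_num : (1 : WithTop ℕ∞) + 1 ≤ 2)
    hy).differentiableWithinAt (by simp)).hasFDerivWithinAt

theorem IsDomain.fderivWithin_add {S : Set E}
    (hS : IsDomain S) {v w : E → ℝ} {y : E} (hv : ContDiffWithinAt ℝ 2 v S y)
    (hw : ContDiffWithinAt ℝ 2 w S y) (hy : y ∈ S) :
    fderivWithin ℝ (fun z => v z + w z) S y = fderivWithin ℝ v S y + fderivWithin ℝ w S y :=
  ((IsDomain.hasFDerivWithinAt hv (by simp)).add
    (IsDomain.hasFDerivWithinAt hw (by simp))).fderivWithin (hS.unique y hy)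

theorem IsMetricAt.hess_add {G : E → E →L[ℝ] E →L[ℝ] ℝ} {S : Set E} {y : E}
    (h : IsMetricAt G S y) {v w : E → ℝ} (hv : ContDiffWithinAt ℝ 2 v S y)
    (hw : ContDiffWithinAt ℝ 2 w S y) :
    hess G S (fun z => v z + w z) y = hess G S v y + hess G S w y := by
  have h1 : fderivWithin ℝ (fun z => v z + w z) S =ᶠ[𝓝[S] y]
      fun z => fderivWithin ℝ v S z + fderivWithin ℝ w S z := by
    filter_upwards [ContDiffWithinAt.eventually_of_mem (n := 2) hv h.mem,
      ContDiffWithinAt.eventually_of_mem (n := 2) hw h.mem, self_mem_nhdsWithin] with z h1 h2 hz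
    exact h.dom.fderivWithin_add h1 h2 hz
  have h2 := (h.dom.hasFDerivWithinAt_fderivWithin hv h.mem).add
    (h.dom.hasFDerivWithinAt_fderivWithin hw h.mem)
  have h3 := (h2.congr_of_eventuallyEq h1 (h1.self_of_nhdsWithin h.mem)).fderivWithin
    (h.dom.unique y h.mem)
  ext X Z
  simp only [hess_apply, h3, h1.self_of_nhdsWithin h.mem, _root_.add_apply]
  ring

/-- Composition of a real function with derivatives `p, q` with a function on the domain. -/
theorem IsMetricAt.hess_comp {G : E → E →L[ℝ] E →L[ℝ] ℝ} {S : Set E} {y : E}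
    (h : IsMetricAt G S y) {v : E → ℝ} (hv : ContDiffWithinAt ℝ 2 v S y) {r p : ℝ → ℝ} {q : ℝ}
    (hr : ∀ᶠ t in 𝓝 (v y), HasDerivAt r (p t) t) (hp : HasDerivAt p q (v y)) :
    fderivWithin ℝ (fun z => r (v z)) S y = p (v y) • fderivWithin ℝ v S y ∧
    hess G S (fun z => r (v z)) y = p (v y) • hess G S v y
      + q • (fderivWithin ℝ v S y).smulRight (fderivWithin ℝ v S y) := by
  have h1 : fderivWithin ℝ (fun z => r (v z)) S =ᶠ[𝓝[S] y]
      fun z => p (v z) • fderivWithin ℝ v S z := by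
    filter_upwards [ContDiffWithinAt.eventually_of_mem (n := 2) hv h.mem, self_mem_nhdsWithin,
      hv.continuousWithinAt.eventually hr] with z h1 hz h2
    exact (h2.comp_hasFDerivWithinAt z (IsDomain.hasFDerivWithinAt h1 (by simp))).fderivWithin
      (h.dom.unique z hz)
  have h2 := (hp.comp_hasFDerivWithinAt y (IsDomain.hasFDerivWithinAt hv (by simp))).smul
    (h.dom.hasFDerivWithinAt_fderivWithin hv h.mem)
  have h3 := (h2.congr_of_eventuallyEq h1 (h1.self_of_nhdsWithin h.mem)).fderivWithin
    (h.dom.unique y h.mem)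
  refine ⟨h1.self_of_nhdsWithin h.mem, ?_⟩
  ext X Z
  rw [hess_apply, h3, h1.self_of_nhdsWithin h.mem]
  change p (v y) * fderivWithin ℝ (fderivWithin ℝ v S) S y X Z
      + q * fderivWithin ℝ v S y X * fderivWithin ℝ v S y Z
      - p (v y) * fderivWithin ℝ v S y (chr G S y X Z)
    = p (v y) * (fderivWithin ℝ (fderivWithin ℝ v S) S y X Z
      - fderivWithin ℝ v S y (chr G S y X Z))
      + q * (fderivWithin ℝ v S y X * fderivWithin ℝ v S y Z)
  ring

/-- A graph over a subset of a vector space: `exp l` is the warping factor, `exp L` the vertical part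
of the upward unit normal, and `Y` the horizontal part of the downward unit normal. -/
structure IsGraphAt (G : E → E →L[ℝ] E →L[ℝ] ℝ) (S : Set E) (l L f : E → ℝ) (Y : E → E) (y : E) :
    Prop where
  metric : IsMetricAt G S y
  contDiff_l : ContDiffWithinAt ℝ 2 l S y
  contDiff_L : ContDiffWithinAt ℝ 2 L S y
  contDiff_f : ContDiffWithinAt ℝ 3 f S y
  contDiff_Y : ContDiffWithinAt ℝ 2 Y S y
  dual : ∀ᶠ z in 𝓝[S] y, G z (Y z) = Real.exp (l z + L z) • fderivWithin ℝ f S z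
  norm : ∀ᶠ z in 𝓝[S] y, G z (Y z) (Y z) = 1 - Real.exp (L z) ^ 2

section

variable {G : E → E →L[ℝ] E →L[ℝ] ℝ} {S : Set E} {l L f : E → ℝ} {Y : E → E} {y : E}

theorem IsGraphAt.eventually (h : IsGraphAt G S l L f Y y) :
    ∀ᶠ z in 𝓝[S] y, IsGraphAt G S l L f Y z := by
  filter_upwards [h.metric.eventually,
    ContDiffWithinAt.eventually_of_mem (n := 2) h.contDiff_l h.metric.mem,
    ContDiffWithinAt.eventually_of_mem (n := 2) h.contDiff_L h.metric.mem,
    ContDiffWithinAt.eventually_of_mem (n := 3) h.contDiff_f h.metric.mem,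
    ContDiffWithinAt.eventually_of_mem (n := 2) h.contDiff_Y h.metric.mem,
    eventually_eventually_nhdsWithin.2 h.dual, eventually_eventually_nhdsWithin.2 h.norm]
    with z h1 h2 h3 h4 h5 h6 h7
  exact ⟨h1, h2, h3, h4, h5, h6, h7⟩

theorem IsGraphAt.contDiff_f' (h : IsGraphAt G S l L f Y y) : ContDiffWithinAt ℝ 2 f S y :=
  h.contDiff_f.of_le (by norm_num)

theorem IsGraphAt.dual_apply (h : IsGraphAt G S l L f Y y) (X : E) :
    G y (Y y) X = Real.exp (l y) * Real.exp (L y) * fderivWithin ℝ f S y X := by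
  rw [h.dual.self_of_nhdsWithin h.metric.mem, Real.exp_add]
  rfl

theorem IsGraphAt.norm_apply (h : IsGraphAt G S l L f Y y) :
    G y (Y y) (Y y) = 1 - Real.exp (L y) ^ 2 :=
  h.norm.self_of_nhdsWithin h.metric.mem

theorem IsGraphAt.apply_covd (h : IsGraphAt G S l L f Y y) (Z X : E) :
    G y (covd G S Y y Z) X = Real.exp (l y) * Real.exp (L y) *
      ((fderivWithin ℝ l S y Z + fderivWithin ℝ L S y Z) * fderivWithin ℝ f S y X
        + hess G S f y Z X) := by
  have hm := h.metric
  have h1 := ((IsDomain.hasFDerivWithinAt h.contDiff_l (by simp)).add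
    (IsDomain.hasFDerivWithinAt h.contDiff_L (by simp))).exp.smul
    (hm.dom.hasFDerivWithinAt_fderivWithin h.contDiff_f' hm.mem)
  rw [hm.apply_covd (h.contDiff_Y.differentiableWithinAt (by simp)) h1 h.dual]
  change Real.exp (l y + L y) * fderivWithin ℝ (fderivWithin ℝ f S) S y Z X
    + Real.exp (l y + L y) * (fderivWithin ℝ l S y Z + fderivWithin ℝ L S y Z)
      * fderivWithin ℝ f S y X - Real.exp (l y + L y) * fderivWithin ℝ f S y (chr G S y Z X) = _
  rw [hess_apply, Real.exp_add]
  ring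

theorem IsGraphAt.apply_covd_self (h : IsGraphAt G S l L f Y y) (Z : E) :
    G y (covd G S Y y Z) (Y y) = - Real.exp (L y) ^ 2 * fderivWithin ℝ L S y Z := by
  have hm := h.metric
  have hY := (h.contDiff_Y.differentiableWithinAt (by simp)).hasFDerivWithinAt
  have h1 := (hm.hasFDerivWithinAt.clm_apply hY).clm_apply hY
  have h2 := ((IsDomain.hasFDerivWithinAt h.contDiff_L (by simp)).exp.pow 2).const_sub 1
  have h3 := DFunLike.congr_fun (hm.dom.eq_of_eventuallyEq hm.mem h.norm h1 h2) Z
  have h4 : G y (Y y) (fderivWithin ℝ Y S y Z) + (G y (fderivWithin ℝ Y S y Z) (Y y)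
      + fderivWithin ℝ G S y Z (Y y) (Y y))
      = -(2 * Real.exp (L y) * (Real.exp (L y) * fderivWithin ℝ L S y Z)) := by
    refine Eq.trans h3 ?_
    change -((2 • Real.exp (L y) ^ (2 - 1)) * (Real.exp (L y) * fderivWithin ℝ L S y Z)) = _
    simp
  rw [hm.compat, hm.self.symm (Y y), hm.self.symm (Y y)] at h4
  rw [covd_apply, map_add, _root_.add_apply]
  linarith

theorem IsGraphAt.apply_accel (h : IsGraphAt G S l L f Y y) :
    G y (covd G S Y y (Y y)) = (Real.exp (L y) ^ 2) • fderivWithin ℝ l S y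
      - fderivWithin ℝ (fun z => l z + L z) S y
      + fderivWithin ℝ (fun z => l z + L z) S y (Y y) • G y (Y y) := by
  have hm := h.metric
  rw [hm.dom.fderivWithin_add h.contDiff_l h.contDiff_L hm.mem]
  ext X
  have h1 := h.apply_covd (Y y) X
  have h2 := h.apply_covd X (Y y)
  have h3 := h.apply_covd_self X
  have h4 := h.dual_apply (Y y)
  have h5 := h.norm_apply
  have h6 := h.dual_apply X
  have h7 := hm.hess_symm h.contDiff_f' (Y y) X
  rw [h7] at h1
  simp only [_root_.add_apply, _root_.sub_apply, _root_.smul_apply, smul_eq_mul]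
  rw [h6, h1]
  linear_combination h3 - h2 + (fderivWithin ℝ l S y X + fderivWithin ℝ L S y X) * (h4 - h5)

/-- The mean curvature of the graph. -/
def graphH (G : E → E →L[ℝ] E →L[ℝ] ℝ) (S : Set E) (l : E → ℝ) (Y : E → E) (y : E) : ℝ :=
  traceL E (covd G S Y y) + fderivWithin ℝ l S y (Y y)

/-- The shape operator of the graph, in terms of the projection to the base. -/
def graphShape (G : E → E →L[ℝ] E →L[ℝ] ℝ) (S : Set E) (l : E → ℝ) (Y : E → E) (y : E) : E →L[ℝ] E :=
  covd G S Y y + (G y (Y y)).smulRight (grad G S l y)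

/-- The Laplacian of the graph. -/
def graphLap (G : E → E →L[ℝ] E →L[ℝ] ℝ) (S : Set E) (l : E → ℝ) (Y : E → E) (v : E → ℝ) (y : E) : ℝ :=
  lap G S v y - hess G S v y (Y y) (Y y) + G y (Y y) (Y y) * fderivWithin ℝ v S y (grad G S l y)
    - graphH G S l Y y * fderivWithin ℝ v S y (Y y)

theorem IsGraphAt.jacobi (h : IsGraphAt G S l L f Y y) {ψ : E → ℝ} (hψ : ψ = fun z => l z + L z) :
    graphLap G S l Y ψ y + (fderivWithin ℝ ψ S y (grad G S ψ y) - fderivWithin ℝ ψ S y (Y y) ^ 2) =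
      - fderivWithin ℝ (graphH G S l Y) S y (Y y) - traceL E (jacobiOp G S y (Y y))
        + hess G S l y (Y y) (Y y) + fderivWithin ℝ l S y (Y y) ^ 2
        + Real.exp (L y) ^ 2 * (lap G S l y + fderivWithin ℝ l S y (grad G S l y))
        - traceL E (graphShape G S l Y y ∘L graphShape G S l Y y) := by
  subst hψ
  have hm := h.metric
  have hψ2 : ContDiffWithinAt ℝ 2 (fun z => l z + L z) S y := h.contDiff_l.add h.contDiff_L
  have hdψ := hm.dom.fderivWithin_add h.contDiff_l h.contDiff_L hm.mem
  set ψ := fun z => l z + L z with hψ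
  have hY := (h.contDiff_Y.differentiableWithinAt (by simp)).hasFDerivWithinAt
  have hdY := hm.dom.hasFDerivWithinAt_fderivWithin hψ2 hm.mem
  have hdl := hm.dom.hasFDerivWithinAt_fderivWithin h.contDiff_l hm.mem
  obtain ⟨N', hN, -⟩ := hm.hasFDerivWithinAt_covd h.contDiff_Y
  have hP := hN.clm_apply hY
  have hGY := hm.hasFDerivWithinAt.clm_apply hY
  have hω := (((IsDomain.hasFDerivWithinAt h.contDiff_L (by simp)).exp.pow 2).smul hdl).sub hdY
    |>.add ((hdY.clm_apply hY).smul hGY)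
  have hPe := h.eventually.mono fun z hz => hz.apply_accel
  have hcov := hm.apply_covd hP.differentiableWithinAt hω hPe
  -- the divergence of the acceleration
  have hdiv : covd G S (fun z => covd G S Y z (Y z)) y =
      Real.exp (L y) ^ 2 • ((2 : ℝ) • (fderivWithin ℝ L S y).smulRight (grad G S l y)
        + (G y).inverse ∘L hess G S l y) - (G y).inverse ∘L hess G S ψ y
      + ((hess G S ψ y).flip (Y y) + fderivWithin ℝ ψ S y ∘L covd G S Y y).smulRight (Y y)
      + fderivWithin ℝ ψ S y (Y y) • covd G S Y y := by
    ext1 Z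
    refine hm.self.ext fun X => ?_
    rw [hcov]
    simp only [_root_.add_apply, _root_.sub_apply, _root_.smul_apply,
      ContinuousLinearMap.comp_apply, ContinuousLinearMap.smulRight_apply,
      ContinuousLinearMap.flip_apply, map_add, map_sub, map_smul, hm.self.apply_inverse,
      smul_eq_mul, grad, hess_apply, covd_apply, hm.compat]
    simp only [Nat.reduceSub, pow_one, nsmul_eq_mul, Nat.cast_ofNat]
    change _ - (Real.exp (L y) ^ 2 * fderivWithin ℝ l S y (chr G S y Z X)
      - fderivWithin ℝ ψ S y (chr G S y Z X)
      + fderivWithin ℝ ψ S y (Y y) * G y (Y y) (chr G S y Z X)) = _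
    ring
  have hb := hm.bochner h.contDiff_Y
  rw [hdiv] at hb
  simp only [map_add, map_sub, map_smul, traceL_smulRight, ← metricTrace_def, smul_eq_mul,
    _root_.add_apply, ContinuousLinearMap.comp_apply, ContinuousLinearMap.flip_apply] at hb
  change Real.exp (L y) ^ 2 * (2 * fderivWithin ℝ L S y (grad G S l y) + lap G S l y) - lap G S ψ y
    + _ + _ = _ at hb
  -- the derivative of the mean curvature
  have hH : fderivWithin ℝ (graphH G S l Y) S y (Y y) =
      fderivWithin ℝ (fun z => traceL E (covd G S Y z)) S y (Y y)
      + (hess G S l y (Y y) (Y y) + fderivWithin ℝ l S y (covd G S Y y (Y y))) := by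
    have h1 := (traceL E).hasFDerivAt.comp_hasFDerivWithinAt y hN
    have h2 := (h1.add (hdl.clm_apply hY)).fderivWithin (hm.dom.unique y hm.mem)
    change fderivWithin ℝ (graphH G S l Y) S y = _ at h2
    rw [h2, show fderivWithin ℝ (fun z => traceL E (covd G S Y z)) S y = _ from
      h1.fderivWithin (hm.dom.unique y hm.mem), hess_apply, covd_apply, map_add]
    simp only [_root_.add_apply, ContinuousLinearMap.comp_apply, ContinuousLinearMap.flip_apply]
    ring
  -- the square of the shape operator
  have hS : traceL E (graphShape G S l Y y ∘L graphShape G S l Y y) =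
      traceL E (covd G S Y y ∘L covd G S Y y)
      - 2 * (Real.exp (L y) ^ 2 * fderivWithin ℝ L S y (grad G S l y))
      + fderivWithin ℝ l S y (Y y) ^ 2 := by
    set N := covd G S Y y
    set a := grad G S l y with ha
    have e1 : graphShape G S l Y y ∘L graphShape G S l Y y = N ∘L N + N ∘L (G y (Y y)).smulRight a
        + (G y (Y y)).smulRight a ∘L N + (G y (Y y) a) • (G y (Y y)).smulRight a := by
      ext Z
      simp [graphShape, N, a]
      abel_nf
      rw [smul_comm]
    have e2 : N ∘L (G y (Y y)).smulRight a = (G y (Y y)).smulRight (N a) := by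
      ext Z; simp
    have e3 : G y (Y y) a = fderivWithin ℝ l S y (Y y) := by
      rw [hm.self.symm, ha, grad, hm.self.apply_inverse]
    rw [e1]
    simp only [map_add, map_smul]
    rw [traceL_comp_comm ((G y (Y y)).smulRight a) N, e2, traceL_smulRight, traceL_smulRight,
      hm.self.symm, h.apply_covd_self, e3, smul_eq_mul]
    ring
  have hPinv : covd G S Y y (Y y) = (Real.exp (L y) ^ 2) • grad G S l y
      - grad G S ψ y + fderivWithin ℝ ψ S y (Y y) • Y y := by
    refine hm.self.ext fun X => ?_
    rw [h.apply_accel]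
    simp only [map_add, map_sub, map_smul, grad, hm.self.apply_inverse]
    rfl
  have hsym : fderivWithin ℝ l S y (grad G S ψ y) = fderivWithin ℝ ψ S y (grad G S l y) :=
    hm.self.dual_symm _ _
  rw [hH, hS]
  rw [hPinv] at hb ⊢
  simp only [map_add, map_sub, map_smul, smul_eq_mul] at hb ⊢
  rw [graphLap, graphH, h.norm_apply]
  linear_combination -hb - hsym

end

end Graphs

section GraphMetric

variable {E : Type*} [NormedAddCommGroup E] [NormedSpace ℝ E] [FiniteDimensional ℝ E]

/-- The metric of the graph on a subset of a vector space. -/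
def graphG (G : E → E →L[ℝ] E →L[ℝ] ℝ) (S : Set E) (l f : E → ℝ) (y : E) : E →L[ℝ] E →L[ℝ] ℝ :=
  G y + Real.exp (l y) ^ 2 • pullForm (ContinuousLinearMap.mul ℝ ℝ)
    (fderivWithin ℝ f S y) (fderivWithin ℝ f S y)

variable {G : E → E →L[ℝ] E →L[ℝ] ℝ} {S : Set E} {l L f : E → ℝ} {Y : E → E} {y : E}

theorem graphG_apply (X Z : E) : graphG G S l f y X Z = G y X Z + Real.exp (l y) ^ 2 *
    (fderivWithin ℝ f S y X * fderivWithin ℝ f S y Z) := rfl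

theorem IsGraphAt.metric_graph (h : IsGraphAt G S l L f Y y) :
    IsMetricAt (graphG G S l f) S y where
  dom := h.metric.dom
  mem := h.metric.mem
  inner := h.metric.inner.mono fun z hz => hz.add_sq _ (by positivity)
  contDiff := by
    have h1 : ContDiffWithinAt ℝ 2 (fderivWithin ℝ f S) S y :=
      h.contDiff_f.fderivWithin_right h.metric.dom.unique (by norm_num) h.metric.mem
    have h2 : graphG G S l f = fun z => G z + Real.exp (l z) ^ 2 •
        (fderivWithin ℝ f S z).smulRight (fderivWithin ℝ f S z) := by
      ext z X Z
      rfl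
    rw [h2]
    exact h.metric.contDiff.add ((h.contDiff_l.exp.pow 2).smul (h1.smulRight h1))

theorem IsGraphAt.fderiv_graphG (h : IsGraphAt G S l L f Y y) (Z X W : E) :
    fderivWithin ℝ (graphG G S l f) S y Z X W = fderivWithin ℝ G S y Z X W
      + Real.exp (l y) ^ 2 * (2 * fderivWithin ℝ l S y Z
          * (fderivWithin ℝ f S y X * fderivWithin ℝ f S y W)
        + fderivWithin ℝ (fderivWithin ℝ f S) S y Z X * fderivWithin ℝ f S y W
        + fderivWithin ℝ f S y X * fderivWithin ℝ (fderivWithin ℝ f S) S y Z W) := by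
  have hm := h.metric
  have h1 := (h.metric_graph.hasFDerivWithinAt.clm_apply (hasFDerivWithinAt_const X y S)).clm_apply
      (hasFDerivWithinAt_const W y S)
  have h2 := (hm.hasFDerivWithinAt.clm_apply (hasFDerivWithinAt_const X y S)).clm_apply
      (hasFDerivWithinAt_const W y S)
  have hf := hm.dom.hasFDerivWithinAt_fderivWithin h.contDiff_f' hm.mem
  have h3 := h2.add (((IsDomain.hasFDerivWithinAt h.contDiff_l (by simp)).exp.pow 2).mul
    ((hf.clm_apply (hasFDerivWithinAt_const X y S)).mul
      (hf.clm_apply (hasFDerivWithinAt_const W y S))))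
  have h4 := DFunLike.congr_fun (hm.dom.eq_of_eventuallyEq hm.mem (Eventually.of_forall fun z => by
    exact graphG_apply X W) h1 h3) Z
  simp only [ContinuousLinearMap.comp_zero, zero_add, ContinuousLinearMap.flip_apply,
    _root_.add_apply, _root_.smul_apply, smul_eq_mul, nsmul_eq_mul] at h4
  rw [h4]
  change _ + (_ + (fderivWithin ℝ f S y X * fderivWithin ℝ f S y W) * _) = _
  push_cast
  ring

theorem IsGraphAt.exp_sq (h : IsGraphAt G S l L f Y y) (X Z : E) :
    Real.exp (l y) ^ 2 * (fderivWithin ℝ f S y X * fderivWithin ℝ f S y Z)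
      = (Real.exp (L y) ^ 2)⁻¹ * (G y (Y y) X * G y (Y y) Z) := by
  rw [h.dual_apply, h.dual_apply]
  have := (Real.exp_pos (L y)).ne'
  field_simp

theorem IsGraphAt.graphG_eq (h : IsGraphAt G S l L f Y y) (X Z : E) :
    graphG G S l f y X Z = G y X Z + (Real.exp (L y) ^ 2)⁻¹ * (G y (Y y) X * G y (Y y) Z) := by
  rw [graphG_apply, h.exp_sq]

theorem IsGraphAt.inverse_graphG (h : IsGraphAt G S l L f Y y) (η : E →L[ℝ] ℝ) :
    (graphG G S l f y).inverse η = (G y).inverse η - η (Y y) • Y y := by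
  refine h.metric_graph.self.inverse_eq fun Z => ?_
  have h1 : G y (Y y) ((G y).inverse η) = η (Y y) := by
    rw [h.metric.self.symm, h.metric.self.apply_inverse]
  rw [h.graphG_eq]
  simp only [map_sub, map_smul, _root_.sub_apply, _root_.smul_apply, smul_eq_mul, h1,
    h.metric.self.apply_inverse, h.norm_apply]
  have := (Real.exp_pos (L y)).ne'
  field_simp
  ring

theorem IsGraphAt.metricTrace_graphG (h : IsGraphAt G S l L f Y y) (T : E →L[ℝ] E →L[ℝ] ℝ) :
    metricTrace (graphG G S l f y) T = metricTrace (G y) T - T (Y y) (Y y) := by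
  have e : (graphG G S l f y).inverse ∘L T = (G y).inverse ∘L T - (T.flip (Y y)).smulRight (Y y) := by
    ext X
    exact h.inverse_graphG (T X)
  rw [metricTrace_def, e, map_sub, traceL_smulRight, ← metricTrace_def]
  rfl

theorem IsGraphAt.dual_covd (h : IsGraphAt G S l L f Y y) (X Z : E) :
    G y (covd G S Y y X) Z = (fderivWithin ℝ l S y X + fderivWithin ℝ L S y X) * G y (Y y) Z
      + Real.exp (l y) * Real.exp (L y) * hess G S f y X Z := by
  rw [h.apply_covd, h.dual_apply]
  ring

theorem IsGraphAt.chr_graphG (h : IsGraphAt G S l L f Y y) (X Z : E) :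
    chr (graphG G S l f) S y X Z = chr G S y X Z
      + (G y (covd G S Y y X) Z - fderivWithin ℝ L S y X * G y (Y y) Z
        + G y (Y y) X * fderivWithin ℝ l S y Z) • Y y
      - ((Real.exp (L y) ^ 2)⁻¹ * (G y (Y y) X * G y (Y y) Z)) •
        (grad G S l y - fderivWithin ℝ l S y (Y y) • Y y) := by
  refine h.metric_graph.self.ext fun W => ?_
  have h1 : graphG G S l f y (grad G S l y - fderivWithin ℝ l S y (Y y) • Y y) W
      = fderivWithin ℝ l S y W := by
    rw [grad, ← h.inverse_graphG, h.metric_graph.self.apply_inverse]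
  have h2 : graphG G S l f y (Y y) W = (Real.exp (L y) ^ 2)⁻¹ * G y (Y y) W := by
    rw [h.graphG_eq, h.norm_apply]
    have := (Real.exp_pos (L y)).ne'
    field_simp
    ring
  have h3 : fderivWithin ℝ f S y (chr G S y X Z)
      = fderivWithin ℝ (fderivWithin ℝ f S) S y X Z - hess G S f y X Z := by
    rw [hess_apply]; ring
  rw [map_sub, map_add, map_smul, map_smul]
  simp only [_root_.add_apply, _root_.sub_apply, _root_.smul_apply, smul_eq_mul]
  rw [h1, h2, h.metric_graph.apply_chr, h.fderiv_graphG, h.fderiv_graphG, h.fderiv_graphG,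
    graphG_apply, h.metric.apply_chr, h3, h.metric.dom.symm h.contDiff_f' h.metric.mem W X,
    h.metric.dom.symm h.contDiff_f' h.metric.mem W Z,
    h.metric.dom.symm h.contDiff_f' h.metric.mem Z X, h.dual_covd]
  simp only [h.dual_apply]
  have := (Real.exp_pos (L y)).ne'
  field_simp
  ring

theorem IsGraphAt.lap_graphG (h : IsGraphAt G S l L f Y y) (v : E → ℝ) :
    metricTrace (graphG G S l f y) (hess (graphG G S l f) S v y) = graphLap G S l Y v y := by
  have hm := h.metric.self
  have e : hess (graphG G S l f) S v y = hess G S v y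
      - fderivWithin ℝ v S y (Y y) • (G y ∘L covd G S Y y
        - (fderivWithin ℝ L S y).smulRight (G y (Y y)) + (G y (Y y)).smulRight (fderivWithin ℝ l S y))
      + ((Real.exp (L y) ^ 2)⁻¹ * (fderivWithin ℝ v S y (grad G S l y)
          - fderivWithin ℝ l S y (Y y) * fderivWithin ℝ v S y (Y y))) •
        (G y (Y y)).smulRight (G y (Y y)) := by
    ext X Z
    simp only [hess_apply, h.chr_graphG, map_add, map_sub, map_smul, _root_.add_apply,
      _root_.sub_apply, _root_.smul_apply, ContinuousLinearMap.comp_apply,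
      ContinuousLinearMap.smulRight_apply, smul_eq_mul]
    ring
  have h1 : G y (Y y) ((G y).inverse (fderivWithin ℝ l S y)) = fderivWithin ℝ l S y (Y y) := by
    rw [hm.symm, hm.apply_inverse]
  rw [h.metricTrace_graphG, e]
  simp only [metricTrace_add, metricTrace_sub, metricTrace_smul, metricTrace_prod, hm.metricTrace_comp,
    hm.inverse_apply, _root_.add_apply, h1,
      _root_.sub_apply, _root_.smul_apply, ContinuousLinearMap.comp_apply,
      ContinuousLinearMap.smulRight_apply, smul_eq_mul, h.apply_covd_self, h.norm_apply]
  rw [graphLap, graphH, lap, h.norm_apply]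
  have := (Real.exp_pos (L y)).ne'
  field_simp
  ring

theorem IsGraphAt.shape_nonneg (h : IsGraphAt G S l L f Y y) :
    0 ≤ traceL E (graphShape G S l Y y ∘L graphShape G S l Y y) := by
  refine h.metric_graph.self.traceL_comp_self_nonneg fun X Z => ?_
  have hm := h.metric.self
  have h1 : ∀ Z, G y (grad G S l y) Z = fderivWithin ℝ l S y Z := fun Z => by
    rw [grad, hm.apply_inverse]
  have h2 : ∀ X Z, graphG G S l f y (graphShape G S l Y y X) Z =
      G y (covd G S Y y X) Z + G y (Y y) X * fderivWithin ℝ l S y Z + (Real.exp (L y) ^ 2)⁻¹ *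
        ((- Real.exp (L y) ^ 2 * fderivWithin ℝ L S y X
          + G y (Y y) X * fderivWithin ℝ l S y (Y y)) * G y (Y y) Z) := fun X Z => by
    rw [h.graphG_eq]
    simp only [graphShape, map_add, map_smul, _root_.add_apply, _root_.smul_apply,
      ContinuousLinearMap.smulRight_apply, smul_eq_mul, h1]
    rw [hm.symm (Y y) (covd G S Y y X), h.apply_covd_self, hm.symm (Y y) (grad G S l y), h1]
  rw [h2, h2, h.dual_covd, h.dual_covd, h.metric.hess_symm h.contDiff_f' Z X]
  have := (Real.exp_pos (L y)).ne'
  field_simp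
  ring

/-- The scalar product of one-forms on the graph. -/
theorem IsInner.dual_cauchy_schwarz {B : E →L[ℝ] E →L[ℝ] ℝ} (hB : IsInner B) {X : E}
    (hX : B X X ≤ 1) (a : E →L[ℝ] ℝ) : 0 ≤ a (B.inverse a) - a X ^ 2 := by
  have h1 : a X = B (B.inverse a) X := by rw [hB.apply_inverse]
  have h2 : a (B.inverse a) = B (B.inverse a) (B.inverse a) := by rw [hB.apply_inverse]
  rw [h1, h2]
  have := hB.sq_le (B.inverse a) X
  have := mul_le_mul_of_nonneg_left hX (hB.nonneg (B.inverse a))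
  linarith

theorem IsGraphAt.graphLap_sqrt (h : IsGraphAt G S l L f Y y) :
    graphLap G S l Y (fun z => Real.exp (L z / 2)) y = Real.exp (L y / 2) *
      ((1 / 2) * graphLap G S l Y L y + (1 / 4) * (fderivWithin ℝ L S y (grad G S L y)
        - fderivWithin ℝ L S y (Y y) ^ 2)) := by
  have h1 : ∀ t : ℝ, HasDerivAt (fun t => Real.exp (t / 2)) (Real.exp (t / 2) * (1 / 2)) t :=
    fun t => ((hasDerivAt_id t).div_const 2).exp
  have h2 : ∀ t : ℝ, HasDerivAt (fun t => Real.exp (t / 2) * (1 / 2))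
      (Real.exp (t / 2) * (1 / 2) * (1 / 2)) t := fun t => (h1 t).mul_const _
  obtain ⟨e1, e2⟩ := h.metric.hess_comp h.contDiff_L (Eventually.of_forall h1) (h2 (L y))
  rw [graphLap, graphLap, lap, lap, e1, e2]
  simp only [metricTrace_add, metricTrace_smul, metricTrace_prod, _root_.add_apply,
    _root_.smul_apply, smul_eq_mul, ContinuousLinearMap.smulRight_apply, grad]
  ring

theorem IsGraphAt.graphLap_add (h : IsGraphAt G S l L f Y y) :
    graphLap G S l Y (fun z => l z + L z) y = graphLap G S l Y l y + graphLap G S l Y L y := by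
  rw [graphLap, graphLap, graphLap, lap, lap, lap, h.metric.hess_add h.contDiff_l h.contDiff_L,
    h.metric.dom.fderivWithin_add h.contDiff_l h.contDiff_L h.metric.mem]
  simp only [metricTrace_add, _root_.add_apply]
  ring

theorem IsGraphAt.graphLap_sqrt_le (h : IsGraphAt G S l L f Y y) {B C₀ : ℝ} (hB : 0 ≤ B) (hC₀ : 0 ≤ C₀)
    (hRic : - traceL E (jacobiOp G S y (Y y)) ≤ B * G y (Y y) (Y y))
    (hdl : ∀ X, |fderivWithin ℝ l S y X| ≤ B * √(G y X X))
    (hHl : ∀ X, |hess G S l y X X| ≤ B * G y X X)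
    (hH : |graphH G S l Y y| ≤ C₀)
    (hDH : - fderivWithin ℝ (graphH G S l Y) S y (Y y) ≤ C₀ * (1 +
      √(fderivWithin ℝ (fun z => l z + L z) S y (grad G S (fun z => l z + L z) y)
        - fderivWithin ℝ (fun z => l z + L z) S y (Y y) ^ 2))) :
    graphLap G S l Y (fun z => Real.exp (L z / 2)) y ≤
      (C₀ ^ 2 + C₀ * (1 + B) + 3 * B + 3 * B ^ 2 + 2 * Module.finrank ℝ E * B) * Real.exp (L y / 2) := by
  have hm := h.metric.self
  have hw := h.norm_apply
  have hw0 : 0 ≤ Real.exp (L y) ^ 2 := by positivity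
  have hY1 : G y (Y y) (Y y) ≤ 1 := by linarith
  have hY0 := hm.nonneg (Y y)
  have hw1 : Real.exp (L y) ^ 2 ≤ 1 := by linarith
  have hJ := h.jacobi rfl
  have hA := h.shape_nonneg
  have hadd := h.graphLap_add
  have hdψ := h.metric.dom.fderivWithin_add h.contDiff_l h.contDiff_L h.metric.mem
  rw [h.graphLap_sqrt, mul_comm (Real.exp _)]
  refine mul_le_mul_of_nonneg_right ?_ (Real.exp_pos _).le
  -- the gradient of `l`
  have hs1 : √(G y (Y y) (Y y)) ≤ 1 := Real.sqrt_le_one.2 hY1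
  have hlY : |fderivWithin ℝ l S y (Y y)| ≤ B :=
    (hdl _).trans (mul_le_of_le_one_right hB hs1)
  have hlY2 : fderivWithin ℝ l S y (Y y) ^ 2 ≤ B ^ 2 := sq_le_sq' (by linarith [abs_le.1 hlY])
    (abs_le.1 hlY).2
  have hgl0 : G y (grad G S l y) (grad G S l y) = fderivWithin ℝ l S y (grad G S l y) := by
    conv_lhs => rw [grad, hm.apply_inverse]
    rfl
  have hgl : 0 ≤ fderivWithin ℝ l S y (grad G S l y) := hgl0 ▸ hm.nonneg _
  have hgl2 : fderivWithin ℝ l S y (grad G S l y) ≤ B ^ 2 := by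
    have h1 := hdl (grad G S l y)
    rw [hgl0, abs_of_nonneg hgl] at h1
    have h2 := Real.sq_sqrt hgl
    have h3 := Real.sqrt_nonneg (fderivWithin ℝ l S y (grad G S l y))
    set s := √(fderivWithin ℝ l S y (grad G S l y))
    rcases h3.eq_or_lt with h4 | h4
    · rw [← h2, ← h4]; nlinarith
    · have : s ≤ B := by
        rw [← h2, sq] at h1
        exact le_of_mul_le_mul_right h1 h4
      rw [← h2]
      exact pow_le_pow_left₀ h3 this 2
  have hlap := hm.abs_metricTrace_le hHl
  change |lap G S l y| ≤ _ at hlap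
  have hn : 0 ≤ (Module.finrank ℝ E : ℝ) * B := by positivity
  have hHY : |hess G S l y (Y y) (Y y)| ≤ B := (hHl _).trans (mul_le_of_le_one_right hB hY1)
  have hHl2 : |graphH G S l Y y * fderivWithin ℝ l S y (Y y)| ≤ C₀ * B := by
    rw [abs_mul]
    exact mul_le_mul hH hlY (abs_nonneg _) hC₀
  have hb1 : 0 ≤ G y (Y y) (Y y) * fderivWithin ℝ l S y (grad G S l y) := mul_nonneg hY0 hgl
  have hLl : - graphLap G S l Y l y ≤ Module.finrank ℝ E * B + B + C₀ * B := by
    rw [graphLap]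
    linarith [abs_le.1 hlap, abs_le.1 hHY, abs_le.1 hHl2]
  have hb2 : Real.exp (L y) ^ 2 * (lap G S l y + fderivWithin ℝ l S y (grad G S l y))
      ≤ Module.finrank ℝ E * B + B ^ 2 := by
    have h1 : lap G S l y + fderivWithin ℝ l S y (grad G S l y)
        ≤ Module.finrank ℝ E * B + B ^ 2 := by linarith [abs_le.1 hlap]
    exact (mul_le_mul_of_nonneg_left h1 hw0).trans (mul_le_of_le_one_left (by positivity) hw1)
  have hb3 : B * G y (Y y) (Y y) ≤ B := mul_le_of_le_one_right hB hY1
  -- the gradient of the logarithm of the vertical part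
  have hq0 := hm.dual_cauchy_schwarz hY1 (fderivWithin ℝ (fun z => l z + L z) S y)
  have hq1 := hm.dual_cauchy_schwarz hY1
    ((1 / 2 : ℝ) • fderivWithin ℝ (fun z => l z + L z) S y + fderivWithin ℝ l S y)
  have hql := hm.dual_cauchy_schwarz hY1 (fderivWithin ℝ l S y)
  have hsym := hm.dual_symm (fderivWithin ℝ l S y) (fderivWithin ℝ L S y)
  change 0 ≤ fderivWithin ℝ (fun z => l z + L z) S y (grad G S (fun z => l z + L z) y) - _ at hq0
  set q2 := fderivWithin ℝ (fun z => l z + L z) S y (grad G S (fun z => l z + L z) y)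
    - fderivWithin ℝ (fun z => l z + L z) S y (Y y) ^ 2 with hq2
  have hqs := Real.sq_sqrt hq0
  have hqp := Real.sqrt_nonneg q2
  have hQ : fderivWithin ℝ L S y (grad G S L y) - fderivWithin ℝ L S y (Y y) ^ 2 ≤
      (3 / 2) * q2 + 3 * B ^ 2 := by
    have : fderivWithin ℝ L S y (grad G S L y) - fderivWithin ℝ L S y (Y y) ^ 2 ≤
      (3 / 2) * q2 + 3 * (fderivWithin ℝ l S y (grad G S l y) - fderivWithin ℝ l S y (Y y) ^ 2) := by
      rw [hdψ] at hq1
      rw [hq2, grad, grad, grad, hdψ]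
      simp only [map_add, map_smul, _root_.add_apply, _root_.smul_apply, smul_eq_mul] at hq1 ⊢
      linarith
    linarith [sq_nonneg (fderivWithin ℝ l S y (Y y))]
  have hk : C₀ * √q2 ≤ q2 / 4 + C₀ ^ 2 := by nlinarith [sq_nonneg (√q2 - 2 * C₀)]
  have hk1 : 0 ≤ C₀ * B := mul_nonneg hC₀ hB
  have hψ : graphLap G S l Y (fun z => l z + L z) y ≤ - q2 + C₀ * (1 + √q2) + 2 * B + 2 * B ^ 2
      + Module.finrank ℝ E * B := by
    linarith [(abs_le.1 hHY).2]
  have hL : graphLap G S l Y L y ≤ - q2 + C₀ * (1 + √q2) + 3 * B + 2 * B ^ 2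
      + 2 * (Module.finrank ℝ E * B) + C₀ * B := by
    linarith
  linarith [sq_nonneg C₀, sq_nonneg B]

end GraphMetric

section Transition

variable {E : Type*} [NormedAddCommGroup E] [NormedSpace ℝ E] [FiniteDimensional ℝ E]

/-- The map `κ` is a local isometry from the metric `G₁` near `y` to the metric `G₂`. -/
structure IsTransition (G₁ : E → E →L[ℝ] E →L[ℝ] ℝ) (S₁ : Set E) (G₂ : E → E →L[ℝ] E →L[ℝ] ℝ)
    (S₂ : Set E) (κ : E → E) (y : E) : Prop where
  metric₁ : IsMetricAt G₁ S₁ y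
  metric₂ : IsMetricAt G₂ S₂ (κ y)
  contDiff : ContDiffWithinAt ℝ 3 κ S₁ y
  maps : ∀ᶠ z in 𝓝[S₁] y, κ z ∈ S₂
  pull : ∀ᶠ z in 𝓝[S₁] y,
    G₁ z = pullForm (G₂ (κ z)) (fderivWithin ℝ κ S₁ z) (fderivWithin ℝ κ S₁ z)

variable {G₁ G₂ : E → E →L[ℝ] E →L[ℝ] ℝ} {S₁ S₂ : Set E} {κ : E → E} {y : E}

theorem IsTransition.tendsto (h : IsTransition G₁ S₁ G₂ S₂ κ y) :
    Tendsto κ (𝓝[S₁] y) (𝓝[S₂] (κ y)) :=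
  tendsto_nhdsWithin_iff.2 ⟨h.contDiff.continuousWithinAt, h.maps⟩

theorem IsTransition.eventually (h : IsTransition G₁ S₁ G₂ S₂ κ y) :
    ∀ᶠ z in 𝓝[S₁] y, IsTransition G₁ S₁ G₂ S₂ κ z := by
  filter_upwards [h.metric₁.eventually, h.tendsto.eventually h.metric₂.eventually,
    ContDiffWithinAt.eventually_of_mem (n := 3) h.contDiff h.metric₁.mem,
    eventually_eventually_nhdsWithin.2 h.maps, eventually_eventually_nhdsWithin.2 h.pull]
    with z h1 h2 h3 h4 h5
  exact ⟨h1, h2, h3, h4, h5⟩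

theorem IsTransition.contDiff' (h : IsTransition G₁ S₁ G₂ S₂ κ y) : ContDiffWithinAt ℝ 2 κ S₁ y :=
  h.contDiff.of_le (by norm_num)

theorem IsTransition.hasFDerivWithinAt (h : IsTransition G₁ S₁ G₂ S₂ κ y) :
    HasFDerivWithinAt κ (fderivWithin ℝ κ S₁ y) S₁ y :=
  IsDomain.hasFDerivWithinAt h.contDiff (by simp)

theorem IsTransition.pull_apply (h : IsTransition G₁ S₁ G₂ S₂ κ y) (X Z : E) :
    G₁ y X Z = G₂ (κ y) (fderivWithin ℝ κ S₁ y X) (fderivWithin ℝ κ S₁ y Z) := by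
  rw [h.pull.self_of_nhdsWithin h.metric₁.mem]
  rfl

theorem IsTransition.exists_equiv (h : IsTransition G₁ S₁ G₂ S₂ κ y) :
    ∃ e : E ≃L[ℝ] E, ∀ X, e X = fderivWithin ℝ κ S₁ y X := by
  have hi : Function.Injective (fderivWithin ℝ κ S₁ y).toLinearMap := by
    intro X Z hXZ
    refine h.metric₁.self.ext fun W => ?_
    rw [h.pull_apply, h.pull_apply]
    exact congrArg (fun a => G₂ (κ y) a (fderivWithin ℝ κ S₁ y W)) hXZ
  exact ⟨(LinearEquiv.ofInjectiveEndo _ hi).toContinuousLinearEquiv, fun X => rfl⟩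

/-- The chain rule for maps between subsets. -/
theorem IsTransition.comp {F : Type*} [NormedAddCommGroup F] [NormedSpace ℝ F]
    (h : IsTransition G₁ S₁ G₂ S₂ κ y) {v : E → F} {v' : E →L[ℝ] F}
    (hv : HasFDerivWithinAt v v' S₂ (κ y)) :
    HasFDerivWithinAt (fun z => v (κ z)) (v' ∘L fderivWithin ℝ κ S₁ y) S₁ y := by
  have h1 : HasFDerivWithinAt (fun z => v (κ z)) (v' ∘L fderivWithin ℝ κ S₁ y) (S₁ ∩ κ ⁻¹' S₂) y :=
    hv.comp y (h.hasFDerivWithinAt.mono inter_subset_left) (fun z hz => hz.2)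
  exact h1.mono_of_mem_nhdsWithin (inter_mem self_mem_nhdsWithin h.maps)

theorem IsTransition.chr_eq (h : IsTransition G₁ S₁ G₂ S₂ κ y) (X Z : E) :
    fderivWithin ℝ κ S₁ y (chr G₁ S₁ y X Z) =
      chr G₂ S₂ (κ y) (fderivWithin ℝ κ S₁ y X) (fderivWithin ℝ κ S₁ y Z)
        + fderivWithin ℝ (fderivWithin ℝ κ S₁) S₁ y X Z := by
  set K := fderivWithin ℝ κ S₁ y with hK
  have hm := h.metric₁
  have hD : ∀ X Z W, fderivWithin ℝ G₁ S₁ y X Z W =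
      fderivWithin ℝ G₂ S₂ (κ y) (K X) (K Z) (K W)
        + G₂ (κ y) (fderivWithin ℝ (fderivWithin ℝ κ S₁) S₁ y X Z) (K W)
        + G₂ (κ y) (K Z) (fderivWithin ℝ (fderivWithin ℝ κ S₁) S₁ y X W) := by
    intro X Z W
    have h1 := (hm.hasFDerivWithinAt.clm_apply (hasFDerivWithinAt_const Z y S₁)).clm_apply
      (hasFDerivWithinAt_const W y S₁)
    have hK' := hm.dom.hasFDerivWithinAt_fderivWithin h.contDiff' hm.mem
    have h2 := ((h.comp h.metric₂.hasFDerivWithinAt).clm_apply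
      (hK'.clm_apply (hasFDerivWithinAt_const Z y S₁))).clm_apply
      (hK'.clm_apply (hasFDerivWithinAt_const W y S₁))
    have h3 : ∀ᶠ z in 𝓝[S₁] y, G₁ z Z W =
        G₂ (κ z) (fderivWithin ℝ κ S₁ z Z) (fderivWithin ℝ κ S₁ z W) :=
      h.eventually.mono fun z hz => hz.pull_apply Z W
    have h4 := DFunLike.congr_fun (hm.dom.eq_of_eventuallyEq hm.mem h3 h1 h2) X
    simp only [ContinuousLinearMap.comp_zero, zero_add, ContinuousLinearMap.flip_apply,
      _root_.add_apply, ContinuousLinearMap.comp_apply] at h4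
    rw [h4]
    ring
  obtain ⟨e, he⟩ := h.exists_equiv
  refine h.metric₂.self.ext fun W' => ?_
  obtain ⟨W, rfl⟩ := e.surjective W'
  have he' : ∀ X, e X = K X := he
  rw [he', ← h.pull_apply, hm.apply_chr, hD, hD, hD, map_add, _root_.add_apply, h.metric₂.apply_chr,
    hm.dom.symm h.contDiff' hm.mem W X, hm.dom.symm h.contDiff' hm.mem W Z,
    hm.dom.symm h.contDiff' hm.mem Z X,
    h.metric₂.self.symm (K Z), h.metric₂.self.symm (K X)]
  ring

theorem IsTransition.fderivWithin_comp (h : IsTransition G₁ S₁ G₂ S₂ κ y) {v₁ v₂ : E → ℝ}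
    (hv : ∀ᶠ z in 𝓝[S₁] y, v₁ z = v₂ (κ z)) (hd : DifferentiableWithinAt ℝ v₂ S₂ (κ y)) :
    fderivWithin ℝ v₁ S₁ y = fderivWithin ℝ v₂ S₂ (κ y) ∘L fderivWithin ℝ κ S₁ y :=
  ((h.comp hd.hasFDerivWithinAt).congr_of_eventuallyEq hv
    (hv.self_of_nhdsWithin h.metric₁.mem)).fderivWithin (h.metric₁.dom.unique y h.metric₁.mem)

theorem IsTransition.hess_eq (h : IsTransition G₁ S₁ G₂ S₂ κ y) {v₁ v₂ : E → ℝ}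
    (hv : ∀ᶠ z in 𝓝[S₁] y, v₁ z = v₂ (κ z)) (hd : ContDiffWithinAt ℝ 2 v₂ S₂ (κ y)) (X Z : E) :
    hess G₁ S₁ v₁ y X Z =
      hess G₂ S₂ v₂ (κ y) (fderivWithin ℝ κ S₁ y X) (fderivWithin ℝ κ S₁ y Z) := by
  have hm := h.metric₁
  have hm₂ := h.metric₂
  have he : ∀ᶠ z in 𝓝[S₁] y, fderivWithin ℝ v₁ S₁ z =
      fderivWithin ℝ v₂ S₂ (κ z) ∘L fderivWithin ℝ κ S₁ z := by
    filter_upwards [h.eventually, eventually_eventually_nhdsWithin.2 hv,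
      h.tendsto.eventually (ContDiffWithinAt.eventually_of_mem (n := 2) hd hm₂.mem)] with z h1 h2 h3
    exact h1.fderivWithin_comp h2 (h3.differentiableWithinAt (by simp))
  have h1 := (h.comp (hm₂.dom.hasFDerivWithinAt_fderivWithin hd hm₂.mem)).clm_comp
    (hm.dom.hasFDerivWithinAt_fderivWithin h.contDiff' hm.mem)
  have h2 := (h1.congr_of_eventuallyEq he (he.self_of_nhdsWithin hm.mem)).fderivWithin
    (hm.dom.unique y hm.mem)
  rw [hess_apply, h2, he.self_of_nhdsWithin hm.mem, ContinuousLinearMap.comp_apply, h.chr_eq,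
    hess_apply, map_add]
  change fderivWithin ℝ v₂ S₂ (κ y) (fderivWithin ℝ (fderivWithin ℝ κ S₁) S₁ y X Z)
    + fderivWithin ℝ (fderivWithin ℝ v₂ S₂) S₂ (κ y) (fderivWithin ℝ κ S₁ y X)
      (fderivWithin ℝ κ S₁ y Z) - _ = _
  ring

theorem IsTransition.covd_eq (h : IsTransition G₁ S₁ G₂ S₂ κ y) {Y₁ Y₂ : E → E}
    (hY : ∀ᶠ z in 𝓝[S₁] y, Y₂ (κ z) = fderivWithin ℝ κ S₁ z (Y₁ z))
    (h₁ : DifferentiableWithinAt ℝ Y₁ S₁ y) (h₂ : DifferentiableWithinAt ℝ Y₂ S₂ (κ y)) (X : E) :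
    covd G₂ S₂ Y₂ (κ y) (fderivWithin ℝ κ S₁ y X) =
      fderivWithin ℝ κ S₁ y (covd G₁ S₁ Y₁ y X) := by
  have hm := h.metric₁
  have e1 := (hm.dom.hasFDerivWithinAt_fderivWithin h.contDiff' hm.mem).clm_apply h₁.hasFDerivWithinAt
  have e2 := DFunLike.congr_fun
    (hm.dom.eq_of_eventuallyEq hm.mem hY (h.comp h₂.hasFDerivWithinAt) e1) X
  change fderivWithin ℝ Y₂ S₂ (κ y) (fderivWithin ℝ κ S₁ y X) =
    fderivWithin ℝ κ S₁ y (fderivWithin ℝ Y₁ S₁ y X)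
      + fderivWithin ℝ (fderivWithin ℝ κ S₁) S₁ y X (Y₁ y) at e2
  rw [covd_apply, covd_apply, e2, hY.self_of_nhdsWithin hm.mem, map_add, h.chr_eq]
  abel

theorem IsTransition.trace_covd_eq (h : IsTransition G₁ S₁ G₂ S₂ κ y) {Y₁ Y₂ : E → E}
    (hY : ∀ᶠ z in 𝓝[S₁] y, Y₂ (κ z) = fderivWithin ℝ κ S₁ z (Y₁ z))
    (h₁ : DifferentiableWithinAt ℝ Y₁ S₁ y) (h₂ : DifferentiableWithinAt ℝ Y₂ S₂ (κ y)) :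
    traceL E (covd G₂ S₂ Y₂ (κ y)) = traceL E (covd G₁ S₁ Y₁ y) := by
  obtain ⟨e, he⟩ := h.exists_equiv
  exact traceL_conj e fun X => by rw [he, he, h.covd_eq hY h₁ h₂]

theorem IsTransition.fderivWithin_chr_eq (h : IsTransition G₁ S₁ G₂ S₂ κ y) (W X Z : E) :
    fderivWithin ℝ κ S₁ y (fderivWithin ℝ (chr G₁ S₁) S₁ y W X Z) =
      fderivWithin ℝ (chr G₂ S₂) S₂ (κ y) (fderivWithin ℝ κ S₁ y W) (fderivWithin ℝ κ S₁ y X)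
          (fderivWithin ℝ κ S₁ y Z)
        + chr G₂ S₂ (κ y) (fderivWithin ℝ (fderivWithin ℝ κ S₁) S₁ y W X) (fderivWithin ℝ κ S₁ y Z)
        + chr G₂ S₂ (κ y) (fderivWithin ℝ κ S₁ y X) (fderivWithin ℝ (fderivWithin ℝ κ S₁) S₁ y W Z)
        + fderivWithin ℝ (fderivWithin ℝ (fderivWithin ℝ κ S₁) S₁) S₁ y W X Z
        - fderivWithin ℝ (fderivWithin ℝ κ S₁) S₁ y W (chr G₁ S₁ y X Z) := by
  have hm := h.metric₁
  have cX := hasFDerivWithinAt_const (𝕜 := ℝ) X y S₁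
  have cZ := hasFDerivWithinAt_const (𝕜 := ℝ) Z y S₁
  have hκ2 : ContDiffWithinAt ℝ 2 (fderivWithin ℝ κ S₁) S₁ y :=
    h.contDiff.fderivWithin_right hm.dom.unique (by norm_num) hm.mem
  have hK' := hm.dom.hasFDerivWithinAt_fderivWithin h.contDiff' hm.mem
  have hK'' := hm.dom.hasFDerivWithinAt_fderivWithin hκ2 hm.mem
  have e1 := hK'.clm_apply ((hm.hasFDerivWithinAt_chr.clm_apply cX).clm_apply cZ)
  have e2 := (((h.comp h.metric₂.hasFDerivWithinAt_chr).clm_apply (hK'.clm_apply cX)).clm_apply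
    (hK'.clm_apply cZ)).add ((hK''.clm_apply cX).clm_apply cZ)
  have e3 := DFunLike.congr_fun (hm.dom.eq_of_eventuallyEq hm.mem
    (h.eventually.mono fun z hz => hz.chr_eq X Z) e1 e2) W
  simp only [ContinuousLinearMap.comp_zero, zero_add, ContinuousLinearMap.flip_apply,
      _root_.add_apply, ContinuousLinearMap.comp_apply] at e3
  rw [eq_sub_iff_add_eq, e3]
  abel

theorem IsTransition.jacobiOp_eq (h : IsTransition G₁ S₁ G₂ S₂ κ y) (X Z : E) :
    jacobiOp G₂ S₂ (κ y) (fderivWithin ℝ κ S₁ y X) (fderivWithin ℝ κ S₁ y Z) =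
      fderivWithin ℝ κ S₁ y (jacobiOp G₁ S₁ y X Z) := by
  have hm := h.metric₁
  have hκ2 : ContDiffWithinAt ℝ 2 (fderivWithin ℝ κ S₁) S₁ y :=
    h.contDiff.fderivWithin_right hm.dom.unique (by norm_num) hm.mem
  have hs := hm.dom.symm hκ2 hm.mem Z X
  rw [jacobiOp_apply, jacobiOp_apply, map_sub, map_add, map_sub, h.fderivWithin_chr_eq,
    h.fderivWithin_chr_eq, h.chr_eq Z (chr G₁ S₁ y X X), h.chr_eq X (chr G₁ S₁ y Z X), h.chr_eq,
    h.chr_eq, map_add, map_add, hs, hm.dom.symm h.contDiff' hm.mem Z X,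
    h.metric₂.chr_symm (fderivWithin ℝ κ S₁ y X)
      (fderivWithin ℝ (fderivWithin ℝ κ S₁) S₁ y X Z)]
  abel

theorem IsTransition.trace_jacobiOp_eq (h : IsTransition G₁ S₁ G₂ S₂ κ y) (X : E) :
    traceL E (jacobiOp G₂ S₂ (κ y) (fderivWithin ℝ κ S₁ y X)) = traceL E (jacobiOp G₁ S₁ y X) := by
  obtain ⟨e, he⟩ := h.exists_equiv
  exact traceL_conj e fun Z => by rw [he, he, h.jacobiOp_eq]

/-- At the point `y` the curvature of `G` is bounded below, and the positive function `v` has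
first and second derivatives bounded by multiples of `v`. -/
def BoundedGeometryAt (G : E → E →L[ℝ] E →L[ℝ] ℝ) (S : Set E) (v : E → ℝ) (B : ℝ) (y : E) : Prop :=
  ∀ X, - traceL E (jacobiOp G S y X) ≤ B * G y X X ∧
    |fderivWithin ℝ v S y X| ≤ B * v y * √(G y X X) ∧ |hess G S v y X X| ≤ B * v y * G y X X

theorem IsTransition.boundedGeometryAt (h : IsTransition G₁ S₁ G₂ S₂ κ y) {v₁ v₂ : E → ℝ} {B : ℝ}
    (hv : ∀ᶠ z in 𝓝[S₁] y, v₁ z = v₂ (κ z)) (hd : ContDiffWithinAt ℝ 2 v₂ S₂ (κ y))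
    (hB : BoundedGeometryAt G₁ S₁ v₁ B y) : BoundedGeometryAt G₂ S₂ v₂ B (κ y) := by
  obtain ⟨e, he⟩ := h.exists_equiv
  intro X'
  obtain ⟨X, rfl⟩ := e.surjective X'
  have := hB X
  rw [h.pull_apply, hv.self_of_nhdsWithin h.metric₁.mem, h.hess_eq hv hd,
    h.fderivWithin_comp hv (hd.differentiableWithinAt (by simp)), ← h.trace_jacobiOp_eq] at this
  rw [he]
  exact this

end Transition

section ExplicitGraph

variable {E : Type*} [NormedAddCommGroup E] [NormedSpace ℝ E] [FiniteDimensional ℝ E]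

/-- The logarithm of the vertical part of the unit normal of the graph of `f`. -/
def graphL (G : E → E →L[ℝ] E →L[ℝ] ℝ) (S : Set E) (l f : E → ℝ) (y : E) : ℝ :=
  -(1 / 2) * Real.log (1 + Real.exp (l y) ^ 2 * fderivWithin ℝ f S y (grad G S f y))

/-- The horizontal part of the downward unit normal of the graph of `f`. -/
def graphY (G : E → E →L[ℝ] E →L[ℝ] ℝ) (S : Set E) (l f : E → ℝ) (y : E) : E :=
  Real.exp (l y + graphL G S l f y) • grad G S f y

variable {G : E → E →L[ℝ] E →L[ℝ] ℝ} {S : Set E} {l f : E → ℝ} {y : E}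

theorem IsInner.dual_nonneg {B : E →L[ℝ] E →L[ℝ] ℝ} (hB : IsInner B) (a : E →L[ℝ] ℝ) :
    0 ≤ a (B.inverse a) := by
  have h := hB.nonneg (B.inverse a)
  rwa [hB.apply_inverse] at h

theorem exp_graphL (hG : IsInner (G y)) :
    Real.exp (graphL G S l f y) ^ 2
      * (1 + Real.exp (l y) ^ 2 * fderivWithin ℝ f S y (grad G S f y)) = 1 := by
  have h0 : 0 ≤ fderivWithin ℝ f S y (grad G S f y) := hG.dual_nonneg _
  have h1 : 0 < 1 + Real.exp (l y) ^ 2 * fderivWithin ℝ f S y (grad G S f y) := by positivity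
  rw [← Real.exp_nat_mul, graphL]
  have : ((2 : ℕ) : ℝ) * (-(1 / 2) * Real.log (1 + Real.exp (l y) ^ 2 *
      fderivWithin ℝ f S y (grad G S f y)))
      = - Real.log (1 + Real.exp (l y) ^ 2 * fderivWithin ℝ f S y (grad G S f y)) := by
    push_cast; ring
  rw [this, Real.exp_neg, Real.exp_log h1, inv_mul_cancel₀ h1.ne']

theorem graph_dual (hG : IsInner (G y)) :
    G y (graphY G S l f y) = Real.exp (l y + graphL G S l f y) • fderivWithin ℝ f S y := by
  rw [graphY, map_smul, grad, hG.apply_inverse]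

theorem graph_norm (hG : IsInner (G y)) :
    G y (graphY G S l f y) (graphY G S l f y) = 1 - Real.exp (graphL G S l f y) ^ 2 := by
  have := exp_graphL (S := S) (l := l) (f := f) hG
  rw [graph_dual hG, graphY, _root_.smul_apply, map_smul, smul_eq_mul, smul_eq_mul, Real.exp_add]
  linear_combination this

/-- The relations between the normal and the graph function determine the normal. -/
theorem graph_unique (hG : IsInner (G y)) {Y : E} {w : ℝ} (hw : 0 < w)
    (h1 : ∀ X, G y Y X = Real.exp (l y) * w * fderivWithin ℝ f S y X)
    (h2 : G y Y Y = 1 - w ^ 2) : w = Real.exp (graphL G S l f y) ∧ Y = graphY G S l f y := by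
  have hY : Y = (Real.exp (l y) * w) • grad G S f y := by
    refine hG.ext fun X => ?_
    rw [h1, map_smul, grad, hG.apply_inverse]
    rfl
  have hw2 : w = Real.exp (graphL G S l f y) := by
    have h3 : w ^ 2 * (1 + Real.exp (l y) ^ 2 * fderivWithin ℝ f S y (grad G S f y)) = 1 := by
      rw [h1] at h2
      have : fderivWithin ℝ f S y Y
          = Real.exp (l y) * w * fderivWithin ℝ f S y (grad G S f y) := by
        rw [hY, map_smul, smul_eq_mul]
      rw [this] at h2
      linear_combination h2
    have h4 := exp_graphL (S := S) (l := l) (f := f) hG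
    have h5 : 0 ≤ fderivWithin ℝ f S y (grad G S f y) := hG.dual_nonneg _
    have h6 : 0 < 1 + Real.exp (l y) ^ 2 * fderivWithin ℝ f S y (grad G S f y) := by positivity
    have h7 : w ^ 2 = Real.exp (graphL G S l f y) ^ 2 :=
      mul_right_cancel₀ h6.ne' (h3.trans h4.symm)
    exact (pow_left_inj₀ hw.le (Real.exp_pos _).le two_ne_zero).1 h7
  refine ⟨hw2, ?_⟩
  rw [graphY, Real.exp_add, ← hw2, hY]

theorem IsMetricAt.contDiff_grad (h : IsMetricAt G S y) (hf : ContDiffWithinAt ℝ 3 f S y) :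
    ContDiffWithinAt ℝ 2 (grad G S f) S y :=
  h.contDiff_inverse.clm_apply (hf.fderivWithin_right h.dom.unique (by norm_num) h.mem)

theorem IsMetricAt.isGraphAt (h : IsMetricAt G S y) (hl : ContDiffWithinAt ℝ 2 l S y)
    (hf : ContDiffWithinAt ℝ 3 f S y) :
    IsGraphAt G S l (graphL G S l f) f (graphY G S l f) y := by
  have hg := h.contDiff_grad hf
  have h0 : 0 ≤ fderivWithin ℝ f S y (grad G S f y) := h.self.dual_nonneg _
  have hL : ContDiffWithinAt ℝ 2 (graphL G S l f) S y := by
    refine contDiffWithinAt_const.mul (ContDiffWithinAt.log ?_ (by positivity))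
    exact contDiffWithinAt_const.add ((hl.exp.pow 2).mul
      ((hf.fderivWithin_right h.dom.unique (by norm_num) h.mem).clm_apply hg))
  exact ⟨h, hl, hL, hf, (hl.add hL).exp.smul hg, h.inner.mono fun z hz => graph_dual hz,
    h.inner.mono fun z hz => graph_norm hz⟩

theorem IsTransition.graphH_eq {G₁ G₂ : E → E →L[ℝ] E →L[ℝ] ℝ} {S₁ S₂ : Set E} {κ : E → E}
    (h : IsTransition G₁ S₁ G₂ S₂ κ y) {l₁ l₂ f₁ f₂ : E → ℝ}
    (hl : ∀ᶠ z in 𝓝[S₁] y, l₁ z = l₂ (κ z)) (hl₂ : ContDiffWithinAt ℝ 2 l₂ S₂ (κ y))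
    (hl₁ : ContDiffWithinAt ℝ 2 l₁ S₁ y) (hf₁ : ContDiffWithinAt ℝ 3 f₁ S₁ y)
    (hf : ∀ᶠ z in 𝓝[S₁] y, f₁ z = f₂ (κ z)) (hf₂ : ContDiffWithinAt ℝ 3 f₂ S₂ (κ y)) :
    graphH G₂ S₂ l₂ (graphY G₂ S₂ l₂ f₂) (κ y) = graphH G₁ S₁ l₁ (graphY G₁ S₁ l₁ f₁) y := by
  have hm := h.metric₁
  have hY : ∀ᶠ z in 𝓝[S₁] y, graphY G₂ S₂ l₂ f₂ (κ z) =
      fderivWithin ℝ κ S₁ z (graphY G₁ S₁ l₁ f₁ z) := by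
    filter_upwards [h.eventually, hl, eventually_eventually_nhdsWithin.2 hf,
      h.tendsto.eventually (ContDiffWithinAt.eventually_of_mem (n := 3) hf₂ h.metric₂.mem)]
      with z h1 h2 h3 h4
    have e1 := h1.fderivWithin_comp h3 (h4.differentiableWithinAt (by simp))
    have e2 : grad G₂ S₂ f₂ (κ z) = fderivWithin ℝ κ S₁ z (grad G₁ S₁ f₁ z) := by
      obtain ⟨e, he⟩ := h1.exists_equiv
      refine h1.metric₂.self.inverse_eq fun Z' => ?_
      obtain ⟨Z, rfl⟩ := e.surjective Z'
      rw [he, ← h1.pull_apply, grad, h1.metric₁.self.apply_inverse, e1]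
      rfl
    have e3 : graphL G₂ S₂ l₂ f₂ (κ z) = graphL G₁ S₁ l₁ f₁ z := by
      rw [graphL, graphL, e2, e1, h2]
      rfl
    rw [graphY, graphY, e3, e2, h2, map_smul]
  have hd₁ := (hm.isGraphAt hl₁ hf₁).contDiff_Y.differentiableWithinAt (by simp)
  have hd₂ := (h.metric₂.isGraphAt hl₂ hf₂).contDiff_Y.differentiableWithinAt (by simp)
  rw [graphH, graphH, h.trace_covd_eq hY hd₁ hd₂,
    h.fderivWithin_comp hl (hl₂.differentiableWithinAt (by simp)), hY.self_of_nhdsWithin hm.mem]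
  rfl

theorem chr_congr {G₁ G₂ : E → E →L[ℝ] E →L[ℝ] ℝ} (hy : y ∈ S) (h : G₁ =ᶠ[𝓝[S] y] G₂) :
    chr G₁ S y = chr G₂ S y := by
  rw [chr, chr, h.fderivWithin_eq (h.self_of_nhdsWithin hy), h.self_of_nhdsWithin hy]

theorem hess_congr {G₁ G₂ : E → E →L[ℝ] E →L[ℝ] ℝ} (hy : y ∈ S) (h : G₁ =ᶠ[𝓝[S] y] G₂)
    {v₁ v₂ : E → ℝ} (hv : v₁ =ᶠ[𝓝[S] y] v₂) : hess G₁ S v₁ y = hess G₂ S v₂ y := by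
  have h1 : fderivWithin ℝ v₁ S =ᶠ[𝓝[S] y] fderivWithin ℝ v₂ S := hv.fderivWithin
  rw [hess, hess, chr_congr hy h, h1.fderivWithin_eq (h1.self_of_nhdsWithin hy),
    h1.self_of_nhdsWithin hy]

end ExplicitGraph

section Warped

variable {E : Type*} [NormedAddCommGroup E] [NormedSpace ℝ E] [FiniteDimensional ℝ E]

/-- The metric `G + e^{2l} dt²` on the product of a subset of a vector space with the line. -/
def warpedG (G : E → E →L[ℝ] E →L[ℝ] ℝ) (l : E → ℝ) (p : E × ℝ) : E × ℝ →L[ℝ] E × ℝ →L[ℝ] ℝ :=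
  pullForm (G p.1) (ContinuousLinearMap.fst ℝ E ℝ) (ContinuousLinearMap.fst ℝ E ℝ)
    + Real.exp (l p.1) ^ 2 • pullForm (ContinuousLinearMap.mul ℝ ℝ)
      (ContinuousLinearMap.snd ℝ E ℝ) (ContinuousLinearMap.snd ℝ E ℝ)

variable {G : E → E →L[ℝ] E →L[ℝ] ℝ} {S : Set E} {l f : E → ℝ} {y : E} {t : ℝ}

theorem warpedG_apply (p X Z : E × ℝ) :
    warpedG G l p X Z = G p.1 X.1 Z.1 + Real.exp (l p.1) ^ 2 * (X.2 * Z.2) := rfl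

theorem IsDomain.prod_univ (hS : IsDomain S) : IsDomain (S ×ˢ (univ : Set ℝ)) where
  unique := hS.unique.prod uniqueDiffOn_univ
  dense := by
    rw [interior_prod_eq, closure_prod_eq, interior_univ, closure_univ]
    exact prod_mono hS.dense subset_rfl

theorem tendsto_fst_prod_univ :
    Tendsto Prod.fst (𝓝[S ×ˢ (univ : Set ℝ)] (y, t)) (𝓝[S] y) := by
  rw [nhdsWithin_prod_eq]
  exact tendsto_fst

theorem IsMetricAt.warped (h : IsMetricAt G S y) (hl : ContDiffWithinAt ℝ 2 l S y) :
    IsMetricAt (warpedG G l) (S ×ˢ (univ : Set ℝ)) (y, t) where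
  dom := h.dom.prod_univ
  mem := ⟨h.mem, mem_univ _⟩
  inner := by
    filter_upwards [tendsto_fst_prod_univ.eventually h.inner] with p hp
    refine ⟨fun X Z => ?_, fun X hX => ?_⟩
    · rw [warpedG_apply, warpedG_apply, hp.symm, mul_comm X.2]
    · rw [warpedG_apply]
      have h1 := hp.nonneg X.1
      have h2 := mul_self_nonneg X.2
      rcases eq_or_ne X.1 0 with h3 | h3
      · have h4 : X.2 ≠ 0 := fun h4 => hX (Prod.ext h3 h4)
        have := mul_self_pos.2 h4
        positivity
      · have := hp.pos _ h3
        positivity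
  contDiff := by
    have hmaps : MapsTo Prod.fst (S ×ˢ (univ : Set ℝ)) S := fun p hp => hp.1
    have h1 : ContDiffWithinAt ℝ 2 (fun p : E × ℝ => G p.1) (S ×ˢ univ) (y, t) :=
      h.contDiff.comp (y, t) contDiff_fst.contDiffWithinAt hmaps
    have h2 : ContDiffWithinAt ℝ 2 (fun p : E × ℝ => l p.1) (S ×ˢ univ) (y, t) :=
      hl.comp (y, t) contDiff_fst.contDiffWithinAt hmaps
    exact (contDiffWithinAt_const.clm_comp (h1.clm_comp contDiffWithinAt_const)).add
      ((h2.exp.pow 2).smul contDiffWithinAt_const)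

theorem IsMetricAt.fderiv_warped (h : IsMetricAt G S y) (hl : ContDiffWithinAt ℝ 2 l S y)
    (Z X W : E × ℝ) :
    fderivWithin ℝ (warpedG G l) (S ×ˢ (univ : Set ℝ)) (y, t) Z X W =
      fderivWithin ℝ G S y Z.1 X.1 W.1
        + 2 * Real.exp (l y) ^ 2 * fderivWithin ℝ l S y Z.1 * (X.2 * W.2) := by
  have hw := h.warped (t := t) hl
  have hmaps : MapsTo Prod.fst (S ×ˢ (univ : Set ℝ)) S := fun p hp => hp.1
  have hfst : HasFDerivWithinAt Prod.fst (ContinuousLinearMap.fst ℝ E ℝ)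
      (S ×ˢ (univ : Set ℝ)) (y, t) := hasFDerivWithinAt_fst
  have h1 := (hw.hasFDerivWithinAt.clm_apply (hasFDerivWithinAt_const X _ _)).clm_apply
    (hasFDerivWithinAt_const W _ _)
  have h2 := ((HasFDerivWithinAt.comp (y, t) (h.hasFDerivWithinAt) hfst hmaps).clm_apply
    (hasFDerivWithinAt_const X.1 _ _)).clm_apply (hasFDerivWithinAt_const W.1 _ _)
  have h3 := ((HasFDerivWithinAt.comp (y, t) (IsDomain.hasFDerivWithinAt hl (by simp)) hfst
    hmaps).exp.pow 2).mul_const (X.2 * W.2)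
  have h4 := DFunLike.congr_fun (hw.dom.eq_of_eventuallyEq hw.mem
    (Eventually.of_forall fun p => warpedG_apply p X W) h1 (h2.add h3)) Z
  simp only [ContinuousLinearMap.comp_zero, zero_add, ContinuousLinearMap.flip_apply,
      _root_.add_apply, ContinuousLinearMap.comp_apply, _root_.smul_apply, smul_eq_mul,
      nsmul_eq_mul, ContinuousLinearMap.coe_fst', Function.comp_apply] at h4
  rw [h4]
  push_cast
  ring

theorem IsMetricAt.chr_warped (h : IsMetricAt G S y) (hl : ContDiffWithinAt ℝ 2 l S y)
    (X Z : E × ℝ) :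
    chr (warpedG G l) (S ×ˢ (univ : Set ℝ)) (y, t) X Z =
      (chr G S y X.1 Z.1 - (Real.exp (l y) ^ 2 * (X.2 * Z.2)) • grad G S l y,
        X.2 * fderivWithin ℝ l S y Z.1 + Z.2 * fderivWithin ℝ l S y X.1) := by
  have hw := h.warped (t := t) hl
  refine hw.self.ext fun W => ?_
  rw [hw.apply_chr, h.fderiv_warped hl, h.fderiv_warped hl, h.fderiv_warped hl, warpedG_apply]
  simp only [map_sub, map_smul, _root_.sub_apply, _root_.smul_apply, smul_eq_mul, grad,
    h.self.apply_inverse, h.apply_chr]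
  ring

end Warped

section Charts

variable {E : Type*} [NormedAddCommGroup E] [NormedSpace ℝ E] [FiniteDimensional ℝ E]
  {H : Type*} [TopologicalSpace H] {I : ModelWithCorners ℝ E H}
  {M : Type*} [TopologicalSpace M] [ChartedSpace H M] [IsManifold I ∞ M]

/-- A `C^2` Riemannian metric, in terms of its components in charts. -/
structure IsRiemannian (g : FormField I M) : Prop where
  symm : ∀ x X Y, g x X Y = g x Y X
  pos : ∀ x X, X ≠ 0 → 0 < g x X X
  contDiffOn : ∀ p, ContDiffOn ℝ 2 (formInChart g p) (extChartAt I p).target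

theorem isDomain_range (I : ModelWithCorners ℝ E H) : IsDomain (range I) :=
  ⟨I.uniqueDiffOn, I.range_subset_closure_interior⟩

theorem formInChart_extChartAt (h : FormField I M) {p x : M} (hx : x ∈ (extChartAt I p).source)
    (X Z : E) : formInChart h p (extChartAt I p x) X Z =
      h x (tangentCoordChange I p x x X) (tangentCoordChange I p x x Z) := by
  let A : M → ℝ := fun x => h x (tangentCoordChange I p x x X) (tangentCoordChange I p x x Z)
  change A ((extChartAt I p).symm (extChartAt I p x)) = A x
  rw [(extChartAt I p).left_inv hx]

theorem formInChart_self (h : FormField I M) (x : M) :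
    formInChart h x (extChartAt I x x) = h x := by
  refine ContinuousLinearMap.ext fun X => ContinuousLinearMap.ext fun Z => ?_
  have h1 : ∀ V : E, tangentCoordChange I x x x V = V := fun V =>
    tangentCoordChange_self (mem_extChartAt_source x)
  rw [formInChart_extChartAt h (mem_extChartAt_source x), h1, h1]
  rfl

theorem tangentCoordChange_inv {x y z : M} (hx : z ∈ (extChartAt I x).source)
    (hy : z ∈ (extChartAt I y).source) (v : E) :
    tangentCoordChange I y x z (tangentCoordChange I x y z v) = v := by
  rw [tangentCoordChange_comp ⟨⟨hx, hy⟩, hx⟩, tangentCoordChange_self hx]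

theorem IsRiemannian.isInner {g : FormField I M} (hg : IsRiemannian g) {p x : M}
    (hx : x ∈ (extChartAt I p).source) : IsInner (formInChart g p (extChartAt I p x)) where
  symm X Z := by
    rw [formInChart_extChartAt g hx, formInChart_extChartAt g hx]
    exact hg.symm x _ _
  pos X hX := by
    rw [formInChart_extChartAt g hx]
    refine hg.pos x _ fun h => hX ?_
    rw [← tangentCoordChange_inv hx (mem_extChartAt_source x) X]
    exact (congrArg _ h).trans (map_zero _)

theorem eventually_mem_source {p x : M} (hx : x ∈ (extChartAt I p).source) {U : Set M}
    (hU : U ∈ 𝓝 x) : ∀ᶠ z in 𝓝[range I] (extChartAt I p x),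
      z ∈ (extChartAt I p).target ∧ (extChartAt I p).symm z ∈ U := by
  have h1 := extChartAt_target_mem_nhdsWithin' hx
  have h2 : ContinuousAt (extChartAt I p).symm (extChartAt I p x) :=
    continuousAt_extChartAt_symm' hx
  have h3 : U ∈ 𝓝 ((extChartAt I p).symm (extChartAt I p x)) := by
    rwa [(extChartAt I p).left_inv hx]
  exact inter_mem h1 (mem_nhdsWithin_of_mem_nhds (h2 h3))

theorem IsRiemannian.isMetricAt {g : FormField I M} (hg : IsRiemannian g) {p x : M}
    (hx : x ∈ (extChartAt I p).source) :
    IsMetricAt (formInChart g p) (range I) (extChartAt I p x) where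
  dom := isDomain_range I
  mem := extChartAt_target_subset_range p ((extChartAt I p).map_source hx)
  contDiff := (hg.contDiffOn p _ ((extChartAt I p).map_source hx)).mono_of_mem_nhdsWithin
    (extChartAt_target_mem_nhdsWithin' hx)
  inner := by
    filter_upwards [eventually_mem_source hx univ_mem] with z hz
    rw [← (extChartAt I p).right_inv hz.1]
    exact hg.isInner ((extChartAt I p).map_target hz.1)

theorem transition_apply {p q x : M} (hx : x ∈ (extChartAt I p).source) :
    (extChartAt I q ∘ (extChartAt I p).symm) (extChartAt I p x) = extChartAt I q x := by
  rw [Function.comp_apply, (extChartAt I p).left_inv hx]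

theorem IsRiemannian.isTransition {g : FormField I M} (hg : IsRiemannian g) {p q x : M}
    (hp : x ∈ (extChartAt I p).source) (hq : x ∈ (extChartAt I q).source) :
    IsTransition (formInChart g p) (range I) (formInChart g q) (range I)
      (extChartAt I q ∘ (extChartAt I p).symm) (extChartAt I p x) where
  metric₁ := hg.isMetricAt hp
  metric₂ := by
    rw [transition_apply hp]
    exact hg.isMetricAt hq
  contDiff := by
    refine contDiffWithinAt_ext_coord_change (I := I) (n := 3) q p ?_
    rw [PartialEquiv.trans_source'', PartialEquiv.symm_symm, PartialEquiv.symm_target]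
    exact mem_image_of_mem _ ⟨hp, hq⟩
  maps := Eventually.of_forall fun z => mem_range_self _
  pull := by
    have hq' : (extChartAt I q).source ∈ 𝓝 x := extChartAt_source_mem_nhds' hq
    filter_upwards [eventually_mem_source hp hq'] with z hz
    obtain ⟨x', hx', rfl⟩ : ∃ x' ∈ (extChartAt I p).source, extChartAt I p x' = z :=
      ⟨_, (extChartAt I p).map_target hz.1, (extChartAt I p).right_inv hz.1⟩
    rw [(extChartAt I p).left_inv hx'] at hz
    refine ContinuousLinearMap.ext fun X => ContinuousLinearMap.ext fun Z => ?_
    change _ = formInChart g q ((extChartAt I q ∘ (extChartAt I p).symm) (extChartAt I p x'))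
      (tangentCoordChange I p q x' X) (tangentCoordChange I p q x' Z)
    have h1 : x' ∈ (extChartAt I p).source ∩ (extChartAt I q).source ∩ (extChartAt I x').source :=
      ⟨⟨hx', hz.2⟩, mem_extChartAt_source x'⟩
    rw [transition_apply hx', formInChart_extChartAt g hx', formInChart_extChartAt g hz.2,
      tangentCoordChange_comp h1, tangentCoordChange_comp h1]

/-- A function in the coordinates of the preferred chart at `p`. -/
def coords (I : ModelWithCorners ℝ E H) {F : Type*} (v : M → F) (p : M) (y : E) : F :=
  v ((extChartAt I p).symm y)

theorem coords_extChartAt {F : Type*} (v : M → F) {p x : M} (hx : x ∈ (extChartAt I p).source) :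
    coords I v p (extChartAt I p x) = v x := by
  rw [coords, (extChartAt I p).left_inv hx]

theorem contDiffWithinAt_coords {F : Type*} [NormedAddCommGroup F] [NormedSpace ℝ F] {v : M → F}
    {U : Set M} {n : ℕ} (hU : IsOpen U)
    (hv : ContMDiffOn I 𝓘(ℝ, F) n v U) {p x : M} (hp : x ∈ (extChartAt I p).source) (hx : x ∈ U) :
    ContDiffWithinAt ℝ n (coords I v p) (range I) (extChartAt I p x) := by
  have h1 : ContMDiffWithinAt 𝓘(ℝ, E) I n (extChartAt I p).symm (range I) (extChartAt I p x) :=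
    contMDiffWithinAt_extChartAt_symm_range p ((extChartAt I p).map_source hp)
  have h2 : ContMDiffAt I 𝓘(ℝ, F) n v ((extChartAt I p).symm (extChartAt I p x)) := by
    rw [(extChartAt I p).left_inv hp]
    exact hv.contMDiffAt (hU.mem_nhds hx)
  exact (h2.comp_contMDiffWithinAt _ h1).contDiffWithinAt

theorem coords_eventually_transition {F : Type*} (v : M → F) {p q x : M}
    (hp : x ∈ (extChartAt I p).source) (hq : x ∈ (extChartAt I q).source) :
    ∀ᶠ z in 𝓝[range I] (extChartAt I p x),
      coords I v p z = coords I v q ((extChartAt I q ∘ (extChartAt I p).symm) z) := by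
  filter_upwards [eventually_mem_source hp (extChartAt_source_mem_nhds' (I := I) hq)] with z hz
  rw [coords, coords, Function.comp_apply, (extChartAt I q).left_inv hz.2]

theorem diff_eq {v : M → ℝ} {x : M} (hv : MDifferentiableAt I 𝓘(ℝ, ℝ) v x) :
    diff (I := I) v x = fderivWithin ℝ (coords I v x) (range I) (extChartAt I x x) :=
  hv.mfderiv

theorem mdifferentiableAt_of_contMDiffOn {v : M → ℝ} {U : Set M} {n : WithTop ℕ∞} (hn : n ≠ 0) (hU : IsOpen U)
    (hv : ContMDiffOn I 𝓘(ℝ, ℝ) n v U) {x : M} (hx : x ∈ U) : MDifferentiableAt I 𝓘(ℝ, ℝ) v x :=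
  (hv.contMDiffAt (hU.mem_nhds hx)).mdifferentiableAt hn

/-- The differential of a function in the preferred chart at a different point. -/
theorem fderivWithin_coords {v : M → ℝ} {p x : M} (hp : x ∈ (extChartAt I p).source)
    (hv : MDifferentiableAt I 𝓘(ℝ, ℝ) v x)
    (X : E) : fderivWithin ℝ (coords I v p) (range I) (extChartAt I p x) X =
      diff (I := I) v x (tangentCoordChange I p x x X) := by
  have hx := mem_extChartAt_source (I := I) x
  rw [diff_eq hv]
  have h1 := hasFDerivWithinAt_tangentCoordChange (I := I) ⟨hp, hx⟩
  have h2 : HasFDerivWithinAt (coords I v x) (fderivWithin ℝ (coords I v x) (range I)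
      (extChartAt I x x)) (range I)
      ((extChartAt I x ∘ (extChartAt I p).symm) (extChartAt I p x)) := by
    rw [transition_apply hp]
    exact ((mdifferentiableAt_iff _ _).1 hv).2.hasFDerivWithinAt
  have h3 := h2.comp (extChartAt I p x) h1 (fun z _ => mem_range_self _)
  have h4 := h3.congr_of_eventuallyEq (coords_eventually_transition v hp hx)
    ((coords_eventually_transition v hp hx).self_of_nhdsWithin
      (extChartAt_target_subset_range p ((extChartAt I p).map_source hp)))
  rw [h4.fderivWithin (I.uniqueDiffOn _
    (extChartAt_target_subset_range p ((extChartAt I p).map_source hp)))]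
  rfl

theorem laplacian_eq (h : FormField I M) (v : M → ℝ) (x : M) :
    laplacian h v x = metricTrace (formInChart h x (extChartAt I x x))
      (hess (formInChart h x) (range I) (coords I v x) (extChartAt I x x)) := by
  rw [formInChart_self]
  rfl

section Graph

variable {g : FormField I M} {u f : M → ℝ} {U : Set M}
  {ν : ∀ x : M, TangentSpace (I.prod 𝓘(ℝ, ℝ)) (graphMap f x)}

/-- The horizontal part of a vector field along a graph. -/
def horizontal (ν : ∀ x : M, TangentSpace (I.prod 𝓘(ℝ, ℝ)) (graphMap f x)) (x : M) :
    TangentSpace I x :=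
  (show E × ℝ from ν x).1

theorem verticalPart_eq (hu : ∀ x, 0 < u x) (x : M) :
    verticalPart g u f ν x = - (u x * (show E × ℝ from ν x).2) := by
  have h1 : verticalPart g u f ν x = g x 0 (-(horizontal ν x)) +
      u x ^ 2 * ((u x)⁻¹ * -(show E × ℝ from ν x).2) := rfl
  have h2 : g x 0 (-(horizontal ν x)) = 0 := by
    rw [map_zero]
    rfl
  rw [h1, h2]
  have := (hu x).ne'
  field_simp
  ring

theorem IsDownwardUnitNormal.spec (hu : ∀ x, 0 < u x) (hν : IsDownwardUnitNormal g u f U ν) {x : M}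
    (hx : x ∈ U) : 0 < verticalPart g u f ν x ∧
      (∀ X, g x (horizontal ν x) X = u x * verticalPart g u f ν x * diff f x X) ∧
      g x (horizontal ν x) (horizontal ν x) = 1 - verticalPart g u f ν x ^ 2 := by
  obtain ⟨h1, h2, h3⟩ := hν x hx
  have h4 := verticalPart_eq (g := g) (ν := ν) hu x
  change g x (horizontal ν x) (horizontal ν x)
    + u x ^ 2 * ((show E × ℝ from ν x).2 * (show E × ℝ from ν x).2) = 1 at h1
  refine ⟨?_, fun X => ?_, ?_⟩
  · rw [h4]
    have := mul_pos (hu x) (neg_pos.2 h3)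
    linarith
  · have h5 : g x (horizontal ν x) X + u x ^ 2 * ((show E × ℝ from ν x).2 * diff f x X) = 0 := h2 X
    rw [h4]
    linear_combination h5
  · rw [h4]
    linear_combination h1

theorem eq_graph (hg : IsRiemannian g) (hu : ∀ x, 0 < u x) (hν : IsDownwardUnitNormal g u f U ν)
    {p x : M} (hp : x ∈ (extChartAt I p).source) (hx : x ∈ U)
    (hf : MDifferentiableAt I 𝓘(ℝ, ℝ) f x) :
    verticalPart g u f ν x = Real.exp (graphL (formInChart g p) (range I)
      (coords I (fun x => Real.log (u x)) p) (coords I f p) (extChartAt I p x)) ∧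
    tangentCoordChange I x p x (horizontal ν x) = graphY (formInChart g p) (range I)
      (coords I (fun x => Real.log (u x)) p) (coords I f p) (extChartAt I p x) := by
  have hself := mem_extChartAt_source (I := I) x
  have key : ∀ Y : E, 0 < verticalPart g u f ν x →
      (∀ X : E, g x Y X = u x * verticalPart g u f ν x * diff (I := I) f x X) →
      g x Y Y = 1 - verticalPart g u f ν x ^ 2 →
      verticalPart g u f ν x = Real.exp (graphL (formInChart g p) (range I)
        (coords I (fun x => Real.log (u x)) p) (coords I f p) (extChartAt I p x)) ∧
      tangentCoordChange I x p x Y = graphY (formInChart g p) (range I)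
        (coords I (fun x => Real.log (u x)) p) (coords I f p) (extChartAt I p x) := by
    intro Y h1 h2 h3
    refine graph_unique (hg.isInner hp) h1 (fun X => ?_) ?_
    · rw [formInChart_extChartAt g hp, tangentCoordChange_inv hself hp, fderivWithin_coords hp hf,
        coords_extChartAt _ hp, Real.exp_log (hu x)]
      exact h2 _
    · rw [formInChart_extChartAt g hp, tangentCoordChange_inv hself hp]
      exact h3
  exact key _ (hν.spec hu hx).1 (hν.spec hu hx).2.1 (hν.spec hu hx).2.2

theorem graphMetric_inChart (hu : ∀ x, 0 < u x) {p x : M} (hp : x ∈ (extChartAt I p).source)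
    (hf : MDifferentiableAt I 𝓘(ℝ, ℝ) f x) :
    formInChart (graphMetric g u f) p (extChartAt I p x) =
      graphG (formInChart g p) (range I) (coords I (fun x => Real.log (u x)) p) (coords I f p)
        (extChartAt I p x) := by
  refine ContinuousLinearMap.ext fun X => ContinuousLinearMap.ext fun Z => ?_
  rw [formInChart_extChartAt _ hp, graphG_apply, formInChart_extChartAt _ hp,
    fderivWithin_coords hp hf, fderivWithin_coords hp hf, coords_extChartAt _ hp,
    Real.exp_log (hu x)]
  rfl

theorem contDiffWithinAt_log (hu : ∀ x, 0 < u x) (hu2 : ContMDiff I 𝓘(ℝ, ℝ) 2 u) {p x : M}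
    (hp : x ∈ (extChartAt I p).source) :
    ContDiffWithinAt ℝ 2 (coords I (fun x => Real.log (u x)) p) (range I) (extChartAt I p x) := by
  have h1 := contDiffWithinAt_coords (n := 2) isOpen_univ hu2.contMDiffOn hp (mem_univ x)
  exact h1.log (hu _).ne'

theorem isGraphAt_chart (hg : IsRiemannian g) (hu : ∀ x, 0 < u x)
    (hu2 : ContMDiff I 𝓘(ℝ, ℝ) 2 u) (hU : IsOpen U) (hf : ContMDiffOn I 𝓘(ℝ, ℝ) 3 f U)
    {p x : M} (hp : x ∈ (extChartAt I p).source) (hx : x ∈ U) :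
    IsGraphAt (formInChart g p) (range I) (coords I (fun x => Real.log (u x)) p)
      (graphL (formInChart g p) (range I) (coords I (fun x => Real.log (u x)) p) (coords I f p))
      (coords I f p)
      (graphY (formInChart g p) (range I) (coords I (fun x => Real.log (u x)) p) (coords I f p))
      (extChartAt I p x) :=
  (hg.isMetricAt hp).isGraphAt (contDiffWithinAt_log hu hu2 hp)
    (contDiffWithinAt_coords (n := 3) hU hf hp hx)

theorem laplacian_graphMetric (hg : IsRiemannian g) (hu : ∀ x, 0 < u x)
    (hu2 : ContMDiff I 𝓘(ℝ, ℝ) 2 u) (hU : IsOpen U) (hf : ContMDiffOn I 𝓘(ℝ, ℝ) 3 f U)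
    (hν : IsDownwardUnitNormal g u f U ν) {x : M} (hx : x ∈ U) :
    laplacian (graphMetric g u f) (fun y => verticalPart g u f ν y ^ (1 / 2 : ℝ)) x =
      graphLap (formInChart g x) (range I) (coords I (fun x => Real.log (u x)) x)
        (graphY (formInChart g x) (range I) (coords I (fun x => Real.log (u x)) x) (coords I f x))
        (fun z => Real.exp (graphL (formInChart g x) (range I)
          (coords I (fun x => Real.log (u x)) x) (coords I f x) z / 2)) (extChartAt I x x) := by
  have hself := mem_extChartAt_source (I := I) x
  have hS : extChartAt I x x ∈ range I := mem_range_self _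
  have hfd : ∀ x' ∈ U, MDifferentiableAt I 𝓘(ℝ, ℝ) f x' := fun x' hx' =>
    mdifferentiableAt_of_contMDiffOn (by simp) hU hf hx'
  have hnear : ∀ᶠ z in 𝓝[range I] (extChartAt I x x), ∃ x' ∈ (extChartAt I x).source,
      x' ∈ U ∧ extChartAt I x x' = z := by
    filter_upwards [eventually_mem_source hself (hU.mem_nhds hx)] with z hz
    exact ⟨_, (extChartAt I x).map_target hz.1, hz.2, (extChartAt I x).right_inv hz.1⟩
  have e1 : formInChart (graphMetric g u f) x =ᶠ[𝓝[range I] (extChartAt I x x)]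
      graphG (formInChart g x) (range I) (coords I (fun x => Real.log (u x)) x) (coords I f x) := by
    filter_upwards [hnear] with z ⟨x', h1, h2, h3⟩
    rw [← h3, graphMetric_inChart hu h1 (hfd x' h2)]
  have e2 : coords I (fun y => verticalPart g u f ν y ^ (1 / 2 : ℝ)) x
      =ᶠ[𝓝[range I] (extChartAt I x x)] fun z => Real.exp (graphL (formInChart g x) (range I)
          (coords I (fun x => Real.log (u x)) x) (coords I f x) z / 2) := by
    filter_upwards [hnear] with z ⟨x', h1, h2, h3⟩
    rw [← h3, coords_extChartAt _ h1, (eq_graph hg hu hν h1 h2 (hfd x' h2)).1, ← Real.exp_mul]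
    congr 1
    ring
  rw [laplacian_eq, hess_congr hS e1 e2, e1.self_of_nhdsWithin hS]
  exact (isGraphAt_chart hg hu hu2 hU hf hself hx).lap_graphG _

end Graph

end Charts

section Sections

variable {E : Type*} [NormedAddCommGroup E] [NormedSpace ℝ E] [FiniteDimensional ℝ E]
  {H : Type*} [TopologicalSpace H] {I : ModelWithCorners ℝ E H}
  {M : Type*} [TopologicalSpace M] [ChartedSpace H M] [IsManifold I ∞ M]

theorem range_prod_line (I : ModelWithCorners ℝ E H) :
    range (I.prod 𝓘(ℝ, ℝ)) = range I ×ˢ (univ : Set ℝ) := by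
  rw [modelWithCorners_prod_coe, range_prodMap]
  simp

theorem mem_source_prod_line {x x' : M} {t t' : ℝ} (h : x' ∈ (extChartAt I x).source) :
    (x', t') ∈ (extChartAt (I.prod 𝓘(ℝ, ℝ)) (x, t)).source := by
  rw [extChartAt_prod, PartialEquiv.prod_source]
  exact ⟨h, by rw [extChartAt_source]; exact mem_univ _⟩

theorem hasFDerivWithinAt_prod_line {κ : E → E} {K : E →L[ℝ] E} {S : Set E} {y : E} {r : ℝ}
    (h : HasFDerivWithinAt κ K S y) : HasFDerivWithinAt (fun z : E × ℝ => (κ z.1, z.2))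
      ((K ∘L ContinuousLinearMap.fst ℝ E ℝ).prod (ContinuousLinearMap.snd ℝ E ℝ))
      (S ×ˢ (univ : Set ℝ)) (y, r) :=
  (HasFDerivWithinAt.comp (y, r) h hasFDerivWithinAt_fst fun _ hp => hp.1).prodMk
    hasFDerivWithinAt_snd

theorem tangentCoordChange_prod_line {p q x : M} {t s r : ℝ} (hp : x ∈ (extChartAt I p).source)
    (hq : x ∈ (extChartAt I q).source) (X : E) (τ : ℝ) :
    tangentCoordChange (I.prod 𝓘(ℝ, ℝ)) (p, t) (q, s) (x, r) (X, τ) =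
      (tangentCoordChange I p q x X, τ) := by
  have h1 := hasFDerivWithinAt_tangentCoordChange (I := I.prod 𝓘(ℝ, ℝ)) (x := (p, t)) (y := (q, s))
    (z := (x, r)) ⟨mem_source_prod_line hp, mem_source_prod_line hq⟩
  have h2 := hasFDerivWithinAt_prod_line (r := r)
    (hasFDerivWithinAt_tangentCoordChange (I := I) ⟨hp, hq⟩)
  rw [← range_prod_line] at h2
  exact DFunLike.congr_fun (((isDomain_range (I.prod 𝓘(ℝ, ℝ))).unique _ (mem_range_self _)).eq h1 h2)
    (X, τ)

theorem formInChart_warped {g : FormField I M} {u : M → ℝ} (hu : ∀ x, 0 < u x) (x : M) (t : ℝ) :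
    formInChart (warpedMetric g u) (x, t) =ᶠ[𝓝[range I ×ˢ (univ : Set ℝ)] (extChartAt I x x, t)]
      warpedG (formInChart g x) (coords I (fun x => Real.log (u x)) x) := by
  have hself := mem_extChartAt_source (I := I) x
  filter_upwards [tendsto_fst_prod_univ.eventually (eventually_mem_source hself univ_mem)] with p hp
  obtain ⟨z, r⟩ := p
  obtain ⟨x', hx', rfl⟩ : ∃ x' ∈ (extChartAt I x).source, extChartAt I x x' = z :=
    ⟨_, (extChartAt I x).map_target hp.1, (extChartAt I x).right_inv hp.1⟩
  refine ContinuousLinearMap.ext fun X => ContinuousLinearMap.ext fun Z => ?_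
  have h1 := formInChart_extChartAt (warpedMetric g u) (mem_source_prod_line (t := t) (t' := r) hx') X Z
  have h2 : ∀ X : E × ℝ, tangentCoordChange (I.prod 𝓘(ℝ, ℝ)) (x, t) (x', r) (x', r) X
      = (tangentCoordChange I x x' x' X.1, X.2) := fun X =>
    tangentCoordChange_prod_line hx' (mem_extChartAt_source x') X.1 X.2
  rw [h2, h2] at h1
  refine h1.trans ?_
  rw [warpedG_apply, formInChart_extChartAt g hx', coords_extChartAt _ hx', Real.exp_log (hu x')]
  rfl

theorem christoffel_warped {g : FormField I M} {u : M → ℝ} (hg : IsRiemannian g) (hu : ∀ x, 0 < u x)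
    (hu2 : ContMDiff I 𝓘(ℝ, ℝ) 2 u) (x : M) (t : ℝ) (X Z : E × ℝ) :
    (show E × ℝ →L[ℝ] E × ℝ →L[ℝ] E × ℝ from christoffel (warpedMetric g u) (x, t)) X Z =
      (chr (formInChart g x) (range I) (extChartAt I x x) X.1 Z.1 - (u x ^ 2 * (X.2 * Z.2)) •
        grad (formInChart g x) (range I) (coords I (fun x => Real.log (u x)) x) (extChartAt I x x),
        X.2 * fderivWithin ℝ (coords I (fun x => Real.log (u x)) x) (range I) (extChartAt I x x) Z.1
        + Z.2 * fderivWithin ℝ (coords I (fun x => Real.log (u x)) x) (range I) (extChartAt I x x) X.1) := by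
  have hself := mem_extChartAt_source (I := I) x
  have h1 : christoffel (warpedMetric g u) (x, t) =
      chr (formInChart (warpedMetric g u) (x, t)) (range I ×ˢ (univ : Set ℝ))
        (extChartAt I x x, t) := by
    rw [← range_prod_line]
    rfl
  have h2 := chr_congr (S := range I ×ˢ (univ : Set ℝ)) (y := (extChartAt I x x, t))
    ⟨mem_range_self _, mem_univ _⟩ (formInChart_warped (g := g) hu x t)
  have h3 := (hg.isMetricAt hself).chr_warped (t := t) (contDiffWithinAt_log hu hu2 hself) X Z
  rw [coords_extChartAt _ hself, Real.exp_log (hu x)] at h3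
  rw [← h3, ← h2, h1]

theorem eventually_extChartAt {x : M} {P : E → Prop}
    (h : ∀ᶠ z in 𝓝[range I] (extChartAt I x x), P z) : ∀ᶠ x' in 𝓝 x, P (extChartAt I x x') := by
  have h1 : Tendsto (extChartAt I x) (𝓝 x) (𝓝[range I] (extChartAt I x x)) :=
    tendsto_nhdsWithin_iff.2 ⟨continuousAt_extChartAt x, Eventually.of_forall fun _ => mem_range_self _⟩
  exact h1.eventually h

/-- Differentiability of a map to a tangent bundle, in terms of its coordinate expression. -/
theorem hasMFDerivAt_tangentBundle {E' : Type*} [NormedAddCommGroup E'] [NormedSpace ℝ E']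
    {H' : Type*} [TopologicalSpace H'] {J : ModelWithCorners ℝ E' H'} {N : Type*}
    [TopologicalSpace N] [ChartedSpace H' N] [IsManifold J 1 N] {σ : M → TangentBundle J N} {x : M}
    {Φ : E → E' × E'} {D : E →L[ℝ] E' × E'} (hσ : ContinuousAt (fun x' => (σ x').proj) x)
    (hΦ : ∀ᶠ z in 𝓝[range I] (extChartAt I x x),
      extChartAt J.tangent (σ x) (σ ((extChartAt I x).symm z)) = Φ z)
    (hD : HasFDerivWithinAt Φ D (range I) (extChartAt I x x)) :
    HasMFDerivAt I J.tangent σ x D := by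
  have hS : extChartAt I x x ∈ range I := mem_range_self _
  refine ⟨?_, hD.congr_of_eventuallyEq hΦ (hΦ.self_of_nhdsWithin hS)⟩
  rw [FiberBundle.continuousAt_totalSpace E']
  refine ⟨hσ, ?_⟩
  have h1 : Tendsto (extChartAt I x) (𝓝 x) (𝓝[range I] (extChartAt I x x)) :=
    tendsto_nhdsWithin_iff.2 ⟨continuousAt_extChartAt x, Eventually.of_forall fun _ => mem_range_self _⟩
  have h2 : ContinuousAt (fun x' => (Φ (extChartAt I x x')).2) x :=
    (continuous_snd.tendsto _).comp (hD.continuousWithinAt.tendsto.comp h1)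
  refine h2.congr ?_
  filter_upwards [eventually_extChartAt hΦ, extChartAt_source_mem_nhds (I := I) x] with x' h3 h4
  rw [(extChartAt I x).left_inv h4] at h3
  rw [← h3]
  rfl

section Graph

variable {g : FormField I M} {u f : M → ℝ} {U : Set M}
  {ν : ∀ x : M, TangentSpace (I.prod 𝓘(ℝ, ℝ)) (graphMap f x)}

theorem eventually_chart (hU : IsOpen U) {x : M} (hx : x ∈ U) :
    ∀ᶠ z in 𝓝[range I] (extChartAt I x x), ∃ x' ∈ (extChartAt I x).source,
      x' ∈ U ∧ extChartAt I x x' = z := by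
  filter_upwards [eventually_mem_source (mem_extChartAt_source (I := I) x) (hU.mem_nhds hx)] with z hz
  exact ⟨_, (extChartAt I x).map_target hz.1, hz.2, (extChartAt I x).right_inv hz.1⟩

theorem hasMFDerivAt_graphMap (hU : IsOpen U) (hf : ContMDiffOn I 𝓘(ℝ, ℝ) 3 f U) {x : M} (hx : x ∈ U) :
    HasMFDerivAt I (I.prod 𝓘(ℝ, ℝ)) (graphMap f) x
      (show E →L[ℝ] E × ℝ from (ContinuousLinearMap.id ℝ E).prod
        (fderivWithin ℝ (coords I f x) (range I) (extChartAt I x x))) := by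
  have hfx := mdifferentiableAt_of_contMDiffOn (by simp) hU hf hx
  have h1 := (hasMFDerivAt_id (I := I) x).prodMk hfx.hasMFDerivAt
  have h2 : mfderiv I 𝓘(ℝ, ℝ) f x = fderivWithin ℝ (coords I f x) (range I) (extChartAt I x x) :=
    diff_eq hfx
  rw [h2] at h1
  exact h1

/-- The vertical component of the downward unit normal, in coordinates. -/
def graphT (G : E → E →L[ℝ] E →L[ℝ] ℝ) (S : Set E) (l f : E → ℝ) (y : E) : ℝ :=
  -Real.exp (graphL G S l f y - l y)

theorem normal_snd (hg : IsRiemannian g) (hu : ∀ x, 0 < u x) (hν : IsDownwardUnitNormal g u f U ν)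
    {p x : M} (hp : x ∈ (extChartAt I p).source) (hx : x ∈ U)
    (hf : MDifferentiableAt I 𝓘(ℝ, ℝ) f x) :
    (show E × ℝ from ν x).2 = graphT (formInChart g p) (range I)
      (coords I (fun x => Real.log (u x)) p) (coords I f p) (extChartAt I p x) := by
  have h1 := (eq_graph hg hu hν hp hx hf).1
  rw [verticalPart_eq hu] at h1
  have := (hu x).ne'
  rw [graphT, Real.exp_sub, ← h1, coords_extChartAt _ hp, Real.exp_log (hu x)]
  field_simp

theorem hasMFDerivAt_normal (hg : IsRiemannian g) (hu : ∀ x, 0 < u x)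
    (hu2 : ContMDiff I 𝓘(ℝ, ℝ) 2 u) (hU : IsOpen U) (hf : ContMDiffOn I 𝓘(ℝ, ℝ) 3 f U)
    (hν : IsDownwardUnitNormal g u f U ν) {x : M} (hx : x ∈ U) {G : E → E →L[ℝ] E →L[ℝ] ℝ}
    (hG : G = formInChart g x) {l f' : E → ℝ} (hl : l = coords I (fun x => Real.log (u x)) x)
    (hf' : f' = coords I f x) {y : E} (hy : y = extChartAt I x x) :
    HasMFDerivAt I (I.prod 𝓘(ℝ, ℝ)).tangent
      (fun x' => (⟨graphMap f x', ν x'⟩ : TangentBundle (I.prod 𝓘(ℝ, ℝ)) (M × ℝ))) x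
      (show E →L[ℝ] (E × ℝ) × (E × ℝ) from
        ((ContinuousLinearMap.id ℝ E).prod (fderivWithin ℝ f' (range I) y)).prod
        ((fderivWithin ℝ (graphY G (range I) l f') (range I) y).prod
          (fderivWithin ℝ (graphT G (range I) l f') (range I) y))) := by
  subst hG hl hf' hy
  have hself := mem_extChartAt_source (I := I) x
  have hgr := isGraphAt_chart hg hu hu2 hU hf hself hx
  have hcont : ContinuousAt (graphMap f) x := (hasMFDerivAt_graphMap hU hf hx).continuousAt
  refine hasMFDerivAt_tangentBundle (Φ := fun z => ((z, coords I f x z),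
    (graphY (formInChart g x) (range I) (coords I (fun x => Real.log (u x)) x) (coords I f x) z,
    graphT (formInChart g x) (range I) (coords I (fun x => Real.log (u x)) x) (coords I f x) z)))
    hcont ?_ ?_
  · filter_upwards [eventually_chart (I := I) hU hx] with z ⟨x', h1, h2, h3⟩
    subst h3
    rw [(extChartAt I x).left_inv h1]
    have hfx := mdifferentiableAt_of_contMDiffOn (by simp) hU hf h2
    have h4 := (eq_graph hg hu hν h1 h2 hfx).2
    have h5 := normal_snd hg hu hν h1 h2 hfx
    have h6 := tangentCoordChange_prod_line (t := f x') (s := f x) (r := f x')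
      (mem_extChartAt_source (I := I) x') h1 (horizontal ν x') (show E × ℝ from ν x').2
    rw [← h4, ← h5, coords_extChartAt f h1]
    exact congrArg (fun V => ((extChartAt I x x', f x'), V)) h6
  · have hT : ContDiffWithinAt ℝ 2 (graphT (formInChart g x) (range I)
        (coords I (fun x => Real.log (u x)) x) (coords I f x)) (range I) (extChartAt I x x) :=
      (hgr.contDiff_L.sub hgr.contDiff_l).exp.neg
    exact ((hasFDerivWithinAt_id _ _).prodMk (IsDomain.hasFDerivWithinAt hgr.contDiff_f (by simp))).prodMk
      ((IsDomain.hasFDerivWithinAt hgr.contDiff_Y (by simp)).prodMk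
        (IsDomain.hasFDerivWithinAt hT (by simp)))

end Graph
end Sections

section Curvature

variable {E : Type*} [NormedAddCommGroup E] [NormedSpace ℝ E] [FiniteDimensional ℝ E]

theorem fderivWithin_graphT {G : E → E →L[ℝ] E →L[ℝ] ℝ} {S : Set E} {l f : E → ℝ} {y : E}
    (h : IsGraphAt G S l (graphL G S l f) f (graphY G S l f) y) (X : E) :
    fderivWithin ℝ (graphT G S l f) S y X = graphT G S l f y *
      (fderivWithin ℝ (graphL G S l f) S y X - fderivWithin ℝ l S y X) := by
  have h1 := ((IsDomain.hasFDerivWithinAt h.contDiff_L (by simp)).sub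
    (IsDomain.hasFDerivWithinAt h.contDiff_l (by simp))).exp.neg
  have h2 := h1.fderivWithin (h.metric.dom.unique y h.metric.mem)
  change fderivWithin ℝ (graphT G S l f) S y = _ at h2
  rw [h2]
  change -(Real.exp (graphL G S l f y - l y) * (fderivWithin ℝ (graphL G S l f) S y X
    - fderivWithin ℝ l S y X)) = _
  rw [graphT]
  ring

/-- The differential of the graph function on the image of the shape operator. -/
theorem IsGraphAt.fderiv_shape {G : E → E →L[ℝ] E →L[ℝ] ℝ} {S : Set E} {l L f : E → ℝ} {Y : E → E}
    {y : E} (h : IsGraphAt G S l L f Y y) (X : E) :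
    fderivWithin ℝ f S y (graphShape G S l Y y X) = - Real.exp (L y - l y) * fderivWithin ℝ L S y X
      + fderivWithin ℝ f S y X * fderivWithin ℝ l S y (Y y) := by
  have hm := h.metric.self
  have h1 := h.dual_apply (graphShape G S l Y y X)
  have h2 : G y (Y y) (graphShape G S l Y y X) = - Real.exp (L y) ^ 2 * fderivWithin ℝ L S y X
      + G y (Y y) X * fderivWithin ℝ l S y (Y y) := by
    rw [← h.apply_covd_self, hm.symm (covd G S Y y X), graphShape]
    simp only [map_add, map_smul, _root_.add_apply, ContinuousLinearMap.smulRight_apply, smul_eq_mul]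
    rw [hm.symm (Y y) (grad G S l y), grad, hm.apply_inverse]
  rw [h2, h.dual_apply] at h1
  have e1 := (Real.exp_pos (L y)).ne'
  have e2 := (Real.exp_pos (l y)).ne'
  rw [Real.exp_sub]
  field_simp
  have e3 := mul_left_cancel₀ e1 (a := Real.exp (L y)) (b := - Real.exp (L y) * fderivWithin ℝ L S y X
      + Real.exp (l y) * fderivWithin ℝ f S y X * fderivWithin ℝ l S y (Y y))
      (c := Real.exp (l y) * fderivWithin ℝ f S y (graphShape G S l Y y X)) (by linear_combination h1)
  linear_combination -e3

variable {H : Type*} [TopologicalSpace H] {I : ModelWithCorners ℝ E H}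
  {M : Type*} [TopologicalSpace M] [ChartedSpace H M] [IsManifold I ∞ M]
  {g : FormField I M} {u f : M → ℝ} {U : Set M}
  {ν : ∀ x : M, TangentSpace (I.prod 𝓘(ℝ, ℝ)) (graphMap f x)}

theorem normal_eq (hg : IsRiemannian g) (hu : ∀ x, 0 < u x) (hν : IsDownwardUnitNormal g u f U ν)
    {x : M} (hx : x ∈ U) (hf : MDifferentiableAt I 𝓘(ℝ, ℝ) f x) :
    (show E × ℝ from ν x) = (graphY (formInChart g x) (range I)
      (coords I (fun x => Real.log (u x)) x) (coords I f x) (extChartAt I x x),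
      graphT (formInChart g x) (range I)
      (coords I (fun x => Real.log (u x)) x) (coords I f x) (extChartAt I x x)) := by
  have hself := mem_extChartAt_source (I := I) x
  have h1 := (eq_graph hg hu hν hself hx hf).2
  have h2 := normal_snd hg hu hν hself hx hf
  refine Prod.ext ?_ h2
  rw [← h1]
  exact (tangentCoordChange_self hself).symm

theorem covDerivAlong_eq (hg : IsRiemannian g) (hu : ∀ x, 0 < u x)
    (hu2 : ContMDiff I 𝓘(ℝ, ℝ) 2 u) (hU : IsOpen U) (hf : ContMDiffOn I 𝓘(ℝ, ℝ) 3 f U)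
    (hν : IsDownwardUnitNormal g u f U ν) {x : M} (hx : x ∈ U) {G : E → E →L[ℝ] E →L[ℝ] ℝ}
    (hG : G = formInChart g x) {l f' : E → ℝ} (hl : l = coords I (fun x => Real.log (u x)) x)
    (hf' : f' = coords I f x) {y : E} (hy : y = extChartAt I x x) (X : E) :
    (show E × ℝ from covDerivAlong (I := I) (warpedMetric g u) (graphMap f) ν x X) =
      (graphShape G (range I) l (graphY G (range I) l f') y X,
        fderivWithin ℝ f' (range I) y (graphShape G (range I) l (graphY G (range I) l f') y X)) := by
  have h0 := (hasMFDerivAt_normal hg hu hu2 hU hf hν hx hG hl hf' hy).mfderiv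
  have hself := mem_extChartAt_source (I := I) x
  have hgr := isGraphAt_chart hg hu hu2 hU hf hself hx
  have hN := normal_eq hg hu hν hx (mdifferentiableAt_of_contMDiffOn (by simp) hU hf hx)
  have hΓ := christoffel_warped hg hu hu2 x (f x)
    (X, fderivWithin ℝ f' (range I) y X) (show E × ℝ from ν x)
  have hlu : l y = Real.log (u x) := by rw [hl, hy, coords_extChartAt _ hself]
  have h1 : (show E × ℝ from covDerivAlong (I := I) (warpedMetric g u) (graphMap f) ν x X) =
      (fderivWithin ℝ (graphY G (range I) l f') (range I) y X,
        fderivWithin ℝ (graphT G (range I) l f') (range I) y X) +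
      (show E × ℝ →L[ℝ] E × ℝ →L[ℝ] E × ℝ from christoffel (warpedMetric g u) (x, f x))
        (X, fderivWithin ℝ f' (range I) y X) (show E × ℝ from ν x) := by
    rw [covDerivAlong, h0]
    rfl
  rw [h1, hΓ, hN]
  subst hG hl hf' hy
  have hu' := Real.exp_log (hu x)
  set G := formInChart g x
  set l := coords I (fun x => Real.log (u x)) x
  set f' := coords I f x
  set y := extChartAt I x x
  rw [← hlu] at hu'
  rw [hgr.fderiv_shape, fderivWithin_graphT hgr, ← hu', graphT]
  refine Prod.ext ?_ ?_
  · change fderivWithin ℝ (graphY G (range I) l f') (range I) y X +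
      (chr G (range I) y X (graphY G (range I) l f' y) - (Real.exp (l y) ^ 2 *
        (fderivWithin ℝ f' (range I) y X * -Real.exp (graphL G (range I) l f' y - l y))) •
        grad G (range I) l y) = covd G (range I) (graphY G (range I) l f') y X
          + G y (graphY G (range I) l f' y) X • grad G (range I) l y
    have h2 : Real.exp (l y) ^ 2 *
        (fderivWithin ℝ f' (range I) y X * -Real.exp (graphL G (range I) l f' y - l y)) =
        - G y (graphY G (range I) l f' y) X := by
      rw [hgr.dual_apply, Real.exp_sub]
      have := (Real.exp_pos (l y)).ne'
      field_simp
    rw [h2, covd_apply, neg_smul]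
    abel
  · change -Real.exp (graphL G (range I) l f' y - l y) * (_ - _) + (_ * _
      + -Real.exp (graphL G (range I) l f' y - l y) * _) = _
    ring

theorem meanCurvature_eq (hg : IsRiemannian g) (hu : ∀ x, 0 < u x)
    (hu2 : ContMDiff I 𝓘(ℝ, ℝ) 2 u) (hU : IsOpen U) (hf : ContMDiffOn I 𝓘(ℝ, ℝ) 3 f U)
    (hν : IsDownwardUnitNormal g u f U ν) {x : M} (hx : x ∈ U) :
    meanCurvature I (warpedMetric g u) (graphMap f) ν x =
      graphH (formInChart g x) (range I) (coords I (fun x => Real.log (u x)) x)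
        (graphY (formInChart g x) (range I) (coords I (fun x => Real.log (u x)) x) (coords I f x))
        (extChartAt I x x) := by
  have hself := mem_extChartAt_source (I := I) x
  have hgr := isGraphAt_chart hg hu hu2 hU hf hself hx
  have hlu := coords_extChartAt (I := I) (fun x => Real.log (u x)) hself
  have hcov := fun X => covDerivAlong_eq hg hu hu2 hU hf hν hx rfl rfl rfl rfl X
  have hφ := (hasMFDerivAt_graphMap hU hf hx).mfderiv
  have hG : formInChart g x (extChartAt I x x) = g x := formInChart_self g x
  have hu' := Real.exp_log (hu x)
  rw [← hlu] at hu'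
  set G := formInChart g x
  set l := coords I (fun x => Real.log (u x)) x
  set f' := coords I f x
  set y := extChartAt I x x
  have e0 : ∀ (V : E × ℝ) (Z : E),
      (show E × ℝ →L[ℝ] E × ℝ →L[ℝ] ℝ from warpedMetric g u (graphMap f x)) V
        (Z, fderivWithin ℝ f' (range I) y Z)
        = G y V.1 Z + Real.exp (l y) ^ 2 * (V.2 * fderivWithin ℝ f' (range I) y Z) := by
    intro V Z
    rw [hG, hu']
    rfl
  have e1 : (pullForm (warpedMetric g u (graphMap f x)) (mfderiv I (I.prod 𝓘(ℝ, ℝ)) (graphMap f) x)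
      (mfderiv I (I.prod 𝓘(ℝ, ℝ)) (graphMap f) x) : TangentSpace I x →L[ℝ] TangentSpace I x →L[ℝ] ℝ)
      = graphG G (range I) l f' y := by
    rw [hφ]
    refine ContinuousLinearMap.ext fun X => ContinuousLinearMap.ext fun Z => ?_
    exact e0 (X, fderivWithin ℝ f' (range I) y X) Z
  have e2 : secondFundForm (I := I) (warpedMetric g u) (graphMap f) ν x
      = graphG G (range I) l f' y ∘L graphShape G (range I) l (graphY G (range I) l f') y := by
    rw [secondFundForm, hφ]
    refine ContinuousLinearMap.ext fun X => ContinuousLinearMap.ext fun Z => ?_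
    refine (e0 (show E × ℝ from covDerivAlong (I := I) (warpedMetric g u) (graphMap f) ν x X) Z).trans ?_
    rw [hcov X]
    rfl
  rw [meanCurvature, e1, e2]
  refine (hgr.metric_graph.self.metricTrace_comp _).trans ?_
  rw [graphShape, map_add, traceL_smulRight, graphH, hgr.metric.self.symm, grad,
    hgr.metric.self.apply_inverse]

/-- The mean curvature near a point, in the preferred chart at that point. -/
theorem meanCurvature_eventually (hg : IsRiemannian g) (hu : ∀ x, 0 < u x)
    (hu2 : ContMDiff I 𝓘(ℝ, ℝ) 2 u) (hU : IsOpen U) (hf : ContMDiffOn I 𝓘(ℝ, ℝ) 3 f U)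
    (hν : IsDownwardUnitNormal g u f U ν) {x x' : M} (hx' : x' ∈ U)
    (hxx : x' ∈ (extChartAt I x).source) :
    meanCurvature I (warpedMetric g u) (graphMap f) ν x' =
      graphH (formInChart g x) (range I) (coords I (fun x => Real.log (u x)) x)
        (graphY (formInChart g x) (range I) (coords I (fun x => Real.log (u x)) x) (coords I f x))
        (extChartAt I x x') := by
  have hself := mem_extChartAt_source (I := I) x'
  rw [meanCurvature_eq hg hu hu2 hU hf hν hx']
  have h1 := hg.isTransition hxx hself
  have h2 := h1.graphH_eq (l₁ := coords I (fun x => Real.log (u x)) x)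
    (l₂ := coords I (fun x => Real.log (u x)) x') (f₁ := coords I f x) (f₂ := coords I f x')
    (coords_eventually_transition _ hxx hself)
    (by rw [transition_apply hxx]; exact contDiffWithinAt_log hu hu2 hself)
    (contDiffWithinAt_log hu hu2 hxx) (contDiffWithinAt_coords (n := 3) hU hf hxx hx')
    (coords_eventually_transition _ hxx hself)
    (by rw [transition_apply hxx]; exact contDiffWithinAt_coords (n := 3) hU hf hself hx')
  rwa [transition_apply hxx] at h2

end Curvature

section Prescribed

variable {E : Type*} [NormedAddCommGroup E] [NormedSpace ℝ E] [FiniteDimensional ℝ E]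

theorem IsGraphAt.accel_eq {G : E → E →L[ℝ] E →L[ℝ] ℝ} {S : Set E} {l L f : E → ℝ} {Y : E → E}
    {y : E} (h : IsGraphAt G S l L f Y y) :
    covd G S Y y (Y y) = (Real.exp (L y) ^ 2) • grad G S l y - grad G S (fun z => l z + L z) y
      + fderivWithin ℝ (fun z => l z + L z) S y (Y y) • Y y := by
  have hm := h.metric
  refine hm.self.ext fun X => ?_
  rw [h.apply_accel]
  simp only [map_add, map_sub, map_smul, grad, hm.self.apply_inverse]

variable {H : Type*} [TopologicalSpace H] {I : ModelWithCorners ℝ E H}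
  {M : Type*} [TopologicalSpace M] [ChartedSpace H M] [IsManifold I ∞ M]
  {g : FormField I M} {u f : M → ℝ} {U : Set M}
  {ν : ∀ x : M, TangentSpace (I.prod 𝓘(ℝ, ℝ)) (graphMap f x)}

/-- The velocity of a vertical translation of tangent vectors to `M × ℝ`. -/
theorem hasMFDerivAt_tangentVec (x : M) (t : ℝ) (V : E × ℝ) :
    HasMFDerivAt 𝓘(ℝ, ℝ) (I.prod 𝓘(ℝ, ℝ)).tangent
      (fun s : ℝ => (⟨(x, s), V⟩ : TangentBundle (I.prod 𝓘(ℝ, ℝ)) (M × ℝ))) t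
      (show ℝ →L[ℝ] (E × ℝ) × (E × ℝ) from
        ContinuousLinearMap.toSpanSingleton ℝ ((0, 1), (0, 0))) := by
  refine hasMFDerivAt_tangentBundle (Φ := fun s => ((extChartAt I x x, s), V)) ?_ ?_ ?_
  · exact (Continuous.prodMk_right x).continuousAt
  · refine Eventually.of_forall fun s => ?_
    have h1 := tangentCoordChange_prod_line (p := x) (q := x) (t := s) (s := t) (r := s)
      (mem_extChartAt_source (I := I) x) (mem_extChartAt_source (I := I) x) V.1 V.2
    rw [tangentCoordChange_self (mem_extChartAt_source (I := I) x)] at h1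
    exact congrArg (fun W => ((extChartAt I x x, s), W)) h1
  · have h1 : HasDerivAt (fun s : ℝ => ((extChartAt I x x, s), V)) ((0, 1), (0, 0)) t :=
      ((hasDerivAt_const t (extChartAt I x x)).prodMk (hasDerivAt_id t)).prodMk (hasDerivAt_const t V)
    exact h1.hasFDerivAt.hasFDerivWithinAt

theorem diff_vertical_nonneg {F : TangentBundle (I.prod 𝓘(ℝ, ℝ)) (M × ℝ) → ℝ}
    (hF : ContMDiff (I.prod 𝓘(ℝ, ℝ)).tangent 𝓘(ℝ, ℝ) 1 F) {x : M} {t : ℝ} {V : E × ℝ}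
    (hmono : Monotone fun s : ℝ => F ⟨(x, s), V⟩) :
    0 ≤ (show (E × ℝ) × (E × ℝ) →L[ℝ] ℝ from
      diff (I := (I.prod 𝓘(ℝ, ℝ)).tangent) F ⟨(x, t), V⟩) ((0, 1), (0, 0)) := by
  have h1 := ((hF _).mdifferentiableAt (by simp)).hasMFDerivAt.comp t
    (hasMFDerivAt_tangentVec (I := I) x t V)
  have h2 : HasFDerivAt (fun s : ℝ => F ⟨(x, s), V⟩) ((show (E × ℝ) × (E × ℝ) →L[ℝ] ℝ from
      diff (I := (I.prod 𝓘(ℝ, ℝ)).tangent) F ⟨(x, t), V⟩) ∘L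
      ContinuousLinearMap.toSpanSingleton ℝ ((0, 1), (0, 0))) t := h1.hasFDerivAt
  refine (h2.hasDerivAt.nonneg_of_monotone hmono).trans_eq ?_
  rw [ContinuousLinearMap.comp_apply, ContinuousLinearMap.toSpanSingleton_apply, one_smul]

theorem warpedMetric_normal (hg : IsRiemannian g) (hu : ∀ x, 0 < u x)
    (hu2 : ContMDiff I 𝓘(ℝ, ℝ) 2 u) (hU : IsOpen U) (hf : ContMDiffOn I 𝓘(ℝ, ℝ) 3 f U)
    (hν : IsDownwardUnitNormal g u f U ν) {x : M} (hx : x ∈ U) {G : E → E →L[ℝ] E →L[ℝ] ℝ}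
    (hG : G = formInChart g x) {l f' ψ : E → ℝ} (hl : l = coords I (fun x => Real.log (u x)) x)
    (hf' : f' = coords I f x) {y : E} (hy : y = extChartAt I x x)
    (hψ : ψ = fun z => l z + graphL G (range I) l f' z) {Y : E → E} (hY : Y = graphY G (range I) l f') :
    sasakiSq (warpedMetric g u) (⟨graphMap f x, ν x⟩ : TangentBundle (I.prod 𝓘(ℝ, ℝ)) (M × ℝ))
      (show (E × ℝ) × (E × ℝ) from ((Y y, graphT G (range I) l f' y),
        (fderivWithin ℝ Y (range I) y (Y y), fderivWithin ℝ (graphT G (range I) l f') (range I) y (Y y))))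
      = 1 + (fderivWithin ℝ ψ (range I) y (grad G (range I) ψ y)
        - fderivWithin ℝ ψ (range I) y (Y y) ^ 2) := by
  have hself := mem_extChartAt_source (I := I) x
  have hgr := isGraphAt_chart hg hu hu2 hU hf hself hx
  have hN := normal_eq hg hu hν hx (mdifferentiableAt_of_contMDiffOn (by simp) hU hf hx)
  have hlu := coords_extChartAt (I := I) (fun x => Real.log (u x)) hself
  have hu' := Real.exp_log (hu x)
  rw [← hlu] at hu'
  have hGx : formInChart g x (extChartAt I x x) = g x := formInChart_self g x
  have hΓ := christoffel_warped hg hu hu2 x (f x)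
    (Y y, graphT G (range I) l f' y) (show E × ℝ from ν x)
  rw [hN] at hΓ
  rw [← hG, ← hl, ← hf', ← hy] at hgr hN hΓ
  rw [← hY] at hgr hN hΓ
  rw [← hl, ← hy] at hu'
  rw [← hG, ← hy] at hGx
  set L := graphL G (range I) l f'
  set T := graphT G (range I) l f' with hT
  have hTy : T y = -Real.exp (L y - l y) := rfl
  have hm := hgr.metric.self
  have hwm : ∀ V : E × ℝ, (show E × ℝ →L[ℝ] E × ℝ →L[ℝ] ℝ from
      warpedMetric g u (graphMap f x)) V V = G y V.1 V.1 + Real.exp (l y) ^ 2 * (V.2 * V.2) := by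
    intro V
    rw [hGx, hu']
    rfl
  have hconn : (show E × ℝ from connectionMap (warpedMetric g u)
      (⟨graphMap f x, ν x⟩ : TangentBundle (I.prod 𝓘(ℝ, ℝ)) (M × ℝ))
      (show (E × ℝ) × (E × ℝ) from ((Y y, T y),
        (fderivWithin ℝ Y (range I) y (Y y), fderivWithin ℝ T (range I) y (Y y))))) =
      (fderivWithin ℝ ψ (range I) y (Y y) • Y y - grad G (range I) ψ y,
        T y * fderivWithin ℝ ψ (range I) y (Y y)) := by
    have h1 : (show E × ℝ from connectionMap (warpedMetric g u)
      (⟨graphMap f x, ν x⟩ : TangentBundle (I.prod 𝓘(ℝ, ℝ)) (M × ℝ))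
      (show (E × ℝ) × (E × ℝ) from ((Y y, T y),
        (fderivWithin ℝ Y (range I) y (Y y), fderivWithin ℝ T (range I) y (Y y))))) =
      (fderivWithin ℝ Y (range I) y (Y y), fderivWithin ℝ T (range I) y (Y y)) +
      (show E × ℝ →L[ℝ] E × ℝ →L[ℝ] E × ℝ from christoffel (warpedMetric g u) (x, f x))
        (Y y, T y) (show E × ℝ from ν x) := rfl
    have h2 := hgr.accel_eq
    rw [← hψ, covd_apply] at h2
    have h3 : fderivWithin ℝ T (range I) y (Y y) = T y *
      (fderivWithin ℝ L (range I) y (Y y) - fderivWithin ℝ l (range I) y (Y y)) := by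
      subst hY
      exact fderivWithin_graphT hgr _
    have h4 : fderivWithin ℝ ψ (range I) y (Y y) =
        fderivWithin ℝ l (range I) y (Y y) + fderivWithin ℝ L (range I) y (Y y) := by
      rw [hψ, hgr.metric.dom.fderivWithin_add hgr.contDiff_l hgr.contDiff_L hgr.metric.mem]
      rfl
    have h5 : Real.exp (l y) ^ 2 * (T y * T y) = Real.exp (L y) ^ 2 := by
      rw [hTy, Real.exp_sub]
      have := (Real.exp_pos (l y)).ne'
      field_simp
    rw [h1, hN, hΓ, ← hu', h3]
    refine Prod.ext ?_ ?_
    · change fderivWithin ℝ Y (range I) y (Y y) + (chr G (range I) y (Y y) (Y y)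
        - (Real.exp (l y) ^ 2 * (T y * T y)) • grad G (range I) l y) = _
      rw [h5, ← add_sub_assoc, h2]
      abel_nf
    · change T y * _ + (T y * _ + T y * _) = T y * _
      rw [h4]
      ring
  have hTl : Real.exp (l y) ^ 2 * (T y * T y) = Real.exp (L y) ^ 2 := by
    rw [hTy, Real.exp_sub]
    have := (Real.exp_pos (l y)).ne'
    field_simp
  refine (congrArg₂ (· + ·) (hwm (Y y, T y)) ((congrArg (fun V : E × ℝ =>
    (show E × ℝ →L[ℝ] E × ℝ →L[ℝ] ℝ from warpedMetric g u (graphMap f x)) V V) hconn).trans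
    (hwm _))).trans ?_
  have e1 := hgr.norm_apply
  have e2 : G y (grad G (range I) ψ y) = fderivWithin ℝ ψ (range I) y := hm.apply_inverse _
  have e3 : G y (Y y) (grad G (range I) ψ y) = fderivWithin ℝ ψ (range I) y (Y y) := by
    rw [hm.symm, e2]
  simp only [map_sub, map_smul, _root_.sub_apply, _root_.smul_apply, smul_eq_mul, e1, e2, e3]
  linear_combination (1 + fderivWithin ℝ ψ (range I) y (Y y) ^ 2) * hTl

theorem sqrt_one_add_le (t : ℝ) : √(1 + t) ≤ 1 + √t := by
  rw [Real.sqrt_le_left (by positivity)]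
  rcases le_or_gt 0 t with h | h
  · nlinarith [Real.sq_sqrt h, Real.sqrt_nonneg t]
  · nlinarith [Real.sqrt_nonneg t]

theorem prescribed_bounds (hg : IsRiemannian g) (hu : ∀ x, 0 < u x)
    (hu2 : ContMDiff I 𝓘(ℝ, ℝ) 2 u) (hU : IsOpen U) (hf : ContMDiffOn I 𝓘(ℝ, ℝ) 3 f U)
    (hν : IsDownwardUnitNormal g u f U ν) {F : TangentBundle (I.prod 𝓘(ℝ, ℝ)) (M × ℝ) → ℝ}
    (hF : ContMDiff (I.prod 𝓘(ℝ, ℝ)).tangent 𝓘(ℝ, ℝ) 1 F) {C₀ : ℝ}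
    (hFC : C1NormLE (warpedMetric g u) F C₀)
    (hmono : ∀ (x : M) (X : TangentSpace I x) (s : ℝ),
      Monotone fun t : ℝ => F ⟨(x, t), tangentVec (x, t) X s⟩)
    (hH : ∀ x ∈ U, meanCurvature I (warpedMetric g u) (graphMap f) ν x = F ⟨graphMap f x, ν x⟩)
    {x : M} (hx : x ∈ U) {G : E → E →L[ℝ] E →L[ℝ] ℝ}
    (hG : G = formInChart g x) {l f' ψ : E → ℝ} (hl : l = coords I (fun x => Real.log (u x)) x)
    (hf' : f' = coords I f x) {y : E} (hy : y = extChartAt I x x)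
    (hψ : ψ = fun z => l z + graphL G (range I) l f' z) {Y : E → E} (hY : Y = graphY G (range I) l f') :
    |graphH G (range I) l Y y| ≤ C₀ ∧
    - fderivWithin ℝ (graphH G (range I) l Y) (range I) y (Y y) ≤ C₀ * (1 +
      √(fderivWithin ℝ ψ (range I) y (grad G (range I) ψ y)
        - fderivWithin ℝ ψ (range I) y (Y y) ^ 2)) := by
  obtain ⟨a, b, ha, hb, hab, hFab⟩ := hFC
  obtain ⟨hFa, hFb⟩ := hFab ⟨graphMap f x, ν x⟩ (hν x hx).1.le
  have hself := mem_extChartAt_source (I := I) x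
  have hs := warpedMetric_normal hg hu hu2 hU hf hν hx hG hl hf' hy hψ hY
  have hgr := isGraphAt_chart hg hu hu2 hU hf hself hx
  have hσ := hasMFDerivAt_normal hg hu hu2 hU hf hν hx hG hl hf' hy
  have hFσ := (((hF _).mdifferentiableAt (by simp)).hasMFDerivAt.comp x hσ)
  have hev : graphH G (range I) l Y =ᶠ[𝓝[range I] y]
      coords I (F ∘ fun x' => (⟨graphMap f x', ν x'⟩ : TangentBundle (I.prod 𝓘(ℝ, ℝ)) (M × ℝ))) x := by
    rw [hy]
    filter_upwards [eventually_chart (I := I) hU hx] with z ⟨x', h1, h2, h3⟩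
    rw [← h3, coords_extChartAt _ h1, Function.comp_apply, ← hH x' h2,
      meanCurvature_eventually hg hu hu2 hU hf hν h2 h1, hG, hl, hY, hf', hG, hl]
  have hyS : y ∈ range I := hy ▸ mem_range_self _
  have hval := hev.self_of_nhdsWithin hyS
  rw [hy, coords_extChartAt _ hself, ← hy] at hval
  refine ⟨?_, ?_⟩
  · rw [hval]
    exact hFa.trans (by linarith)
  obtain ⟨Φ, hΦ⟩ : ∃ Φ : (E × ℝ) × (E × ℝ) →L[ℝ] ℝ, Φ = diff (I := (I.prod 𝓘(ℝ, ℝ)).tangent) F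
    ⟨graphMap f x, ν x⟩ := ⟨_, rfl⟩
  have hder : HasFDerivWithinAt (coords I (F ∘ fun x' =>
    (⟨graphMap f x', ν x'⟩ : TangentBundle (I.prod 𝓘(ℝ, ℝ)) (M × ℝ))) x) (Φ ∘L
      ((ContinuousLinearMap.id ℝ E).prod (fderivWithin ℝ f' (range I) y)).prod
        ((fderivWithin ℝ (graphY G (range I) l f') (range I) y).prod
          (fderivWithin ℝ (graphT G (range I) l f') (range I) y))) (range I) y := by
    have h1 := hFσ.2
    rw [← hy] at h1
    subst hΦ
    exact h1
  have hder2 := (hder.congr_of_eventuallyEq hev (hev.self_of_nhdsWithin hyS)).fderivWithin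
    ((isDomain_range I).unique y hyS)
  rw [← hG, ← hl, ← hf', ← hy, ← hY] at hgr
  set T := graphT G (range I) l f' with hT
  have e1 : fderivWithin ℝ (graphH G (range I) l Y) (range I) y (Y y) =
      Φ ((Y y, fderivWithin ℝ f' (range I) y (Y y)), (fderivWithin ℝ Y (range I) y (Y y),
        fderivWithin ℝ T (range I) y (Y y))) := by
    rw [hder2, hY]
    rfl
  have e2 : Φ ((Y y, fderivWithin ℝ f' (range I) y (Y y)), (fderivWithin ℝ Y (range I) y (Y y),
        fderivWithin ℝ T (range I) y (Y y))) = Φ ((Y y, T y), (fderivWithin ℝ Y (range I) y (Y y),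
        fderivWithin ℝ T (range I) y (Y y)))
        + (fderivWithin ℝ f' (range I) y (Y y) - T y) * Φ ((0, 1), (0, 0)) := by
    rw [← smul_eq_mul, ← map_smul, ← map_add]
    simp
  have e3 : 0 ≤ Φ ((0, 1), (0, 0)) := by
    rw [hΦ]
    exact diff_vertical_nonneg (V := ν x) hF (hmono x (horizontal ν x) (show E × ℝ from ν x).2)
  have e4 : 0 ≤ fderivWithin ℝ f' (range I) y (Y y) - T y := by
    have h1 := hgr.dual_apply (Y y)
    have h2 := hgr.metric.self.nonneg (Y y)
    have h3 : T y < 0 := neg_lt_zero.2 (Real.exp_pos _)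
    have h4 := mul_pos (Real.exp_pos (l y)) (Real.exp_pos (graphL G (range I) l f' y))
    rw [h1] at h2
    have := nonneg_of_mul_nonneg_right h2 h4
    linarith
  have e5 : |Φ ((Y y, T y), (fderivWithin ℝ Y (range I) y (Y y),
      fderivWithin ℝ T (range I) y (Y y)))| ≤ b * √(1 + (fderivWithin ℝ ψ (range I) y (grad G (range I) ψ y)
        - fderivWithin ℝ ψ (range I) y (Y y) ^ 2)) := by
    rw [← hs, hΦ]
    exact hFb _
  have e6 := mul_nonneg e4 e3
  have e7 := sqrt_one_add_le (fderivWithin ℝ ψ (range I) y (grad G (range I) ψ y)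
        - fderivWithin ℝ ψ (range I) y (Y y) ^ 2)
  rw [e1, e2]
  have e8 := neg_le_of_abs_le e5
  have e9 := mul_le_mul_of_nonneg_left e7 hb
  refine le_trans (by linarith) (mul_le_mul_of_nonneg_right (by linarith : b ≤ C₀) (by positivity))

end Prescribed

section Estimates

variable {E : Type*} [NormedAddCommGroup E] [InnerProductSpace ℝ E] [FiniteDimensional ℝ E]

theorem isInner_innerSL : IsInner (innerSL ℝ : E →L[ℝ] E →L[ℝ] ℝ) where
  symm X Z := real_inner_comm Z X
  pos X hX := by
    change 0 < inner ℝ X X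
    rw [real_inner_self_eq_norm_sq]
    positivity

theorem abs_traceL_le (T : E →L[ℝ] E) {c : ℝ} (hT : ∀ X, ‖T X‖ ≤ c * ‖X‖) :
    |traceL E T| ≤ Module.finrank ℝ E * c := by
  rw [← isInner_innerSL.metricTrace_comp T]
  refine isInner_innerSL.abs_metricTrace_le fun X => ?_
  change |inner ℝ (T X) X| ≤ c * inner ℝ X X
  rw [real_inner_self_eq_norm_sq]
  calc |inner ℝ (T X) X| ≤ ‖T X‖ * ‖X‖ := abs_real_inner_le_norm _ _
    _ ≤ c * ‖X‖ * ‖X‖ := by gcongr; exact hT X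
    _ = _ := by ring

theorem IsInner.norm_sq_le {B : E →L[ℝ] E →L[ℝ] ℝ} (hB : IsInner B) (X : E) :
    ‖X‖ ^ 2 ≤ ‖B.inverse‖ * B X X := by
  rcases eq_or_ne X 0 with rfl | hX
  · simp
  have hX' : 0 < ‖X‖ ^ 2 := by positivity
  set Z := B.inverse (innerSL ℝ X : E →L[ℝ] ℝ) with hZ
  have h1 : ∀ W, B Z W = inner ℝ X W := fun W => by
    rw [hZ, hB.apply_inverse]
    rfl
  have h2 := hB.sq_le Z X
  rw [h1, h1, real_inner_self_eq_norm_sq] at h2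
  have h3 : inner ℝ X Z ≤ ‖B.inverse‖ * ‖X‖ ^ 2 := by
    have h4 : ‖Z‖ ≤ ‖B.inverse‖ * ‖X‖ := by
      refine (ContinuousLinearMap.le_opNorm _ _).trans ?_
      rw [innerSL_apply_norm]
    calc inner ℝ X Z ≤ ‖X‖ * ‖Z‖ := real_inner_le_norm _ _
      _ ≤ ‖X‖ * (‖B.inverse‖ * ‖X‖) := by gcongr
      _ = _ := by ring
  have h5 := mul_le_mul_of_nonneg_right h3 (hB.nonneg X)
  nlinarith

theorem norm_apply₃_le {F : Type*} [NormedAddCommGroup F] [NormedSpace ℝ F]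
    (D : E →L[ℝ] E →L[ℝ] F) {c : ℝ} (hD : ‖D‖ ≤ c) (X Z : E) :
    ‖D X Z‖ ≤ c * ‖X‖ * ‖Z‖ := by
  refine (D.le_opNorm₂ X Z).trans ?_
  gcongr

theorem abs_koszul_le {D : E →L[ℝ] E →L[ℝ] E →L[ℝ] ℝ} {c : ℝ} (hD : ‖D‖ ≤ c) (X Z W : E) :
    |(D X Z W + D Z X W - D W X Z) / 2| ≤ 3 / 2 * c * ‖X‖ * ‖Z‖ * ‖W‖ := by
  have h : ∀ X Z W, |D X Z W| ≤ c * ‖X‖ * ‖Z‖ * ‖W‖ := fun X Z W => by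
    refine ((D X Z).le_opNorm W).trans ?_
    gcongr
    exact norm_apply₃_le D hD X Z
  have h1 := abs_le.1 (h X Z W)
  have h2 := abs_le.1 (h Z X W)
  have h3 := abs_le.1 (h W X Z)
  rw [abs_le]
  constructor <;> nlinarith

theorem norm_le_of_coercive {B : E →L[ℝ] E →L[ℝ] ℝ} {k a : ℝ} (hk : 0 < k)
    (hB : ∀ X, k * ‖X‖ ^ 2 ≤ B X X) {X : E} (h : B X X ≤ a * ‖X‖) (ha : 0 ≤ a) : ‖X‖ ≤ a / k := by
  rw [le_div_iff₀ hk]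
  rcases eq_or_ne X 0 with rfl | hX
  · simpa using ha
  have := (hB X).trans h
  have hX' : 0 < ‖X‖ := by positivity
  nlinarith

variable {G : E → E →L[ℝ] E →L[ℝ] ℝ} {S : Set E} {y : E}

theorem IsMetricAt.apply_fderiv_chr (h : IsMetricAt G S y) (V X Z W : E) :
    G y (fderivWithin ℝ (chr G S) S y V X Z) W =
      (fderivWithin ℝ (fderivWithin ℝ G S) S y V X Z W + fderivWithin ℝ (fderivWithin ℝ G S) S y V Z X W
        - fderivWithin ℝ (fderivWithin ℝ G S) S y V W X Z) / 2
      - fderivWithin ℝ G S y V (chr G S y X Z) W := by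
  have hc := fun X : E => hasFDerivWithinAt_const (𝕜 := ℝ) X y S
  have h1 := (h.hasFDerivWithinAt.clm_apply ((h.hasFDerivWithinAt_chr.clm_apply (hc X)).clm_apply
    (hc Z))).clm_apply (hc W)
  have hd := h.dom.hasFDerivWithinAt_fderivWithin h.contDiff h.mem
  have h2 := fun X Z W => ((hd.clm_apply (hc X)).clm_apply (hc Z)).clm_apply (hc W)
  have h3 := (((h2 X Z W).add (h2 Z X W)).sub (h2 W X Z)).const_mul (1 / 2 : ℝ)
  have h4 : ∀ᶠ z in 𝓝[S] y, G z (chr G S z X Z) W = (1 / 2 : ℝ) * (fderivWithin ℝ G S z X Z W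
      + fderivWithin ℝ G S z Z X W - fderivWithin ℝ G S z W X Z) := by
    filter_upwards [h.eventually] with z hz
    rw [hz.apply_chr]
    ring
  have h5 := DFunLike.congr_fun (h.dom.eq_of_eventuallyEq h.mem h4 h1 h3) V
  simp only [ContinuousLinearMap.comp_zero, zero_add, ContinuousLinearMap.flip_apply,
    _root_.add_apply, _root_.sub_apply, _root_.smul_apply, ContinuousLinearMap.comp_apply,
    smul_eq_mul] at h5
  linear_combination h5

theorem IsMetricAt.norm_chr_le (h : IsMetricAt G S y) {c C r : ℝ} (hc : 0 < c) (hC : 0 ≤ C) (hr : 0 < r)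
    (hG : ∀ X, c * r ^ 2 * ‖X‖ ^ 2 ≤ G y X X) (hG' : ‖fderivWithin ℝ G S y‖ ≤ C * r ^ 3) (X Z : E) :
    ‖chr G S y X Z‖ ≤ 3 / 2 * (C / c) * r * ‖X‖ * ‖Z‖ := by
  have h1 := norm_le_of_coercive (a := 3 / 2 * (C * r ^ 3) * ‖X‖ * ‖Z‖) (by positivity) hG
    (X := chr G S y X Z) (by
      rw [h.apply_chr]
      exact (le_abs_self _).trans (abs_koszul_le hG' X Z _)) (by positivity)
  refine h1.trans_eq ?_
  field_simp

theorem IsMetricAt.norm_fderiv_chr_le (h : IsMetricAt G S y) {c C r : ℝ} (hc : 0 < c) (hC : 0 ≤ C)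
    (hr : 0 < r) (hG : ∀ X, c * r ^ 2 * ‖X‖ ^ 2 ≤ G y X X) (hG' : ‖fderivWithin ℝ G S y‖ ≤ C * r ^ 3)
    (hG2 : ‖fderivWithin ℝ (fderivWithin ℝ G S) S y‖ ≤ C * r ^ 4) (V X Z : E) :
    ‖fderivWithin ℝ (chr G S) S y V X Z‖ ≤
      (3 / 2 * (C / c) + 3 / 2 * (C / c) ^ 2) * r ^ 2 * ‖V‖ * ‖X‖ * ‖Z‖ := by
  set P := fderivWithin ℝ (chr G S) S y V X Z with hP
  have h0 := h.norm_chr_le hc hC hr hG hG' X Z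
  have h1 := norm_le_of_coercive (a := 3 / 2 * (C * r ^ 4 * ‖V‖) * ‖X‖ * ‖Z‖
      + C * r ^ 3 * ‖V‖ * (3 / 2 * (C / c) * r * ‖X‖ * ‖Z‖)) (by positivity) hG (X := P) (by
      rw [hP, h.apply_fderiv_chr]
      refine (sub_le_sub ((le_abs_self _).trans (abs_koszul_le ((ContinuousLinearMap.le_opNorm _ V).trans (mul_le_mul_of_nonneg_right hG2 (norm_nonneg V)))
        X Z _)) (neg_abs_le _)).trans ?_
      rw [sub_neg_eq_add, add_mul]
      refine add_le_add_right ?_ _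
      refine ((fderivWithin ℝ G S y V (chr G S y X Z)).le_opNorm _).trans ?_
      gcongr
      refine (norm_apply₃_le _ hG' V _).trans ?_
      gcongr) (by positivity)
  refine h1.trans_eq ?_
  field_simp

/-- Uniform bounds, at the scale `r`, on a metric and a positive function bound the geometry. -/
theorem exists_boundedGeometryAt (c C : ℝ) (hc : 0 < c) (hC : 0 ≤ C) : ∃ B : ℝ, 0 ≤ B ∧
    ∀ (G : E → E →L[ℝ] E →L[ℝ] ℝ) (S : Set E) (v : E → ℝ) (y : E) (r : ℝ), 0 < r → 0 ≤ v y →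
      IsMetricAt G S y → (∀ X, c * r ^ 2 * ‖X‖ ^ 2 ≤ G y X X) →
      ‖fderivWithin ℝ G S y‖ ≤ C * r ^ 3 → ‖fderivWithin ℝ (fderivWithin ℝ G S) S y‖ ≤ C * r ^ 4 →
      ‖fderivWithin ℝ v S y‖ ≤ C * v y * r →
      ‖fderivWithin ℝ (fderivWithin ℝ v S) S y‖ ≤ C * v y * r ^ 2 → BoundedGeometryAt G S v B y := by
  set k := 3 / 2 * (C / c) with hk
  set k₂ := 3 / 2 * (C / c) + 3 / 2 * (C / c) ^ 2 with hk₂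
  have hk0 : 0 ≤ k := by positivity
  have hk20 : 0 ≤ k₂ := by positivity
  set n := (Module.finrank ℝ E : ℝ)
  refine ⟨n * (2 * k₂ + 2 * k ^ 2) / c + C / √c + C * (1 + k) / c, by positivity, ?_⟩
  intro G S v y r hr hv h hG hG' hG2 hv1 hv2 X
  have hΓ := h.norm_chr_le hc hC hr hG hG'
  have hΓ' := h.norm_fderiv_chr_le hc hC hr hG hG' hG2
  rw [← hk] at hΓ
  rw [← hk₂] at hΓ'
  have hGX := hG X
  have hG0 := h.self.nonneg X
  have hrX : r ^ 2 * ‖X‖ ^ 2 ≤ G y X X / c := by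
    rw [le_div_iff₀ hc]
    linarith
  have hc' : 0 < √c := Real.sqrt_pos.2 hc
  have p1 : 0 ≤ n * (2 * k₂ + 2 * k ^ 2) / c := by positivity
  have p2 : 0 ≤ C / √c := by positivity
  have p3 : 0 ≤ C * (1 + k) / c := by positivity
  refine ⟨?_, ?_, ?_⟩
  · have h1 : ∀ Z, ‖jacobiOp G S y X Z‖ ≤ ((2 * k₂ + 2 * k ^ 2) * (r ^ 2 * ‖X‖ ^ 2)) * ‖Z‖ := by
      intro Z
      rw [jacobiOp_apply]
      have e1 := hΓ' Z X X
      have e2 := hΓ' X Z X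
      have e3 : ‖chr G S y Z (chr G S y X X)‖ ≤ k * r * ‖Z‖ * (k * r * ‖X‖ * ‖X‖) := by
        refine (hΓ _ _).trans ?_
        gcongr
        exact hΓ _ _
      have e4 : ‖chr G S y X (chr G S y Z X)‖ ≤ k * r * ‖X‖ * (k * r * ‖Z‖ * ‖X‖) := by
        refine (hΓ _ _).trans ?_
        gcongr
        exact hΓ _ _
      have e5 := norm_sub_le (fderivWithin ℝ (chr G S) S y Z X X - fderivWithin ℝ (chr G S) S y X Z X
        + chr G S y Z (chr G S y X X)) (chr G S y X (chr G S y Z X))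
      have e6 := norm_add_le (fderivWithin ℝ (chr G S) S y Z X X - fderivWithin ℝ (chr G S) S y X Z X)
        (chr G S y Z (chr G S y X X))
      have e7 := norm_sub_le (fderivWithin ℝ (chr G S) S y Z X X) (fderivWithin ℝ (chr G S) S y X Z X)
      refine (e5.trans (add_le_add (e6.trans (add_le_add (e7.trans (add_le_add e1 e2)) e3)) e4)).trans_eq ?_
      ring
    have h2 := (neg_le_abs _).trans (abs_traceL_le _ h1)
    have h3 : n * ((2 * k₂ + 2 * k ^ 2) * (r ^ 2 * ‖X‖ ^ 2)) ≤ n * ((2 * k₂ + 2 * k ^ 2) * (G y X X / c)) := by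
      gcongr
    have h4 : n * ((2 * k₂ + 2 * k ^ 2) * (G y X X / c)) = n * (2 * k₂ + 2 * k ^ 2) / c * G y X X := by
      ring
    refine (h2.trans (h3.trans_eq h4)).trans (mul_le_mul_of_nonneg_right (by linarith) hG0)
  · have h1 : r * ‖X‖ ≤ √(G y X X) / √c := by
      rw [← Real.sqrt_div hG0, ← mul_pow] at *
      exact Real.le_sqrt_of_sq_le hrX
    have h2 : |fderivWithin ℝ v S y X| ≤ C * v y * r * ‖X‖ :=
      ((fderivWithin ℝ v S y).le_opNorm X).trans (by gcongr)
    calc |fderivWithin ℝ v S y X| ≤ C * v y * (r * ‖X‖) := by rw [← mul_assoc]; exact h2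
      _ ≤ C * v y * (√(G y X X) / √c) := by gcongr
      _ = C / √c * v y * √(G y X X) := by ring
      _ ≤ _ := by gcongr; linarith
  · have h1 : |hess G S v y X X| ≤ C * v y * r ^ 2 * ‖X‖ * ‖X‖ + C * v y * r * (k * r * ‖X‖ * ‖X‖) := by
      rw [hess_apply]
      refine (abs_sub _ _).trans (add_le_add (norm_apply₃_le _ hv2 X X) ?_)
      refine ((fderivWithin ℝ v S y).le_opNorm _).trans ?_
      gcongr
      exact hΓ X X
    calc |hess G S v y X X| ≤ C * (1 + k) * v y * (r ^ 2 * ‖X‖ ^ 2) := h1.trans_eq (by ring)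
      _ ≤ C * (1 + k) * v y * (G y X X / c) := by gcongr
      _ = C * (1 + k) / c * v y * G y X X := by ring
      _ ≤ _ := by gcongr; linarith

theorem BoundedGeometryAt.mono {v : E → ℝ} {B B' : ℝ} (h : BoundedGeometryAt G S v B y)
    (hG : ∀ X, 0 ≤ G y X X) (hv : 0 ≤ v y) (hB : B ≤ B') : BoundedGeometryAt G S v B' y := fun X => by
  obtain ⟨h1, h2, h3⟩ := h X
  have := hG X
  exact ⟨h1.trans (by gcongr), h2.trans (by gcongr), h3.trans (by gcongr)⟩

theorem IsMetricAt.eventually_boundedGeometryAt (h : IsMetricAt G S y) {v : E → ℝ}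
    (hv : ContDiffWithinAt ℝ 2 v S y) (hv0 : 0 < v y) :
    ∃ B : ℝ, 0 ≤ B ∧ ∀ᶠ z in 𝓝[S] y, BoundedGeometryAt G S v B z := by
  have hG1 : ContDiffWithinAt ℝ 1 (fderivWithin ℝ G S) S y :=
    h.contDiff.fderivWithin_right h.dom.unique (by norm_num) h.mem
  have hG2 : ContDiffWithinAt ℝ 0 (fderivWithin ℝ (fderivWithin ℝ G S) S) S y :=
    hG1.fderivWithin_right h.dom.unique (by norm_num) h.mem
  have hv1 : ContDiffWithinAt ℝ 1 (fderivWithin ℝ v S) S y :=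
    hv.fderivWithin_right h.dom.unique (by norm_num) h.mem
  have hv2 : ContDiffWithinAt ℝ 0 (fderivWithin ℝ (fderivWithin ℝ v S) S) S y :=
    hv1.fderivWithin_right h.dom.unique (by norm_num) h.mem
  set a := ‖(G y).inverse‖ + 1 with ha
  have ha0 : 0 < a := by positivity
  obtain ⟨C, hC1, hC2, hC3, hC4⟩ : ∃ C, ‖fderivWithin ℝ G S y‖ < C ∧
      ‖fderivWithin ℝ (fderivWithin ℝ G S) S y‖ < C ∧ ‖fderivWithin ℝ v S y‖ < C * v y ∧
      ‖fderivWithin ℝ (fderivWithin ℝ v S) S y‖ < C * v y := by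
    refine ⟨‖fderivWithin ℝ G S y‖ + ‖fderivWithin ℝ (fderivWithin ℝ G S) S y‖
      + (‖fderivWithin ℝ v S y‖ + ‖fderivWithin ℝ (fderivWithin ℝ v S) S y‖) / v y + 1, ?_, ?_, ?_, ?_⟩
    · have : 0 ≤ (‖fderivWithin ℝ v S y‖ + ‖fderivWithin ℝ (fderivWithin ℝ v S) S y‖) / v y := by positivity
      linarith [norm_nonneg (fderivWithin ℝ (fderivWithin ℝ G S) S y)]
    · have : 0 ≤ (‖fderivWithin ℝ v S y‖ + ‖fderivWithin ℝ (fderivWithin ℝ v S) S y‖) / v y := by positivity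
      linarith [norm_nonneg (fderivWithin ℝ G S y)]
    all_goals
      rw [add_mul, add_mul, div_mul_cancel₀ _ hv0.ne']
      have e1 := norm_nonneg (fderivWithin ℝ v S y)
      have e2 := norm_nonneg (fderivWithin ℝ (fderivWithin ℝ v S) S y)
      have e3 : 0 ≤ (‖fderivWithin ℝ G S y‖ + ‖fderivWithin ℝ (fderivWithin ℝ G S) S y‖) * v y := by
        positivity
      linarith
  have hC : 0 ≤ C := (norm_nonneg _).trans hC1.le
  obtain ⟨B, hB, hB'⟩ := exists_boundedGeometryAt (E := E) (1 / (2 * a)) C (by positivity) hC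
  refine ⟨B, hB, ?_⟩
  have hcv := hv.continuousWithinAt
  have hclose : ∀ᶠ z in 𝓝[S] y, ‖G z - G y‖ < 1 / (2 * a) := by
    have h1 : Tendsto (fun z => ‖G z - G y‖) (𝓝[S] y) (𝓝 ‖G y - G y‖) :=
      (h.contDiff.continuousWithinAt.sub continuousWithinAt_const).norm
    refine h1.eventually_lt_const ?_
    rw [sub_self, norm_zero]
    positivity
  filter_upwards [h.eventually, hclose, hcv.tendsto.eventually_const_lt hv0,
    hG1.continuousWithinAt.norm.tendsto.eventually_lt_const hC1,
    hG2.continuousWithinAt.norm.tendsto.eventually_lt_const hC2,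
    hv1.continuousWithinAt.norm.tendsto.eventually_lt (continuousWithinAt_const.mul hcv).tendsto hC3,
    hv2.continuousWithinAt.norm.tendsto.eventually_lt (continuousWithinAt_const.mul hcv).tendsto hC4]
    with z h1 h2 h3 h4 h5 h6 h7
  refine hB' G S v z 1 one_pos h3.le h1 (fun X => ?_) (by simpa using h4.le) (by simpa using h5.le)
    (by simpa using h6.le) (by simpa using h7.le)
  have e1 : ‖X‖ ^ 2 ≤ a * G y X X :=
    (h.self.norm_sq_le X).trans (mul_le_mul_of_nonneg_right (by linarith) (h.self.nonneg X))
  have e2 : |(G z - G y) X X| ≤ 1 / (2 * a) * ‖X‖ * ‖X‖ := norm_apply₃_le _ h2.le X X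
  have e3 : G z X X = G y X X + (G z - G y) X X := by simp
  have e4 := neg_le_of_abs_le e2
  have e5 : 1 / a * ‖X‖ ^ 2 ≤ G y X X := by
    rw [one_div, inv_mul_le_iff₀ ha0]
    exact e1
  have e6 : 1 / a = 1 / (2 * a) + 1 / (2 * a) := by
    field_simp
    norm_num
  rw [e6] at e5
  rw [e3]
  linarith

end Estimates

section Ball

variable {n : ℕ}

theorem ballRho_pos {y : EuclideanSpace ℝ (Fin n)} (hy : ‖y‖ < 1) : 0 < ballRho y := by
  have := norm_nonneg y
  rw [ballRho]
  nlinarith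

theorem ballRho_le (y : EuclideanSpace ℝ (Fin n)) : ballRho y ≤ 1 / 2 := by
  rw [ballRho]
  nlinarith [sq_nonneg ‖y‖]

theorem hasFDerivAt_ballRho (y : EuclideanSpace ℝ (Fin n)) :
    HasFDerivAt ballRho (-(innerSL ℝ y)) y := by
  have h1 := ((hasStrictFDerivAt_norm_sq y).hasFDerivAt.const_sub 1).mul_const' (1 / 2 : ℝ)
  have h2 : (ballRho : EuclideanSpace ℝ (Fin n) → ℝ) = fun z => (1 - ‖z‖ ^ 2) * (1 / 2 : ℝ) := by
    ext z
    rw [ballRho]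
    ring
  rw [h2]
  refine h1.congr_fderiv ?_
  ext v
  simp
  ring

theorem contDiff_ballRho {m : WithTop ℕ∞} : ContDiff ℝ m (ballRho : EuclideanSpace ℝ (Fin n) → ℝ) :=
  (contDiff_const.sub (contDiff_norm_sq ℝ)).div_const _

theorem hasFDerivAt_ballRho_zpow (m : ℤ) {y : EuclideanSpace ℝ (Fin n)} (hy : ‖y‖ < 1) :
    HasFDerivAt (fun z : EuclideanSpace ℝ (Fin n) => ballRho z ^ m)
      (-(m * ballRho y ^ (m - 1)) • innerSL ℝ y) y := by
  have h1 := (hasDerivAt_zpow m (ballRho y) (Or.inl (ballRho_pos hy).ne')).comp_hasFDerivAt y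
    (hasFDerivAt_ballRho y)
  refine h1.congr_fderiv ?_
  rw [smul_neg, neg_smul]

theorem norm_fderiv_ballRho_zpow_le (m : ℤ) {y : EuclideanSpace ℝ (Fin n)} (hy : ‖y‖ < 1) :
    ‖fderiv ℝ (fun z : EuclideanSpace ℝ (Fin n) => ballRho z ^ m) y‖ ≤
      |(m : ℝ)| * ballRho y ^ (m - 1) := by
  have h0 := ballRho_pos hy
  rw [(hasFDerivAt_ballRho_zpow m hy).fderiv, norm_smul, innerSL_apply_norm, norm_neg, norm_mul,
    Real.norm_eq_abs, Real.norm_of_nonneg (by positivity)]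
  exact mul_le_of_le_one_right (by positivity) hy.le

theorem norm_fderiv_fderiv_ballRho_zpow_le (m : ℤ) {y : EuclideanSpace ℝ (Fin n)} (hy : ‖y‖ < 1) :
    ‖fderiv ℝ (fderiv ℝ (fun z : EuclideanSpace ℝ (Fin n) => ballRho z ^ m)) y‖ ≤
      |(m : ℝ)| * (|((m - 1 : ℤ) : ℝ)| + 1) * ballRho y ^ (m - 2) := by
  have h0 := ballRho_pos hy
  have hev : fderiv ℝ (fun z : EuclideanSpace ℝ (Fin n) => ballRho z ^ m) =ᶠ[𝓝 y]
      fun z => (-(m : ℝ)) • (ballRho z ^ (m - 1) • innerSL ℝ z) := by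
    filter_upwards [(isOpen_lt continuous_norm continuous_const).mem_nhds hy] with z hz
    rw [(hasFDerivAt_ballRho_zpow m hz).fderiv, smul_smul, neg_mul]
  have h1 := ((hasFDerivAt_ballRho_zpow (m - 1) hy).smul
    (innerSL ℝ : EuclideanSpace ℝ (Fin n) →L[ℝ] _).hasFDerivAt).const_smul (-(m : ℝ))
  rw [hev.fderiv_eq]
  refine ContinuousLinearMap.opNorm_le_bound _ (by positivity) fun v => ?_
  rw [show fderiv ℝ (fun z => (-(m : ℝ)) • (ballRho z ^ (m - 1) • innerSL ℝ z)) y = _ from h1.fderiv]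
  change ‖(-(m : ℝ)) • (ballRho y ^ (m - 1) • innerSL ℝ v
    + (-(((m - 1 : ℤ) : ℝ) * ballRho y ^ (m - 1 - 1)) * inner ℝ y v) • innerSL ℝ y)‖ ≤ _
  rw [norm_smul, norm_neg, Real.norm_eq_abs, mul_assoc, mul_assoc]
  refine mul_le_mul_of_nonneg_left ((norm_add_le _ _).trans ?_) (abs_nonneg _)
  have e1 : ballRho y ^ (m - 1) = ballRho y ^ (m - 2) * ballRho y := by
    rw [← zpow_add_one₀ h0.ne']
    congr 1
    ring
  have e2 : m - 1 - 1 = m - 2 := by ring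
  have e3 : 0 < ballRho y ^ (m - 2) := zpow_pos h0 _
  have e4 : |inner ℝ y v| ≤ ‖v‖ := (abs_real_inner_le_norm y v).trans
    (mul_le_of_le_one_left (norm_nonneg _) hy.le)
  rw [norm_smul, norm_smul, innerSL_apply_norm, innerSL_apply_norm, norm_mul, norm_neg, norm_mul, e2,
    Real.norm_eq_abs, Real.norm_eq_abs, Real.norm_eq_abs, Real.norm_eq_abs,
    abs_of_pos (zpow_pos h0 _), abs_of_pos e3, e1]
  have e5 : ballRho y ^ (m - 2) * ballRho y * ‖v‖ ≤ ballRho y ^ (m - 2) * ‖v‖ := by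
    refine mul_le_mul_of_nonneg_right (mul_le_of_le_one_right e3.le ?_) (norm_nonneg _)
    linarith [ballRho_le y]
  have e6 : |((m - 1 : ℤ) : ℝ)| * ballRho y ^ (m - 2) * |inner ℝ y v| * ‖y‖ ≤
      |((m - 1 : ℤ) : ℝ)| * ballRho y ^ (m - 2) * ‖v‖ := by
    refine (mul_le_of_le_one_right (by positivity) hy.le).trans ?_
    gcongr
  refine (add_le_add e5 e6).trans_eq ?_
  ring

theorem hypMetric_eq (y : EuclideanSpace ℝ (Fin n)) :
    hypMetric y = ballRho y ^ (-2 : ℤ) • (innerSL ℝ : EuclideanSpace ℝ (Fin n) →L[ℝ] _) := by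
  rw [hypMetric]
  congr 1

theorem contDiffAt_ballRho_inv {y : EuclideanSpace ℝ (Fin n)} (hy : ‖y‖ < 1) {m : WithTop ℕ∞} :
    ContDiffAt ℝ m (fun z : EuclideanSpace ℝ (Fin n) => (ballRho z)⁻¹) y :=
  contDiff_ballRho.contDiffAt.inv (ballRho_pos hy).ne'

theorem contDiffAt_ballRho_zpow {y : EuclideanSpace ℝ (Fin n)} (hy : ‖y‖ < 1) :
    ContDiffAt ℝ 2 (fun z : EuclideanSpace ℝ (Fin n) => ballRho z ^ (-2 : ℤ)) y := by
  have h : (fun z : EuclideanSpace ℝ (Fin n) => ballRho z ^ (-2 : ℤ)) = fun z => (ballRho z)⁻¹ ^ 2 := by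
    ext z
    rw [zpow_neg, inv_pow]
    rfl
  rw [h]
  exact (contDiffAt_ballRho_inv hy).pow 2

theorem contDiffAt_hypMetric {y : EuclideanSpace ℝ (Fin n)} (hy : ‖y‖ < 1) :
    ContDiffAt ℝ 2 (hypMetric : EuclideanSpace ℝ (Fin n) → _) y := by
  have h : (hypMetric : EuclideanSpace ℝ (Fin n) → _) = fun z => ballRho z ^ (-2 : ℤ) •
    (innerSL ℝ : EuclideanSpace ℝ (Fin n) →L[ℝ] _) := funext hypMetric_eq
  rw [h]
  exact (contDiffAt_ballRho_zpow hy).smul contDiffAt_const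

theorem norm_iteratedFDeriv_hypMetric_le (i : ℕ) {y : EuclideanSpace ℝ (Fin n)} (hy : ‖y‖ < 1)
    (hi : i ≤ 2) : ‖iteratedFDeriv ℝ i (hypMetric : EuclideanSpace ℝ (Fin n) → _) y‖ ≤
      ‖iteratedFDeriv ℝ i (fun z : EuclideanSpace ℝ (Fin n) => ballRho z ^ (-2 : ℤ)) y‖ := by
  have h : (hypMetric : EuclideanSpace ℝ (Fin n) → _) =
      (ContinuousLinearMap.toSpanSingleton ℝ (innerSL ℝ : EuclideanSpace ℝ (Fin n) →L[ℝ] _)) ∘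
        fun z => ballRho z ^ (-2 : ℤ) := funext hypMetric_eq
  rw [h]
  refine (ContinuousLinearMap.norm_iteratedFDeriv_comp_left _ (contDiffAt_ballRho_zpow hy)
    (by exact_mod_cast hi)).trans (mul_le_of_le_one_left (norm_nonneg _) ?_)
  refine (ContinuousLinearMap.norm_toSpanSingleton (𝕜 := ℝ) _).trans_le (norm_innerSL_le ℝ)

theorem norm_iteratedFDeriv_two {E F : Type*} [NormedAddCommGroup E] [NormedSpace ℝ E]
    [NormedAddCommGroup F] [NormedSpace ℝ F] (f : E → F) (y : E) :
    ‖iteratedFDeriv ℝ 2 f y‖ = ‖fderiv ℝ (fderiv ℝ f) y‖ := by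
  rw [← norm_iteratedFDeriv_fderiv, norm_iteratedFDeriv_one]

/-- A metric on the ball with small deviation from the hyperbolic metric. -/
theorem exists_boundedGeometryAt_ball (C : ℝ) (hC : 0 ≤ C) : ∃ B : ℝ, 0 ≤ B ∧
    ∀ (G : EuclideanSpace ℝ (Fin n) → EuclideanSpace ℝ (Fin n) →L[ℝ] EuclideanSpace ℝ (Fin n) →L[ℝ] ℝ)
      (y : EuclideanSpace ℝ (Fin n)), ‖y‖ < 1 → IsMetricAt G univ y →
      ballRho y ^ 2 * ‖G y - hypMetric y‖ ≤ 1 / 2 →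
      (∀ j ≤ 2, ballRho y ^ (j + 2) * ‖iteratedFDeriv ℝ j (fun z => G z - hypMetric z) y‖ ≤ C) →
      BoundedGeometryAt G univ (fun z => (ballRho z)⁻¹) B y := by
  obtain ⟨B, hB, hB'⟩ := exists_boundedGeometryAt (E := EuclideanSpace ℝ (Fin n)) (1 / 2) (8 + C)
    (by norm_num) (by positivity)
  refine ⟨B, hB, fun G y hy h h0 hj => ?_⟩
  have hρ := ballRho_pos hy
  have hρ2 := ballRho_le y
  have hG : ContDiffAt ℝ 2 G y := h.contDiff.contDiffAt univ_mem
  have hhyp := contDiffAt_hypMetric hy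
  have hsum : ∀ i ≤ 2, ‖iteratedFDeriv ℝ i G y‖ ≤
      ‖iteratedFDeriv ℝ i (fun z : EuclideanSpace ℝ (Fin n) => ballRho z ^ (-2 : ℤ)) y‖
        + C * (ballRho y)⁻¹ ^ (i + 2) := by
    intro i hi
    have hi' : (i : WithTop ℕ∞) ≤ 2 := by exact_mod_cast hi
    have e1 : G = hypMetric + fun z => G z - hypMetric z := by
      ext1 z
      simp
    have e2 : iteratedFDeriv ℝ i G y = iteratedFDeriv ℝ i hypMetric y
        + iteratedFDeriv ℝ i (fun z => G z - hypMetric z) y := by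
      conv_lhs => rw [e1]
      exact iteratedFDeriv_add_apply (hhyp.of_le hi') ((hG.sub hhyp).of_le hi')
    rw [e2]
    refine (norm_add_le _ _).trans (add_le_add (norm_iteratedFDeriv_hypMetric_le i hy hi) ?_)
    have e3 := hj i hi
    rw [inv_pow, ← div_eq_mul_inv, le_div_iff₀ (by positivity)]
    linarith
  have hz : ∀ k : ℕ, ballRho y ^ (-(k : ℤ)) = (ballRho y)⁻¹ ^ k := fun k => by
    rw [zpow_neg, zpow_natCast, inv_pow]
  refine hB' G univ _ y (ballRho y)⁻¹ (by positivity) (by positivity) h (fun X => ?_) ?_ ?_ ?_ ?_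
  · have e1 : |(G y - hypMetric y) X X| ≤ ‖G y - hypMetric y‖ * ‖X‖ * ‖X‖ :=
      (G y - hypMetric y).le_opNorm₂ X X
    have e2 : G y X X = hypMetric y X X + (G y - hypMetric y) X X := by simp
    have e3 : hypMetric y X X = (ballRho y)⁻¹ ^ 2 * ‖X‖ ^ 2 := by
      change ((ballRho y) ^ 2)⁻¹ * inner ℝ X X = _
      rw [real_inner_self_eq_norm_sq, inv_pow]
    have e4 : ‖G y - hypMetric y‖ ≤ 1 / 2 * (ballRho y)⁻¹ ^ 2 := by
      rw [inv_pow, ← div_eq_mul_inv, le_div_iff₀ (by positivity)]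
      linarith
    have e5 : ‖G y - hypMetric y‖ * ‖X‖ * ‖X‖ ≤ 1 / 2 * (ballRho y)⁻¹ ^ 2 * ‖X‖ * ‖X‖ := by gcongr
    have e6 := neg_le_of_abs_le e1
    rw [e2, e3]
    linarith
  · rw [fderivWithin_univ, ← norm_iteratedFDeriv_one]
    refine (hsum 1 (by norm_num)).trans ?_
    have e1 := norm_fderiv_ballRho_zpow_le (-2) hy
    rw [← norm_iteratedFDeriv_one, show (-2 - 1 : ℤ) = -((3 : ℕ) : ℤ) by norm_num, hz] at e1
    have e2 : |((-2 : ℤ) : ℝ)| = 2 := by norm_num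
    rw [e2] at e1
    have e3 : 0 < (ballRho y)⁻¹ ^ 3 := by positivity
    linarith
  · rw [fderivWithin_univ, fderivWithin_univ, ← norm_iteratedFDeriv_two]
    refine (hsum 2 le_rfl).trans ?_
    have e1 := norm_fderiv_fderiv_ballRho_zpow_le (-2) hy
    rw [← norm_iteratedFDeriv_two, show (-2 - 2 : ℤ) = -((4 : ℕ) : ℤ) by norm_num, hz] at e1
    have e2 : |((-2 : ℤ) : ℝ)| * (|((-2 - 1 : ℤ) : ℝ)| + 1) = 8 := by norm_num
    rw [e2] at e1
    linarith
  · have e1 := norm_fderiv_ballRho_zpow_le (-1) hy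
    rw [show (-1 - 1 : ℤ) = -((2 : ℕ) : ℤ) by norm_num, hz] at e1
    simp only [zpow_neg_one] at e1
    rw [fderivWithin_univ]
    refine e1.trans ?_
    have e2 : |((-1 : ℤ) : ℝ)| = 1 := by norm_num
    have e3 : 0 < (ballRho y)⁻¹ ^ 2 := by positivity
    rw [e2, mul_assoc, ← pow_two]
    exact mul_le_mul_of_nonneg_right (by linarith) e3.le
  · have e1 := norm_fderiv_fderiv_ballRho_zpow_le (-1) hy
    rw [show (-1 - 2 : ℤ) = -((3 : ℕ) : ℤ) by norm_num, hz] at e1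
    simp only [zpow_neg_one] at e1
    rw [fderivWithin_univ, fderivWithin_univ]
    refine e1.trans ?_
    have e2 : |((-1 : ℤ) : ℝ)| * (|((-1 - 1 : ℤ) : ℝ)| + 1) = 3 := by norm_num
    have e3 : 0 < (ballRho y)⁻¹ ^ 3 := by positivity
    rw [e2, show (8 + C) * (ballRho y)⁻¹ * (ballRho y)⁻¹ ^ 2 = (8 + C) * (ballRho y)⁻¹ ^ 3 by ring]
    exact mul_le_mul_of_nonneg_right (by linarith) e3.le

/-- The Euclidean radius of the hyperbolic ball of radius `R`. -/
def hypRad (R : ℝ) : ℝ := √((Real.cosh R - 1) / (Real.cosh R + 1))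

theorem hypRad_sq (R : ℝ) : hypRad R ^ 2 * (Real.cosh R + 1) = Real.cosh R - 1 := by
  have := Real.one_le_cosh R
  rw [hypRad, Real.sq_sqrt (div_nonneg (by linarith) (by linarith))]
  field_simp

theorem hypRad_lt_one (R : ℝ) : hypRad R < 1 := by
  have h1 := hypRad_sq R
  have := Real.one_le_cosh R
  have h2 : 0 ≤ hypRad R := Real.sqrt_nonneg _
  by_contra! h3
  nlinarith [one_le_pow₀ h3 (n := 2)]

theorem hypRad_pos {R : ℝ} (hR : 0 < R) : 0 < hypRad R := by
  have := Real.one_lt_cosh.2 hR.ne'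
  exact Real.sqrt_pos.2 (div_pos (by linarith) (by linarith))

theorem cosh_hypDist_zero {y : EuclideanSpace ℝ (Fin n)} (hy : ‖y‖ < 1) :
    0 ≤ hypDist 0 y ∧ Real.cosh (hypDist 0 y) * (1 - ‖y‖ ^ 2) = 1 + ‖y‖ ^ 2 := by
  have h1 : 0 < 1 - ‖y‖ ^ 2 := by nlinarith [norm_nonneg y]
  have h2 : 1 ≤ 1 + 2 * ‖0 - y‖ ^ 2 / ((1 - ‖(0 : EuclideanSpace ℝ (Fin n))‖ ^ 2) * (1 - ‖y‖ ^ 2)) := by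
    rw [norm_zero]
    have : 0 ≤ 2 * ‖0 - y‖ ^ 2 / ((1 - 0 ^ 2) * (1 - ‖y‖ ^ 2)) :=
      div_nonneg (by positivity) (by linarith)
    linarith
  refine ⟨Real.arcosh_nonneg h2, ?_⟩
  rw [hypDist, Real.cosh_arcosh h2, norm_zero, zero_sub, norm_neg]
  field_simp
  ring

theorem mem_hypExterior {R : ℝ} (hR : 0 ≤ R) {y : EuclideanSpace ℝ (Fin n)} :
    y ∈ hypExterior n R ↔ ‖y‖ < 1 ∧ hypRad R < ‖y‖ := by
  refine and_congr_right fun hy => ?_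
  obtain ⟨h0, h1⟩ := cosh_hypDist_zero hy
  have h2 : 0 < 1 - ‖y‖ ^ 2 := by nlinarith [norm_nonneg y]
  have h3 := hypRad_sq R
  have h4 := Real.one_le_cosh R
  have h5 : 0 ≤ hypRad R := Real.sqrt_nonneg _
  have e1 : R < hypDist 0 y ↔ Real.cosh R < Real.cosh (hypDist 0 y) := by
    rw [Real.cosh_lt_cosh, abs_of_nonneg hR, abs_of_nonneg h0]
  have e2 : Real.cosh R < Real.cosh (hypDist 0 y) ↔
      Real.cosh R * (1 - ‖y‖ ^ 2) < Real.cosh (hypDist 0 y) * (1 - ‖y‖ ^ 2) :=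
    (mul_lt_mul_iff_left₀ h2).symm
  have e3 : hypRad R < ‖y‖ ↔ hypRad R ^ 2 * (Real.cosh R + 1) < ‖y‖ ^ 2 * (Real.cosh R + 1) := by
    rw [mul_lt_mul_iff_left₀ (by linarith), pow_lt_pow_iff_left₀ h5 (norm_nonneg y) two_ne_zero]
  rw [e1, e2, e3, h1, h3]
  constructor <;> intro h <;> linarith

theorem mem_hypBall_self {y : EuclideanSpace ℝ (Fin n)} (hy : ‖y‖ < 1) : y ∈ hypBall y 1 :=
  ⟨hy, by simp [hypDist]⟩

/-- Each point outside a ball is at distance less than `1` from a point at distance more than `1` from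
that ball. -/
theorem exists_mem_hypBall {R : ℝ} (hR : 0 ≤ R) {y : EuclideanSpace ℝ (Fin n)} (hy : y ∈ hypExterior n R) :
    ∃ x ∈ hypExterior n (R + 1), y ∈ hypBall x 1 := by
  obtain ⟨hy1, hy2⟩ := hy
  rcases lt_or_ge (R + 1) (hypDist 0 y) with h | h
  · exact ⟨y, ⟨hy1, h⟩, mem_hypBall_self hy1⟩
  obtain ⟨h0, h1⟩ := cosh_hypDist_zero hy1
  set b := hypDist 0 y / 2 with hb
  have hb2 : hypDist 0 y = 2 * b := by ring
  have hRb : R < 2 * b := hb2 ▸ hy2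
  have hb0 : 0 < b := by linarith
  set a := R / 4 + b / 2 + 1 / 2 with ha
  have ha0 : 0 < a := by positivity
  have htanh : ∀ {s : ℝ}, 0 < s → 0 < Real.tanh s ∧ Real.tanh s < 1 ∧
      (1 - Real.tanh s ^ 2) * Real.cosh s ^ 2 = 1 ∧ Real.tanh s * Real.cosh s = Real.sinh s := by
    intro s hs
    have h2 := Real.cosh_pos s
    have h3 := Real.sinh_pos_iff.2 hs
    have h4 := Real.cosh_sq s
    have h5 : Real.tanh s * Real.cosh s = Real.sinh s := by
      rw [Real.tanh_eq_sinh_div_cosh]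
      field_simp
    refine ⟨?_, Real.tanh_lt_one s, ?_, h5⟩
    · rw [Real.tanh_eq_sinh_div_cosh]
      positivity
    · rw [sub_mul, ← mul_pow, h5]
      linarith
  obtain ⟨ta1, ta2, ta3, ta4⟩ := htanh ha0
  obtain ⟨tb1, tb2, tb3, tb4⟩ := htanh hb0
  have hca := Real.cosh_pos a
  have hcb := Real.cosh_pos b
  have hyt : ‖y‖ = Real.tanh b := by
    rw [← pow_left_inj₀ (norm_nonneg y) tb1.le two_ne_zero]
    rw [hb2, Real.cosh_two_mul, ← tb4] at h1
    have h2 : Real.cosh b ^ 2 * (2 * (Real.tanh b ^ 2 - ‖y‖ ^ 2)) = 0 := by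
      linear_combination h1 - (1 + ‖y‖ ^ 2) * tb3
    have h3 : 2 * (Real.tanh b ^ 2 - ‖y‖ ^ 2) = 0 := by
      rcases mul_eq_zero.1 h2 with h | h
      · exact absurd h (by positivity)
      · exact h
    linarith
  set x := (Real.tanh a / Real.tanh b) • y with hx
  have hxt : ‖x‖ = Real.tanh a := by
    rw [hx, norm_smul, hyt, Real.norm_of_nonneg (by positivity)]
    field_simp
  have hx1 : ‖x‖ < 1 := hxt ▸ ta2
  obtain ⟨h0', h1'⟩ := cosh_hypDist_zero hx1
  have hcosh : Real.cosh (hypDist 0 x) = Real.cosh (2 * a) := by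
    rw [hxt] at h1'
    have h2 : Real.cosh (2 * a) * (1 - Real.tanh a ^ 2) = 1 + Real.tanh a ^ 2 := by
      rw [Real.cosh_two_mul, ← ta4]
      linear_combination (1 + Real.tanh a ^ 2) * ta3
    have h3 : (1 - Real.tanh a ^ 2) ≠ 0 := by
      intro h
      rw [h, zero_mul] at ta3
      exact zero_ne_one ta3
    exact mul_right_cancel₀ h3 (h1'.trans h2.symm)
  have hd : hypDist 0 x = 2 * a := by
    rw [← Real.arcosh_cosh h0', hcosh, Real.arcosh_cosh (by positivity)]
  refine ⟨x, ⟨hx1, ?_⟩, hy1, ?_⟩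
  · rw [hd, ha]
    linarith
  have hsub : ‖x - y‖ ^ 2 = (Real.tanh a - Real.tanh b) ^ 2 := by
    have h2 : x - y = (Real.tanh a / Real.tanh b - 1) • y := by rw [hx, sub_smul, one_smul]
    rw [h2, norm_smul, mul_pow, hyt, Real.norm_eq_abs, sq_abs]
    field_simp
  have h2 : 1 + 2 * ‖x - y‖ ^ 2 / ((1 - ‖x‖ ^ 2) * (1 - ‖y‖ ^ 2)) = Real.cosh (2 * (a - b)) := by
    have h3 : (1 - Real.tanh a ^ 2) = (Real.cosh a ^ 2)⁻¹ := eq_inv_of_mul_eq_one_left ta3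
    have h4 : (1 - Real.tanh b ^ 2) = (Real.cosh b ^ 2)⁻¹ := eq_inv_of_mul_eq_one_left tb3
    have h5 := Real.cosh_sq (a - b)
    rw [hsub, hxt, hyt, h3, h4, Real.cosh_two_mul, h5, Real.sinh_sub, ← ta4, ← tb4]
    field_simp
    ring
  rw [hypDist, h2, Real.arcosh_cosh (by linarith)]
  linarith

end Ball

section Infinity

variable {n : ℕ} {H : Type*} [TopologicalSpace H]
  {I : ModelWithCorners ℝ (EuclideanSpace ℝ (Fin n)) H}
  {M : Type*} [TopologicalSpace M] [ChartedSpace H M] [IsManifold I ∞ M]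
  {c : ChartAtInfinity I M} {g : FormField I M}

theorem contDiffWithinAt_pullForm {E : Type*} [NormedAddCommGroup E] [NormedSpace ℝ E]
    {B : E → E →L[ℝ] E →L[ℝ] ℝ} {T : E → E →L[ℝ] E} {S : Set E} {y : E} {m : WithTop ℕ∞}
    (hB : ContDiffWithinAt ℝ m B S y) (hT : ContDiffWithinAt ℝ m T S y) :
    ContDiffWithinAt ℝ m (fun z => pullForm (B z) (T z) (T z)) S y := by
  have hf := (ContinuousLinearMap.flipₗᵢ ℝ E E ℝ).toContinuousLinearEquiv.contDiff (n := m)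
  exact hf.comp_contDiffWithinAt ((hf.comp_contDiffWithinAt (hB.clm_comp hT)).clm_comp hT)

theorem ChartAtInfinity.mdifferentiable (c : ChartAtInfinity I M) :
    c.Ψ.MDifferentiable I 𝓘(ℝ, EuclideanSpace ℝ (Fin n)) :=
  ⟨c.contMDiffOn.mdifferentiableOn (by simp), c.contMDiffOn_symm.mdifferentiableOn (by simp)⟩

theorem ChartAtInfinity.contDiffAt_symm (c : ChartAtInfinity I M) {y : EuclideanSpace ℝ (Fin n)}
    (hy : y ∈ c.Ψ.target) {x : M} (hx : c.Ψ.symm y ∈ (extChartAt I x).source) :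
    ContDiffAt ℝ 3 (extChartAt I x ∘ c.Ψ.symm) y := by
  have h1 := c.contMDiffOn_symm.contMDiffAt (c.Ψ.open_target.mem_nhds hy)
  have h2 : ContMDiffAt I 𝓘(ℝ, EuclideanSpace ℝ (Fin n)) ∞ (extChartAt I x) (c.Ψ.symm y) :=
    contMDiffAt_extChartAt' (by rwa [extChartAt_source] at hx)
  exact (h2.comp y h1).contDiffAt.of_le (WithTop.coe_le_coe.2 le_top)

theorem ChartAtInfinity.eventually_source (c : ChartAtInfinity I M) {y : EuclideanSpace ℝ (Fin n)}
    (hy : y ∈ c.Ψ.target) {x : M} (hx : c.Ψ.symm y ∈ (extChartAt I x).source) :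
    ∀ᶠ z in 𝓝 y, z ∈ c.Ψ.target ∧ c.Ψ.symm z ∈ (extChartAt I x).source :=
  Filter.Eventually.and (c.Ψ.open_target.mem_nhds hy)
    ((c.Ψ.continuousAt_symm hy).eventually (extChartAt_source_mem_nhds' (I := I) hx))

/-- The differential of the inverse of the chart at infinity, in coordinates. -/
theorem ChartAtInfinity.mfderiv_symm (c : ChartAtInfinity I M) {y : EuclideanSpace ℝ (Fin n)}
    (hy : y ∈ c.Ψ.target) {x : M} (hx : c.Ψ.symm y ∈ (extChartAt I x).source)
    (V : EuclideanSpace ℝ (Fin n)) :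
    tangentCoordChange I x (c.Ψ.symm y) (c.Ψ.symm y)
      (fderivWithin ℝ (extChartAt I x ∘ c.Ψ.symm) univ y V) =
      mfderiv 𝓘(ℝ, EuclideanSpace ℝ (Fin n)) I c.Ψ.symm y V := by
  have hself := mem_extChartAt_source (I := I) (c.Ψ.symm y)
  have h1 := (c.mdifferentiable.mdifferentiableAt_symm hy).hasMFDerivAt.2
  rw [ModelWithCorners.range_eq_univ] at h1
  have h2 : HasFDerivWithinAt (extChartAt I (c.Ψ.symm y) ∘ c.Ψ.symm)
    (show EuclideanSpace ℝ (Fin n) →L[ℝ] EuclideanSpace ℝ (Fin n) from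
      mfderiv 𝓘(ℝ, EuclideanSpace ℝ (Fin n)) I c.Ψ.symm y) univ y := h1
  have h3 : HasFDerivWithinAt (extChartAt I (c.Ψ.symm y) ∘ (extChartAt I x).symm)
    (tangentCoordChange I x (c.Ψ.symm y) (c.Ψ.symm y)) (range I) ((extChartAt I x ∘ c.Ψ.symm) y) :=
    hasFDerivWithinAt_tangentCoordChange (I := I) ⟨hx, hself⟩
  have h4 := ((c.contDiffAt_symm hy hx).contDiffWithinAt (s := univ)).differentiableWithinAt
    (by simp) |>.hasFDerivWithinAt
  have h5 := h3.comp y h4 (fun z _ => show extChartAt I x (c.Ψ.symm z) ∈ range I from mem_range_self _)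
  have h6 : extChartAt I (c.Ψ.symm y) ∘ c.Ψ.symm =ᶠ[𝓝[univ] y]
      ((extChartAt I (c.Ψ.symm y) ∘ (extChartAt I x).symm) ∘ (extChartAt I x ∘ c.Ψ.symm)) := by
    rw [nhdsWithin_univ]
    filter_upwards [c.eventually_source hy hx] with z hz
    simp only [Function.comp_apply]
    rw [(extChartAt I x).left_inv hz.2]
  exact DFunLike.congr_fun (uniqueDiffWithinAt_univ.eq (h5.congr_of_eventuallyEq h6
    (h6.self_of_nhdsWithin (mem_univ y))) h2) V

theorem ChartAtInfinity.push_eq (c : ChartAtInfinity I M) (g : FormField I M)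
    {y : EuclideanSpace ℝ (Fin n)}
    (hy : y ∈ c.Ψ.target) {x : M} (hx : c.Ψ.symm y ∈ (extChartAt I x).source) :
    c.push g y = pullForm (formInChart g x ((extChartAt I x ∘ c.Ψ.symm) y))
      (fderivWithin ℝ (extChartAt I x ∘ c.Ψ.symm) univ y)
      (fderivWithin ℝ (extChartAt I x ∘ c.Ψ.symm) univ y) := by
  refine ContinuousLinearMap.ext fun V => ContinuousLinearMap.ext fun W => ?_
  have h1 := formInChart_extChartAt g hx (fderivWithin ℝ (extChartAt I x ∘ c.Ψ.symm) univ y V)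
    (fderivWithin ℝ (extChartAt I x ∘ c.Ψ.symm) univ y W)
  rw [c.mfderiv_symm hy hx, c.mfderiv_symm hy hx] at h1
  exact h1.symm

theorem ChartAtInfinity.isInner_push (c : ChartAtInfinity I M) (hg : IsRiemannian g)
    {y : EuclideanSpace ℝ (Fin n)} (hy : y ∈ c.Ψ.target) : IsInner (c.push g y) where
  symm V W := hg.symm _ _ _
  pos V hV := by
    refine hg.pos _ _ fun h => hV ?_
    have h1 := DFunLike.congr_fun (c.mdifferentiable.comp_symm_deriv hy) V
    change mfderiv I 𝓘(ℝ, EuclideanSpace ℝ (Fin n)) c.Ψ (c.Ψ.symm y)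
      (mfderiv 𝓘(ℝ, EuclideanSpace ℝ (Fin n)) I c.Ψ.symm y V) = V at h1
    rw [← h1]
    exact (congrArg _ h).trans (map_zero _)

theorem isDomain_univ {E : Type*} [NormedAddCommGroup E] [NormedSpace ℝ E] :
    IsDomain (univ : Set E) :=
  ⟨uniqueDiffOn_univ, by simp⟩

theorem ChartAtInfinity.isTransition (c : ChartAtInfinity I M) (hg : IsRiemannian g)
    {y : EuclideanSpace ℝ (Fin n)} (hy : y ∈ c.Ψ.target) :
    IsTransition (c.push g) univ (formInChart g (c.Ψ.symm y)) (range I)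
      (extChartAt I (c.Ψ.symm y) ∘ c.Ψ.symm) y := by
  have hself := mem_extChartAt_source (I := I) (c.Ψ.symm y)
  have hκ := (c.contDiffAt_symm hy hself).contDiffWithinAt (s := univ)
  have hev := c.eventually_source hy hself
  have hpull : ∀ᶠ z in 𝓝[univ] y, c.push g z = pullForm
      (formInChart g (c.Ψ.symm y) ((extChartAt I (c.Ψ.symm y) ∘ c.Ψ.symm) z))
      (fderivWithin ℝ (extChartAt I (c.Ψ.symm y) ∘ c.Ψ.symm) univ z)
      (fderivWithin ℝ (extChartAt I (c.Ψ.symm y) ∘ c.Ψ.symm) univ z) := by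
    rw [nhdsWithin_univ]
    filter_upwards [hev] with z hz
    exact c.push_eq g hz.1 hz.2
  have hm₂ : IsMetricAt (formInChart g (c.Ψ.symm y)) (range I)
      ((extChartAt I (c.Ψ.symm y) ∘ c.Ψ.symm) y) := hg.isMetricAt hself
  refine ⟨⟨isDomain_univ, mem_univ _, ?_, ?_⟩, hm₂, hκ,
    Eventually.of_forall fun z => mem_range_self _, hpull⟩
  · refine ContDiffWithinAt.congr_of_eventuallyEq (contDiffWithinAt_pullForm ?_ ?_) hpull
      (hpull.self_of_nhdsWithin (mem_univ y))
    · exact hm₂.contDiff.comp y (hκ.of_le (by norm_num)) fun z _ => mem_range_self _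
    · exact hκ.fderivWithin_right
        uniqueDiffOn_univ (by norm_num) (mem_univ y)
  · rw [nhdsWithin_univ]
    filter_upwards [hev] with z hz
    exact c.isInner_push hg hz.1

/-- Bounds near infinity. -/
theorem exists_boundedGeometryAt_infinity [T2Space M] (hg : IsRiemannian g) {α : ℝ≥0} {τ : ℝ} (hτ : 0 < τ)
    (hd : HasWeightedDecay c.R₀ 2 α τ (fun y => c.push g y - hypMetric y)) {ρ : M → ℝ}
    (hρ : IsExtensionOfRho c ρ) :
    ∃ (K : Set M) (R B : ℝ), IsCompact K ∧ R < 1 ∧ 0 ≤ B ∧ ∀ x ∉ K, x ∈ c.Ψ.source → R < ‖c.Ψ x‖ →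
      BoundedGeometryAt (formInChart g x) (range I) (coords I (fun x => (ρ x)⁻¹) x) B
        (extChartAt I x x) := by
  obtain ⟨hρ0, hρ2, K, hK, hK₀, hρK⟩ := hρ
  obtain ⟨b, hb⟩ := hd
  obtain ⟨B, hB, hB'⟩ := exists_boundedGeometryAt_ball (n := n) |b| (abs_nonneg b)
  set δ := (1 / (2 * (|b| + 1))) ^ τ⁻¹ with hδ
  have hδ0 : 0 < δ := Real.rpow_pos_of_pos (by positivity) _
  have hδτ : δ ^ τ = 1 / (2 * (|b| + 1)) := by
    rw [hδ, Real.rpow_inv_rpow (by positivity) hτ.ne']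
  refine ⟨K, max (hypRad (c.R₀ + 1)) (√(1 - 2 * δ)), B, hK, max_lt (hypRad_lt_one _) ?_, hB, ?_⟩
  · rw [Real.sqrt_lt' one_pos]
    linarith
  intro x hxK hxs hx
  have hyt := c.Ψ.map_source hxs
  set y := c.Ψ x with hy
  have hyx : c.Ψ.symm y = x := c.Ψ.left_inv hxs
  have hy1 : ‖y‖ < 1 := by
    have := hyt
    rw [c.target_eq] at this
    exact this.1
  have hR : 0 ≤ c.R₀ + 1 := by linarith [c.R₀_pos]
  have hyE : y ∈ hypExterior n (c.R₀ + 1) :=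
    (mem_hypExterior hR).2 ⟨hy1, (le_max_left _ _).trans_lt hx⟩
  have hρy := ballRho_pos hy1
  have hρδ : ballRho y ≤ δ := by
    have h1 := (Real.sqrt_lt' (by
      have : 0 ≤ √(1 - 2 * δ) := Real.sqrt_nonneg _
      exact this.trans_lt ((le_max_right _ _).trans_lt hx))).1 ((le_max_right _ _).trans_lt hx)
    rw [ballRho]
    linarith
  have hρτ : ballRho y ^ τ ≤ 1 / (2 * (|b| + 1)) :=
    (Real.rpow_le_rpow hρy.le hρδ hτ.le).trans_eq hδτ
  have hbτ : b * ballRho y ^ τ ≤ 1 / 2 := by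
    have h0 := Real.rpow_nonneg hρy.le τ
    have h1 : b * ballRho y ^ τ ≤ |b| * (1 / (2 * (|b| + 1))) :=
      mul_le_mul (le_abs_self b) hρτ h0 (abs_nonneg b)
    refine h1.trans ?_
    rw [mul_one_div, div_le_div_iff₀ (by positivity) (by norm_num)]
    linarith
  have hbτ' : b * ballRho y ^ τ ≤ |b| := by
    have h0 := Real.rpow_nonneg hρy.le τ
    have h1 : ballRho y ^ τ ≤ 1 := Real.rpow_le_one hρy.le (by linarith [ballRho_le y]) hτ.le
    exact (mul_le_mul_of_nonneg_right (le_abs_self b) h0).trans (mul_le_of_le_one_right (abs_nonneg b) h1)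
  have hyb := mem_hypBall_self hy1
  have htr := c.isTransition hg hyt
  have hN := (hb y hyE).1
  have hBG := hB' (c.push g) y hy1 htr.metric₁ (by
    have := hN 0 (by norm_num) y hyb
    rw [norm_iteratedFDeriv_zero] at this
    exact this.trans hbτ) fun j hj => (hN j hj y hyb).trans hbτ'
  have hd2 : ContDiffWithinAt ℝ 2 (coords I (fun x => (ρ x)⁻¹) x) (range I) (extChartAt I x x) :=
    (contDiffWithinAt_coords (n := 2) isOpen_univ hρ2.contMDiffOn (mem_extChartAt_source x)
      (mem_univ x)).inv (hρ0 _).ne'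
  have hself := mem_extChartAt_source (I := I) (c.Ψ.symm y)
  have hev : ∀ᶠ z in 𝓝[univ] y, (ballRho z)⁻¹ =
      coords I (fun x => (ρ x)⁻¹) (c.Ψ.symm y) ((extChartAt I (c.Ψ.symm y) ∘ c.Ψ.symm) z) := by
    rw [nhdsWithin_univ]
    filter_upwards [c.eventually_source hyt hself, (c.Ψ.continuousAt_symm hyt).eventually
      (hK.isClosed.isOpen_compl.mem_nhds (by rw [hyx]; exact hxK))] with z hz hz'
    rw [Function.comp_apply, coords_extChartAt _ hz.2, hρK _ hz', c.Ψ.right_inv hz.1]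
  have hfin := htr.boundedGeometryAt hev (by rw [Function.comp_apply, hyx]; exact hd2) hBG
  rw [Function.comp_apply, hyx] at hfin
  exact hfin

/-- Bounds on compact sets. -/
theorem IsRiemannian.eventually_boundedGeometryAt (hg : IsRiemannian g) {v : M → ℝ} (hv0 : ∀ x, 0 < v x)
    (hv : ContMDiff I 𝓘(ℝ, ℝ) 2 v) (p : M) : ∃ B : ℝ, 0 ≤ B ∧ ∀ᶠ x in 𝓝 p,
      BoundedGeometryAt (formInChart g x) (range I) (coords I v x) B (extChartAt I x x) := by
  have hself := mem_extChartAt_source (I := I) p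
  have hvx : ∀ {q x : M}, x ∈ (extChartAt I q).source →
      ContDiffWithinAt ℝ 2 (coords I v q) (range I) (extChartAt I q x) := fun hx =>
    contDiffWithinAt_coords (n := 2) isOpen_univ hv.contMDiffOn hx (mem_univ _)
  obtain ⟨B, hB, h⟩ := (hg.isMetricAt hself).eventually_boundedGeometryAt (hvx hself) (hv0 _)
  refine ⟨B, hB, ?_⟩
  filter_upwards [eventually_extChartAt h, extChartAt_source_mem_nhds (I := I) p] with x h1 h2
  have hx := mem_extChartAt_source (I := I) x
  have h3 := (hg.isTransition h2 hx).boundedGeometryAt (coords_eventually_transition v h2 hx)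
    (by rw [transition_apply h2]; exact hvx hx) h1
  rwa [transition_apply h2] at h3

end Infinity

section Completeness

variable {n : ℕ} {H : Type*} [TopologicalSpace H]
  {I : ModelWithCorners ℝ (EuclideanSpace ℝ (Fin n)) H}
  {M : Type*} [TopologicalSpace M] [ChartedSpace H M] [IsManifold I ∞ M]

open scoped Bundle in
/-- The Riemannian distance is bounded by the length of a segment in the chart at infinity. -/
theorem ChartAtInfinity.riemannianEDist_le (c : ChartAtInfinity I M)
    (g : Bundle.RiemannianMetric (fun x : M => TangentSpace I x))
    {a b : EuclideanSpace ℝ (Fin n)} {C : ℝ} (hC : 0 ≤ C)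
    (hseg : ∀ t ∈ Icc (0 : ℝ) 1, AffineMap.lineMap a b t ∈ c.Ψ.target ∧
      ∀ V, c.push g.inner (AffineMap.lineMap a b t) V V ≤ (C * ‖V‖) ^ 2) :
    letI : Bundle.RiemannianBundle (fun x : M => TangentSpace I x) := ⟨g⟩
    riemannianEDist I (c.Ψ.symm a) (c.Ψ.symm b) ≤ ENNReal.ofReal (C * ‖b - a‖) := by
  let _ : Bundle.RiemannianBundle (fun x : M => TangentSpace I x) := ⟨g⟩
  have hline : ContMDiff 𝓘(ℝ, ℝ) 𝓘(ℝ, EuclideanSpace ℝ (Fin n)) 1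
      (AffineMap.lineMap a b : ℝ → EuclideanSpace ℝ (Fin n)) := by
    have h1 : (AffineMap.lineMap a b : ℝ → EuclideanSpace ℝ (Fin n)) = fun t => t • (b - a) + a :=
      funext fun t => AffineMap.lineMap_apply_module' a b t
    rw [h1]
    exact ((contDiff_id.smul contDiff_const).add contDiff_const).contMDiff
  set γ : ℝ → M := fun t => c.Ψ.symm (AffineMap.lineMap a b t) with hγ
  have hγs : ContMDiffOn 𝓘(ℝ, ℝ) I 1 γ (Icc 0 1) :=
    (c.contMDiffOn_symm.of_le (by simp)).comp hline.contMDiffOn fun t ht => (hseg t ht).1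
  refine (riemannianEDist_le_pathELength hγs (by simp [hγ]) (by simp [hγ]) zero_le_one).trans ?_
  rw [pathELength_eq_lintegral_mfderiv_Icc]
  have hbd : ∀ t ∈ Icc (0 : ℝ) 1, ‖mfderiv 𝓘(ℝ, ℝ) I γ t 1‖ₑ ≤ ENNReal.ofReal (C * ‖b - a‖) := by
    intro t ht
    obtain ⟨h1, h2⟩ := hseg t ht
    have h3 : HasMFDerivAt 𝓘(ℝ, ℝ) 𝓘(ℝ, EuclideanSpace ℝ (Fin n)) (AffineMap.lineMap a b) t
        (ContinuousLinearMap.toSpanSingleton ℝ (b - a)) :=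
      (AffineMap.hasDerivAt_lineMap (a := a) (b := b) (x := t)).hasFDerivAt.hasMFDerivAt
    have h4 := (c.mdifferentiable.mdifferentiableAt_symm h1).hasMFDerivAt.comp t h3
    have h5 : mfderiv 𝓘(ℝ, ℝ) I γ t 1 =
        mfderiv 𝓘(ℝ, EuclideanSpace ℝ (Fin n)) I c.Ψ.symm (AffineMap.lineMap a b t) (b - a) := by
      rw [show mfderiv 𝓘(ℝ, ℝ) I γ t = _ from h4.mfderiv]
      change mfderiv 𝓘(ℝ, EuclideanSpace ℝ (Fin n)) I c.Ψ.symm (AffineMap.lineMap a b t)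
        ((1 : ℝ) • (b - a)) = _
      rw [one_smul]
    rw [h5, ← ofReal_norm]
    refine ENNReal.ofReal_le_ofReal ?_
    refine abs_le_of_sq_le_sq' ?_ (by positivity) |>.2
    rw [← real_inner_self_eq_norm_sq]
    exact h2 (b - a)
  refine (MeasureTheory.setLIntegral_mono' measurableSet_Icc hbd).trans ?_
  simp

theorem lineMap_eq_add {E : Type*} [AddCommGroup E] [Module ℝ E] (y e : E) (t : ℝ) :
    AffineMap.lineMap y (y + e) t = y + t • e := by
  rw [AffineMap.lineMap_apply_module', add_sub_cancel_left, add_comm]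

open scoped Bundle in
theorem ChartAtInfinity.exists_tendsto_subseq [T2Space M] [FirstCountableTopology M]
    (c : ChartAtInfinity I M)
    (g : Bundle.RiemannianMetric (fun x : M => TangentSpace I x)) (hg : IsCompleteMetric g) {b : ℝ}
    (hb : 0 ≤ b) (hpush : ∀ y ∈ c.Ψ.target, ∀ V, c.push g.inner y V V ≤ (b / ballRho y * ‖V‖) ^ 2)
    {K : Set M} (hK : IsCompact K) {R : ℝ} (hR : R < 1) {s : ℕ → M}
    (hs : ∀ k, s k ∈ K ∨ s k ∈ c.Ψ.source ∧ ‖c.Ψ (s k)‖ ≤ R) :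
    ∃ x, ∃ φ : ℕ → ℕ, StrictMono φ ∧ Tendsto (s ∘ φ) atTop (𝓝 x) := by
  by_cases h : ∃ᶠ k in atTop, s k ∈ K
  · obtain ⟨x, -, φ, hφ, hx⟩ := hK.tendsto_subseq' h
    exact ⟨x, φ, hφ, hx⟩
  rw [not_frequently] at h
  have h1 : ∀ᶠ k in atTop, s k ∈ c.Ψ.source ∧ ‖c.Ψ (s k)‖ ≤ R :=
    h.mono fun k hk => (hs k).resolve_left hk
  obtain ⟨q, hq, φ, hφ, hlim⟩ := (isCompact_closedBall (0 : EuclideanSpace ℝ (Fin n)) R).tendsto_subseq'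
    (x := fun k => c.Ψ (s k)) (h1.mono fun k hk => by simpa using hk.2).frequently
  have h2 : ∀ᶠ k in atTop, s (φ k) ∈ c.Ψ.source := hφ.tendsto_atTop.eventually (h1.mono fun k hk => hk.1)
  suffices h : ∃ x, Tendsto (s ∘ φ) atTop (𝓝 x) by
    obtain ⟨x, hx⟩ := h
    exact ⟨x, φ, hφ, hx⟩
  have hq1 : ‖q‖ < 1 := by
    rw [mem_closedBall_zero_iff] at hq
    exact hq.trans_lt hR
  have htarget : ∀ {y}, y ∈ c.Ψ.target ↔ ‖y‖ < 1 ∧ hypRad c.R₀ < ‖y‖ := fun {y} => by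
    rw [c.target_eq, mem_hypExterior c.R₀_pos.le]
  have hq2 : hypRad c.R₀ ≤ ‖q‖ := ge_of_tendsto hlim.norm
    (h2.mono fun k hk => (htarget.1 (c.Ψ.map_source hk)).2.le)
  rcases hq2.lt_or_eq with hq3 | hq3
  · refine ⟨c.Ψ.symm q, ((c.Ψ.continuousAt_symm (htarget.2 ⟨hq1, hq3⟩)).tendsto.comp hlim).congr' ?_⟩
    exact h2.mono fun k hk => c.Ψ.left_inv hk
  have hr0 : 0 < ‖q‖ := hq3 ▸ hypRad_pos c.R₀_pos
  rw [hq3] at htarget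
  set r := ‖q‖ with hr
  set R' := (1 + r) / 2 with hR'
  have hρR : 0 < (1 - R' ^ 2) / 2 := by nlinarith
  set C := b / ((1 - R' ^ 2) / 2) with hC
  have hC0 : 0 ≤ C := by positivity
  have hbound : ∀ z : EuclideanSpace ℝ (Fin n), r < ‖z‖ → ‖z‖ ≤ R' → z ∈ c.Ψ.target ∧
      ∀ V, c.push g.inner z V V ≤ (C * ‖V‖) ^ 2 := by
    intro z hz1 hz2
    have hz : z ∈ c.Ψ.target := htarget.2 ⟨by linarith, hz1⟩
    refine ⟨hz, fun V => (hpush z hz V).trans ?_⟩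
    have h3 : (1 - R' ^ 2) / 2 ≤ ballRho z := by
      rw [ballRho]
      nlinarith
    have h4 : 0 < ballRho z := hρR.trans_le h3
    have h5 : b / ballRho z ≤ C := div_le_div_of_nonneg_left hb hρR h3
    gcongr
  refine hg (s ∘ φ) fun ε hε => ?_
  obtain ⟨ε', hε'0, hε'⟩ : ∃ ε' : ℝ, 0 < ε' ∧ ENNReal.ofReal ε' ≤ ε := by
    rcases eq_or_ne ε ⊤ with rfl | htop
    · exact ⟨1, one_pos, le_top⟩
    · exact ⟨ε.toReal, ENNReal.toReal_pos hε.ne' htop, ENNReal.ofReal_toReal_le⟩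
  set δ := min ((1 - r) / 4) (ε' / (3 * C + 1)) with hδ
  have hδ0 : 0 < δ := lt_min (by linarith) (by positivity)
  have hδ1 : δ ≤ (1 - r) / 4 := min_le_left _ _
  have hδ2 : 3 * C * δ < ε' := by
    have h3 : δ * (3 * C + 1) ≤ ε' := by
      rw [← le_div_iff₀ (by positivity)]
      exact min_le_right _ _
    linarith
  set η := δ * r / 2 with hη
  have hη0 : 0 < η := by positivity
  have hδr : δ * r ≤ δ := mul_le_of_le_one_right hδ0.le hq1.le
  have hδr0 : 0 < δ * r := by positivity
  have hηr : η < r := by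
    have : δ * r ≤ 1 * r := mul_le_mul_of_nonneg_right (by linarith) hr0.le
    linarith
  have h3 : ∀ᶠ k in atTop, ‖c.Ψ (s (φ k)) - q‖ < η := by
    have := (hlim.sub_const q).norm
    rw [sub_self, norm_zero] at this
    exact this.eventually_lt_const hη0
  obtain ⟨k, hk⟩ := eventually_atTop.1 (h2.and h3)
  refine ⟨k, fun i hi j hj => ?_⟩
  obtain ⟨hi1, hi2⟩ := hk i hi
  obtain ⟨hj1, hj2⟩ := hk j hj
  let _ : Bundle.RiemannianBundle (fun x : M => TangentSpace I x) := ⟨g⟩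
  have hvert : ∀ y : EuclideanSpace ℝ (Fin n), y ∈ c.Ψ.target → ‖y - q‖ < η →
      riemannianEDist I (c.Ψ.symm y) (c.Ψ.symm (y + δ • q)) ≤ ENNReal.ofReal (C * (δ * r)) := by
    intro y hy hyq
    refine (c.riemannianEDist_le g hC0 fun t ht => ?_).trans_eq (by
      rw [add_sub_cancel_left, norm_smul, Real.norm_of_nonneg hδ0.le])
    rw [lineMap_eq_add, smul_smul]
    refine hbound _ ?_ ?_
    · refine (htarget.1 hy).2.trans_le ?_
      rw [← pow_le_pow_iff_left₀ (norm_nonneg _) (norm_nonneg _) two_ne_zero, norm_add_sq_real,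
        real_inner_smul_right]
      have h4 : 0 ≤ inner ℝ y q := by
        have h5 : inner ℝ y q = inner ℝ (y - q) q + r ^ 2 := by
          rw [inner_sub_left, real_inner_self_eq_norm_sq]
          ring
        have h6 := neg_le_of_abs_le (abs_real_inner_le_norm (y - q) q)
        have h7 : ‖y - q‖ * ‖q‖ ≤ r * r := mul_le_mul (by linarith) le_rfl hr0.le hr0.le
        rw [h5]
        linarith
      have h5 : 0 ≤ t * δ := mul_nonneg ht.1 hδ0.le
      have h6 : 0 ≤ t * δ * inner ℝ y q := mul_nonneg h5 h4
      linarith [sq_nonneg ‖(t * δ) • q‖]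
    · have h4 : y + (t * δ) • q = (y - q) + q + (t * δ) • q := by abel
      have h5 : ‖(t * δ) • q‖ ≤ δ * r := by
        rw [norm_smul, Real.norm_of_nonneg (mul_nonneg ht.1 hδ0.le), mul_assoc]
        exact mul_le_of_le_one_left hδr0.le ht.2
      rw [h4]
      refine ((norm_add_le _ _).trans (add_le_add_left (norm_add_le _ _) _)).trans ?_
      linarith
  have hhor : ∀ y y' : EuclideanSpace ℝ (Fin n), ‖y - q‖ < η → ‖y' - q‖ < η →
      riemannianEDist I (c.Ψ.symm (y + δ • q)) (c.Ψ.symm (y' + δ • q)) ≤ ENNReal.ofReal (C * (2 * η)) := by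
    intro y y' hy hy'
    have h8 : ‖y' + δ • q - (y + δ • q)‖ ≤ 2 * η := by
      have : y' + δ • q - (y + δ • q) = (y' - q) - (y - q) := by abel
      rw [this]
      exact (norm_sub_le _ _).trans (by linarith)
    refine (c.riemannianEDist_le g hC0 fun t ht => ?_).trans (ENNReal.ofReal_le_ofReal
      (mul_le_mul_of_nonneg_left h8 hC0))
    have h4 : AffineMap.lineMap (y + δ • q) (y' + δ • q) t =
        ((1 - t) • (y - q) + t • (y' - q)) + (1 + δ) • q := by
      rw [AffineMap.lineMap_apply_module]
      module
    have h5 : ‖(1 - t) • (y - q) + t • (y' - q)‖ ≤ η := by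
      refine (norm_add_le _ _).trans ?_
      rw [norm_smul, norm_smul, Real.norm_of_nonneg (by linarith [ht.2]), Real.norm_of_nonneg ht.1]
      have e1 := mul_le_mul_of_nonneg_left hy.le (by linarith [ht.2] : 0 ≤ 1 - t)
      have e2 := mul_le_mul_of_nonneg_left hy'.le ht.1
      linarith
    have h6 : ‖(1 + δ) • q‖ = r + δ * r := by
      rw [norm_smul, Real.norm_of_nonneg (by linarith)]
      ring
    rw [h4]
    refine hbound _ ?_ ?_
    · have h7 := norm_sub_norm_le ((1 + δ) • q) (-((1 - t) • (y - q) + t • (y' - q)))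
      rw [norm_neg, sub_neg_eq_add, add_comm ((1 + δ) • q)] at h7
      linarith
    · refine (norm_add_le _ _).trans ?_
      linarith
  have e1 := hvert _ (c.Ψ.map_source hi1) hi2
  have e2 := hhor _ _ hi2 hj2
  have e3 := hvert _ (c.Ψ.map_source hj1) hj2
  rw [c.Ψ.left_inv hi1] at e1
  rw [c.Ψ.left_inv hj1, riemannianEDist_comm] at e3
  refine (riemannianEDist_triangle.trans (add_le_add e1 (riemannianEDist_triangle.trans
    (add_le_add e2 e3)))).trans_lt ?_
  rw [← ENNReal.ofReal_add (by positivity) (by positivity), ← ENNReal.ofReal_add (by positivity) (by positivity)]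
  refine ((ENNReal.ofReal_lt_ofReal_iff hε'0).2 ?_).trans_le hε'
  have e4 : C * (δ * r) ≤ C * δ := mul_le_mul_of_nonneg_left hδr hC0
  have e5 : C * (2 * η) = C * (δ * r) := by rw [hη]; ring
  linarith

theorem ChartAtInfinity.push_le (c : ChartAtInfinity I M) {g : FormField I M} {α : ℝ≥0} {τ : ℝ}
    (hτ : 0 < τ) (hd : HasWeightedDecay c.R₀ 2 α τ (fun y => c.push g y - hypMetric y)) :
    ∃ b : ℝ, 0 ≤ b ∧ ∀ y ∈ c.Ψ.target, ∀ V, c.push g y V V ≤ (b / ballRho y * ‖V‖) ^ 2 := by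
  obtain ⟨b, hb⟩ := hd
  refine ⟨√(1 + |b|), Real.sqrt_nonneg _, fun y hy V => ?_⟩
  rw [c.target_eq] at hy
  have hρ := ballRho_pos hy.1
  obtain ⟨x, hx, hyx⟩ := exists_mem_hypBall c.R₀_pos.le hy
  have hρx := ballRho_pos hx.1
  have h1 := (hb x hx).1 0 (by norm_num) y hyx
  rw [norm_iteratedFDeriv_zero, zero_add] at h1
  have h2 : b * ballRho x ^ τ ≤ |b| := by
    have h0 := Real.rpow_nonneg hρx.le τ
    have h1 : ballRho x ^ τ ≤ 1 := Real.rpow_le_one hρx.le (by linarith [ballRho_le x]) hτ.le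
    exact (mul_le_mul_of_nonneg_right (le_abs_self b) h0).trans (mul_le_of_le_one_right (abs_nonneg b) h1)
  have h3 : ‖c.push g y - hypMetric y‖ ≤ |b| / ballRho y ^ 2 := by
    rw [le_div_iff₀ (by positivity)]
    linarith
  have h4 : |(c.push g y - hypMetric y) V V| ≤ |b| / ballRho y ^ 2 * ‖V‖ * ‖V‖ :=
    ((c.push g y - hypMetric y).le_opNorm₂ V V).trans (by gcongr)
  have h5 : c.push g y V V = hypMetric y V V + (c.push g y - hypMetric y) V V := by simp
  have h6 : hypMetric y V V = (ballRho y ^ 2)⁻¹ * ‖V‖ ^ 2 := by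
    rw [← real_inner_self_eq_norm_sq]
    rfl
  have h7 := (abs_le.1 h4).2
  rw [mul_pow, div_pow, Real.sq_sqrt (by positivity), h5, h6]
  refine (add_le_add_right h7 _).trans_eq ?_
  field_simp

/-- The geometry of asymptotically hyperbolic manifolds is bounded. -/
theorem exists_uniform_boundedGeometryAt [T2Space M] [FirstCountableTopology M] {c : ChartAtInfinity I M}
    {g : Bundle.RiemannianMetric (fun x : M => TangentSpace I x)} (hg : IsRiemannian g.inner)
    (hcomplete : IsCompleteMetric g) {α : ℝ≥0} {τ : ℝ} (hτ : 0 < τ)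
    (hd : HasWeightedDecay c.R₀ 2 α τ (fun y => c.push g.inner y - hypMetric y)) {ρ : M → ℝ}
    (hρ : IsExtensionOfRho c ρ) :
    ∃ B : ℝ, 0 ≤ B ∧ ∀ x, BoundedGeometryAt (formInChart g.inner x) (range I)
      (coords I (fun x => (ρ x)⁻¹) x) B (extChartAt I x x) := by
  obtain ⟨K, R, B, hK, hR, hB, hKR⟩ := exists_boundedGeometryAt_infinity hg hτ hd hρ
  obtain ⟨b, hb, hpush⟩ := c.push_le hτ hd
  have hv0 : ∀ x, 0 < (ρ x)⁻¹ := fun x => inv_pos.2 (hρ.1 x)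
  have hv : ContMDiff I 𝓘(ℝ, ℝ) 2 (fun x => (ρ x)⁻¹) := hρ.2.1.inv₀ fun x => (hρ.1 x).ne'
  have hmono : ∀ {x : M} {B B' : ℝ}, B ≤ B' → BoundedGeometryAt (formInChart g.inner x) (range I)
      (coords I (fun x => (ρ x)⁻¹) x) B (extChartAt I x x) → BoundedGeometryAt (formInChart g.inner x)
      (range I) (coords I (fun x => (ρ x)⁻¹) x) B' (extChartAt I x x) := fun {x B B'} h1 h2 =>
    h2.mono (hg.isInner (mem_extChartAt_source x)).nonneg
      (by rw [coords_extChartAt _ (mem_extChartAt_source x)]; exact (hv0 x).le) h1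
  by_contra! hcon
  have : Nonempty M := ⟨(hcon 0 le_rfl).choose⟩
  choose! s hs using hcon
  obtain ⟨N, hN⟩ := exists_nat_ge B
  have hs' : ∀ k : ℕ, s ((k + N : ℕ) : ℝ) ∈ K ∪ c.K₀ ∨ s ((k + N : ℕ) : ℝ) ∈ c.Ψ.source ∧
      ‖c.Ψ (s ((k + N : ℕ) : ℝ))‖ ≤ R := by
    intro k
    by_contra! h
    obtain ⟨h1, h2⟩ := h
    rw [mem_union, not_or] at h1
    have h3 : s ((k + N : ℕ) : ℝ) ∈ c.Ψ.source := by
      rw [c.source_eq]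
      exact h1.2
    refine hs _ (Nat.cast_nonneg _) (hmono ?_ (hKR _ h1.1 h3 (h2 h3)))
    push_cast
    linarith [Nat.cast_nonneg (α := ℝ) k]
  obtain ⟨x, φ, hφ, hx⟩ := c.exists_tendsto_subseq g hcomplete hb hpush (hK.union c.isCompact_K₀) hR
    (s := fun k : ℕ => s ((k + N : ℕ) : ℝ)) hs'
  obtain ⟨Bx, -, hBx⟩ := hg.eventually_boundedGeometryAt hv0 hv x
  obtain ⟨N', hN'⟩ := exists_nat_ge Bx
  obtain ⟨k, hk1, hk2⟩ := ((hx.eventually hBx).and (eventually_ge_atTop N')).exists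
  refine hs _ (Nat.cast_nonneg _) (hmono ?_ hk1)
  have h1 : N' ≤ φ k + N := (hk2.trans (hφ.id_le k)).trans (Nat.le_add_right _ _)
  exact hN'.trans (by exact_mod_cast h1)

end Completeness

section Warping

variable {E : Type*} [NormedAddCommGroup E] [NormedSpace ℝ E] [FiniteDimensional ℝ E]
  {H : Type*} [TopologicalSpace H] {I : ModelWithCorners ℝ E H}
  {M : Type*} [TopologicalSpace M] [ChartedSpace H M] [IsManifold I ∞ M]
  {g : FormField I M} {u v : M → ℝ}

/-- Bounds on the first and second derivatives of the logarithm. -/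
theorem IsMetricAt.log_bounds {G : E → E →L[ℝ] E →L[ℝ] ℝ} {S : Set E} {y : E} (h : IsMetricAt G S y)
    {u : E → ℝ} (hu : ContDiffWithinAt ℝ 2 u S y) (hu0 : 0 < u y) {D : ℝ}
    (h1 : ∀ X, |fderivWithin ℝ u S y X| ≤ D * u y * √(G y X X))
    (h2 : ∀ X, |hess G S u y X X| ≤ D * u y * G y X X) (X : E) :
    |fderivWithin ℝ (fun z => Real.log (u z)) S y X| ≤ D * √(G y X X) ∧
    |hess G S (fun z => Real.log (u z)) y X X| ≤ (D + D ^ 2) * G y X X := by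
  obtain ⟨e1, e2⟩ := h.hess_comp hu (r := Real.log) (p := fun t => t⁻¹) (q := -(u y ^ 2)⁻¹)
    ((eventually_ne_nhds hu0.ne').mono fun t ht => Real.hasDerivAt_log ht) (hasDerivAt_inv hu0.ne')
  have hG := h.self.nonneg X
  have h1X := h1 X
  have h2X := h2 X
  have h3 : |(u y)⁻¹ * fderivWithin ℝ u S y X| ≤ D * √(G y X X) := by
    rw [abs_mul, abs_of_pos (inv_pos.2 hu0), inv_mul_le_iff₀ hu0]
    linarith
  have h4 : |(u y)⁻¹ * hess G S u y X X| ≤ D * G y X X := by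
    rw [abs_mul, abs_of_pos (inv_pos.2 hu0), inv_mul_le_iff₀ hu0]
    linarith
  refine ⟨by rw [e1]; exact h3, ?_⟩
  have h5 : hess G S (fun z => Real.log (u z)) y X X =
      (u y)⁻¹ * hess G S u y X X - ((u y)⁻¹ * fderivWithin ℝ u S y X) ^ 2 := by
    rw [e2]
    change (u y)⁻¹ * hess G S u y X X
      + -(u y ^ 2)⁻¹ * (fderivWithin ℝ u S y X * fderivWithin ℝ u S y X) = _
    rw [mul_pow, inv_pow]
    ring
  have h6 : ((u y)⁻¹ * fderivWithin ℝ u S y X) ^ 2 ≤ D ^ 2 * G y X X := by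
    rw [← sq_abs]
    refine (pow_le_pow_left₀ (abs_nonneg _) h3 2).trans_eq ?_
    rw [mul_pow, Real.sq_sqrt hG]
  have h7 := abs_le.1 h4
  have h8 := sq_nonneg ((u y)⁻¹ * fderivWithin ℝ u S y X)
  have h9 : 0 ≤ D ^ 2 * G y X X := by positivity
  rw [h5, abs_le]
  constructor <;> linarith

/-- The derivatives of a function with bounded difference from a function with bounded geometry. -/
theorem C2NormLE.warping_bounds (hg : IsRiemannian g)
    (hv : ContMDiff I 𝓘(ℝ, ℝ) 2 v) {A m B : ℝ} (hm : 0 < m) (hB : 0 ≤ B) (hu : ∀ x, m ≤ u x)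
    (hA : C2NormLE g (fun x => u x - v x) A) {x : M}
    (hBG : BoundedGeometryAt (formInChart g x) (range I) (coords I v x) B (extChartAt I x x)) (X : E) :
    |fderivWithin ℝ (coords I u x) (range I) (extChartAt I x x) X| ≤
      (A / m + B * (1 + A / m)) * u x * √(formInChart g x (extChartAt I x x) X X) ∧
    |hess (formInChart g x) (range I) (coords I u x) (extChartAt I x x) X X| ≤
      (A / m + B * (1 + A / m)) * u x * formInChart g x (extChartAt I x x) X X := by
  obtain ⟨hw, a₀, a₁, a₂, ha₀, ha₁, ha₂, hsum, hx⟩ := hA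
  obtain ⟨h0, h1, h2⟩ := hx x
  have hself := mem_extChartAt_source (I := I) x
  have hmet := hg.isMetricAt hself
  set w := fun x => u x - v x with hw'
  have hu' : coords I u x = fun z => coords I w x z + coords I v x z := by
    ext z
    simp [coords, hw']
  have hwc := contDiffWithinAt_coords (n := 2) isOpen_univ hw.contMDiffOn hself (mem_univ x)
  have hvc := contDiffWithinAt_coords (n := 2) isOpen_univ hv.contMDiffOn hself (mem_univ x)
  have hdw : ∀ X : E, diff (I := I) w x X = fderivWithin ℝ (coords I w x) (range I) (extChartAt I x x) X :=
    fun X => DFunLike.congr_fun (diff_eq (hw.mdifferentiable (by simp) x)) X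
  have hgx : ∀ X : E, g x X X = formInChart g x (extChartAt I x x) X X := fun X => by
    rw [formInChart_self]
    rfl
  have h1X : |fderivWithin ℝ (coords I w x) (range I) (extChartAt I x x) X| ≤
      a₁ * √(formInChart g x (extChartAt I x x) X X) := by
    rw [← hdw, ← hgx]
    exact h1 X
  have h2X : |hess (formInChart g x) (range I) (coords I w x) (extChartAt I x x) X X| ≤
      a₂ * √(formInChart g x (extChartAt I x x) X X) * √(formInChart g x (extChartAt I x x) X X) := by
    rw [← hgx]
    exact h2 X X
  obtain ⟨-, b1, b2⟩ := hBG X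
  rw [coords_extChartAt _ hself] at b1 b2
  have hG := hmet.self.nonneg X
  rw [mul_assoc, Real.mul_self_sqrt hG] at h2X
  have hA0 : 0 ≤ A := by linarith
  have hux := hu x
  have hu1 : 1 ≤ u x / m := (one_le_div hm).2 hux
  have hAu : A ≤ A / m * u x := by
    rw [div_mul_eq_mul_div, ← mul_div_assoc']
    exact le_mul_of_one_le_right hA0 hu1
  have hvu : v x ≤ (1 + A / m) * u x := by
    have e1 := neg_le_of_abs_le h0
    simp only [hw'] at e1
    linarith
  have key : ∀ {s t a r : ℝ}, 0 ≤ r → |s| ≤ a * r → a ≤ A → |t| ≤ B * v x * r →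
      |s + t| ≤ (A / m + B * (1 + A / m)) * u x * r := by
    intro s t a r hr hs ha ht
    refine (abs_add_le s t).trans ((add_le_add (hs.trans (mul_le_mul_of_nonneg_right
      (ha.trans hAu) hr)) (ht.trans (mul_le_mul_of_nonneg_right
      (mul_le_mul_of_nonneg_left hvu hB) hr))).trans_eq ?_)
    ring
  rw [hu', hmet.dom.fderivWithin_add hwc hvc hmet.mem, hmet.hess_add hwc hvc]
  exact ⟨key (Real.sqrt_nonneg _) h1X (by linarith) b1, key hG h2X (by linarith) b2⟩

end Warping

end WarpedGraph
end

theorem mainTheorem9 {n : ℕ} {H : Type*} [TopologicalSpace H]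
    (I : ModelWithCorners ℝ (EuclideanSpace ℝ (Fin n)) H)
    (M : Type*) [TopologicalSpace M] [T2Space M] [SecondCountableTopology M] [ChartedSpace H M]
    [IsManifold I ∞ M]
    (α : ℝ≥0) (hα₀ : 0 < α) (hα₁ : α < 1) (τ : ℝ) (hτ : 0 < τ)
    (g : Bundle.ContMDiffRiemannianMetric I 2 (EuclideanSpace ℝ (Fin n))
      (fun x : M => TangentSpace I x))
    (K : FormField I M)
    (hcomplete : IsCompleteMetric g.toRiemannianMetric)
    (c : ChartAtInfinity I M) (hAdS : IsAsymptoticallyAdS c 2 α τ g.inner K)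
    (ρ : M → ℝ) (hρ : IsExtensionOfRho c ρ)
    (A m C₀ : ℝ) (hm : 0 < m) :
    ∃ C : ℝ, 0 < C ∧
      ∀ u : M → ℝ, (∀ x, m ≤ u x) → C2NormLE g.inner (fun x => u x - (ρ x)⁻¹) A →
      ∀ (U : Set M) (f : M → ℝ), IsOpen U → ContMDiffOn I 𝓘(ℝ, ℝ) 3 f U →
      ∀ ν : (∀ x : M, TangentSpace (I.prod 𝓘(ℝ, ℝ)) (graphMap f x)),
        IsDownwardUnitNormal g.inner u f U ν →
      ∀ F : TangentBundle (I.prod 𝓘(ℝ, ℝ)) (M × ℝ) → ℝ,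
        ContMDiff (I.prod 𝓘(ℝ, ℝ)).tangent 𝓘(ℝ, ℝ) 1 F →
        C1NormLE (warpedMetric g.inner u) F C₀ →
        (∀ (x : M) (X : TangentSpace I x) (s : ℝ),
          Monotone fun t : ℝ => F ⟨(x, t), tangentVec (x, t) X s⟩) →
        (∀ x ∈ U, meanCurvature I (warpedMetric g.inner u) (graphMap f) ν x
          = F ⟨graphMap f x, ν x⟩) →
      ∀ x ∈ U,
        laplacian (graphMetric g.inner u f)
            (fun y => verticalPart g.inner u f ν y ^ (1 / 2 : ℝ)) x
          ≤ C * verticalPart g.inner u f ν x ^ (1 / 2 : ℝ) := by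
  have hg : IsRiemannian g.inner :=
    ⟨g.symm, g.pos, fun p => (hAdS.1.1 p).1⟩
  obtain ⟨B, hB, hBG⟩ := exists_uniform_boundedGeometryAt (g := g.toRiemannianMetric) hg hcomplete hτ
    hAdS.1.2 hρ
  have hv : ContMDiff I 𝓘(ℝ, ℝ) 2 (fun x => (ρ x)⁻¹) := hρ.2.1.inv₀ fun x => (hρ.1 x).ne'
  set D := A / m + B * (1 + A / m) with hD
  set b := B + D + D ^ 2 with hb
  set C := C₀ ^ 2 + C₀ * (1 + b) + 3 * b + 3 * b ^ 2
    + 2 * Module.finrank ℝ (EuclideanSpace ℝ (Fin n)) * b with hC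
  refine ⟨|C| + 1, by positivity, ?_⟩
  intro u hu hA U f hU hf ν hν F hF hFC hmono hH x hx
  have hu0 : ∀ x, 0 < u x := fun x => hm.trans_le (hu x)
  have hu2 : ContMDiff I 𝓘(ℝ, ℝ) 2 u := by
    refine (hA.1.add hv).congr fun x => ?_
    simp
  have hA0 : 0 ≤ A := by
    obtain ⟨-, a₀, a₁, a₂, h₀, h₁, h₂, h, -⟩ := hA
    linarith
  have hC₀ : 0 ≤ C₀ := by
    obtain ⟨a₀, a₁, h₀, h₁, h, -⟩ := hFC
    linarith
  have hD0 : 0 ≤ D := by positivity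
  have hself := mem_extChartAt_source (I := I) x
  have hmet := hg.isMetricAt hself
  have hgr := isGraphAt_chart hg hu0 hu2 hU hf hself hx
  have huc := contDiffWithinAt_coords (n := 2) isOpen_univ hu2.contMDiffOn hself (mem_univ x)
  have hux := coords_extChartAt (I := I) u hself
  have hwb := hA.warping_bounds hg hv hm hB hu (hBG x)
  have hlog := hmet.log_bounds huc (hux ▸ hu0 x) (D := D) (fun X => by rw [hux]; exact (hwb X).1)
    (fun X => by rw [hux]; exact (hwb X).2)
  obtain ⟨hH1, hH2⟩ := prescribed_bounds hg hu0 hu2 hU hf hν hF hFC hmono hH hx rfl rfl rfl rfl rfl rfl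
  have hmain := hgr.graphLap_sqrt_le (B := b) (by positivity) hC₀
    ((hBG x _).1.trans (mul_le_mul_of_nonneg_right (by rw [hb]; nlinarith) (hmet.self.nonneg _)))
    (fun X => (hlog X).1.trans (mul_le_mul_of_nonneg_right (by rw [hb]; nlinarith)
      (Real.sqrt_nonneg _)))
    (fun X => (hlog X).2.trans (mul_le_mul_of_nonneg_right (by rw [hb]; linarith)
      (hmet.self.nonneg X))) hH1 hH2
  rw [laplacian_graphMetric hg hu0 hu2 hU hf hν hx,
    (eq_graph hg hu0 hν hself hx (mdifferentiableAt_of_contMDiffOn (by simp) hU hf hx)).1,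
    ← Real.exp_mul, mul_one_div]
  exact hmain.trans (mul_le_mul_of_nonneg_right ((le_abs_self C).trans (by linarith))
    (Real.exp_pos _).le)
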